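/- Let $[\pm n]=\{-n,\dots,-1,1,\dots,n\}$. Let $B_n$ be the group of permutations $w$ of $[\pm n]$ with $w(-i)=-w(i)$ for all $i$, with the $n$ generators $s_0=(-1\ 1)$ and $s_i=(i\ \ i+1)(-i\ \ {-i-1})$ for $1\le i\le n-1$. Let $D_n\le B_n$ be the subgroup of those $w$ that send an even number of positive integers to negative integers, with the $n$ generators $s_0=(-1\ 2)(1\ {-2})$ and the same $s_i$ for $1\le i\le n-1$. For $W=B_n$ or $W=D_n$ and $w\in W$, let $\ell(w)$ be the minimal number of factors in an expression of $w$ as a product of these generators of $W$, and let $\mathrm{des}(w)=|\{i:\ \ell(ws_i)<\ell(w)\}|$. For $q\in(0,\infty)$, a random element $w$ of $W$ is Mallows distributed with parameter $q$ if $\mathbb P(w=w_0)=q^{\ell(w_0)}/\sum_{v\in W}q^{\ell(v)}$ for all $w_0\in W$. For real random variables $A,B$, the Wasserstein $1$-distance is $d_W(A,B)=\inf \mathbb E|A'-B'|$, the infimum being over all couplings $(A',B')$ of $A$ and $B$. Let $Z$ be a standard normal random variable. **Theorem.** Let $q\in(0,\infty)$, and let $\mu$ and $\sigma^2$ denote the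 mean and the variance of $\mathrm{des}(w)+\mathrm{des}(w^{-1})$. 1. If $n\ge 4$ and $w\in B_n$ is Mallows distributed with parameter $q$, then $$d_W\left(\frac{\mathrm{des}(w)+\mathrm{des}(w^{-1})-\mu}{\sigma},\,Z\right)\le\left(180+236\max(q^{-1/2},q^{1/2})\right)n^{-1/2}.$$ 2. If $n\ge 30$ and $w\in D_n$ is Mallows distributed with parameter $q$, then $$d_W\left(\frac{\mathrm{des}(w)+\mathrm{des}(w^{-1})-\mu}{\sigma},\,Z\right)\le\left(384+666\max(q^{-1/2},q^{1/2})\right)n^{-1/2}.$$ -/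

import Mathlib

open MeasureTheory ProbabilityTheory
open scoped ENNReal

namespace Mallows

section WordLength

variable {W ι : Type*} [Group W]

/-- The length of `w` with respect to a family `s` of generators (all of them involutions):
the minimal number of factors in an expression of `w` as a product of generators. -/
noncomputable def length (s : ι → W) (w : W) : ℕ :=
  sInf {k : ℕ | ∃ l : List ι, l.length = k ∧ (l.map s).prod = w}

/-- `w` has a (right) descent at the generator `s i`. -/
def IsDescent (s : ι → W) (w : W) (i : ι) : Prop :=
  length s (w * s i) < length s w

open Classical in
/-- The (right) descent statistic: the number of generators at which `w` has a descent. -/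
noncomputable def des [Fintype ι] (s : ι → W) (w : W) : ℕ :=
  (Finset.univ.filter fun i => IsDescent s w i).card

/-- The two-sided descent statistic `des(w) + des(w⁻¹)`. -/
noncomputable def twoSidedDes [Fintype ι] (s : ι → W) (w : W) : ℕ :=
  des s w + des s w⁻¹

/-- The random element `w` of the finite group `W`, defined on `(Ω, P)`, is Mallows distributed
with parameter `q`: `P(w = g) = q ^ ℓ(g) / ∑ h, q ^ ℓ(h)` for every `g`. -/
def IsMallows [Fintype W] {Ω : Type*} [MeasurableSpace Ω] (s : ι → W) (q : ℝ) (P : Measure Ω)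
    (w : Ω → W) : Prop :=
  Measurable[_, ⊤] w ∧
    ∀ g : W, P.real (w ⁻¹' {g}) = q ^ length s g / ∑ h : W, q ^ length s h

end WordLength

section SignedPermutations

/-- The set `[±n] = {-n, …, -1, 1, …, n}`. -/
abbrev PM (n : ℕ) : Type := {i : ℤ // i ∈ (Finset.Icc (-(n : ℤ)) n).erase 0}

namespace PM

variable {n : ℕ}

instance : Neg (PM n) :=
  ⟨fun i => ⟨-i.1, by
    have h := i.2
    simp only [Finset.mem_erase, Finset.mem_Icc] at h ⊢
    omega⟩⟩

@[simp] lemma coe_neg (i : PM n) : ((-i : PM n) : ℤ) = -(i : ℤ) := rfl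

@[simp] lemma neg_neg (i : PM n) : - -i = i := Subtype.ext (by simp)

lemma neg_inj {i j : PM n} : -i = -j ↔ i = j :=
  ⟨fun h => by rw [← neg_neg i, h, neg_neg], fun h => by rw [h]⟩

/-- The positive integer `k`, `1 ≤ k ≤ n`, as an element of `[±n]`. -/
def ofNat (k : ℕ) (h1 : 1 ≤ k) (h2 : k ≤ n) : PM n :=
  ⟨k, by simp only [Finset.mem_erase, Finset.mem_Icc]; omega⟩

@[simp] lemma coe_ofNat (k : ℕ) (h1 : 1 ≤ k) (h2 : k ≤ n) :
    ((ofNat k h1 h2 : PM n) : ℤ) = k := rfl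

lemma coe_ne_zero (i : PM n) : (i : ℤ) ≠ 0 := (Finset.mem_erase.mp i.2).1

end PM

/-- The hyperoctahedral group `B_n`: the permutations of `[±n]` with `w(-i) = -w(i)`. -/
def B (n : ℕ) : Subgroup (Equiv.Perm (PM n)) where
  carrier := {w | ∀ i, w (-i) = -w i}
  one_mem' _ := rfl
  mul_mem' {v w} hv hw i := by
    simp only [Set.mem_ofPred_eq] at hv hw
    simp [Equiv.Perm.mul_apply, hv, hw]
  inv_mem' {w} hw i := by
    simp only [Set.mem_ofPred_eq] at hw
    rw [Equiv.Perm.inv_eq_iff_eq, hw]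
    simp

lemma mem_B {n : ℕ} {w : Equiv.Perm (PM n)} : w ∈ B n ↔ ∀ i, w (-i) = -w i := Iff.rfl

/-- The number of positive elements of `[±n]` that `w` sends to negative ones. -/
noncomputable def negCount {n : ℕ} (w : Equiv.Perm (PM n)) : ℕ :=
  (Finset.univ.filter fun i : PM n => 0 < (i : ℤ) ∧ ((w i : PM n) : ℤ) < 0).card

/-- The set of positive elements of `[±n]`. -/
noncomputable def posPart (n : ℕ) : Finset (PM n) := Finset.univ.filter fun i : PM n => 0 < (i : ℤ)

lemma prod_sign {n : ℕ} (w : Equiv.Perm (PM n)) :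
    ∏ i ∈ posPart n, Int.sign (w i : ℤ) = (-1) ^ negCount w := by
  have h : ∀ i ∈ posPart n, Int.sign (w i : ℤ) = if ((w i : PM n) : ℤ) < 0 then -1 else 1 := by
    intro i _
    have h0 := PM.coe_ne_zero (w i)
    split_ifs with h
    · exact Int.sign_eq_neg_one_of_neg h
    · exact Int.sign_eq_one_of_pos (by omega)
  rw [Finset.prod_congr rfl h, Finset.prod_ite, Finset.prod_const, Finset.prod_const_one, mul_one,
    posPart, Finset.filter_filter]
  rfl

lemma prod_sign_mul {n : ℕ} {v w : Equiv.Perm (PM n)} (hv : v ∈ B n) (hw : w ∈ B n) :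
    ∏ i ∈ posPart n, Int.sign ((v * w) i : ℤ) =
      (∏ i ∈ posPart n, Int.sign (v i : ℤ)) * ∏ i ∈ posPart n, Int.sign (w i : ℤ) := by
  classical
  -- `a i = |w i|` is a permutation of the positive elements
  let a : PM n → PM n := fun i => if ((w i : PM n) : ℤ) < 0 then -(w i) else w i
  have ha : ∀ i ∈ posPart n, a i ∈ posPart n := by
    intro i _
    have h0 := PM.coe_ne_zero (w i)
    simp only [posPart, Finset.mem_filter, Finset.mem_univ, true_and, a]
    split_ifs with h
    · rw [PM.coe_neg]; omega
    · omega
  have hinj : Set.InjOn a (posPart n) := by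
    intro i hi j hj hij
    simp only [posPart, Finset.coe_filter, Finset.mem_univ, true_and, Set.mem_ofPred_eq] at hi hj
    simp only [a] at hij
    split_ifs at hij with h1 h2 h2
    · exact w.injective (PM.neg_inj.mp hij)
    · rw [← hw i] at hij
      have := congrArg (Subtype.val) (w.injective hij)
      rw [PM.coe_neg] at this; omega
    · rw [← hw j] at hij
      have := congrArg (Subtype.val) (w.injective hij)
      rw [PM.coe_neg] at this; omega
    · exact w.injective hij
  have himg : (posPart n).image a = posPart n :=
    Finset.eq_of_subset_of_card_le (Finset.image_subset_iff.mpr ha)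
      (Finset.card_image_of_injOn hinj).ge
  have hs : ∀ i ∈ posPart n, Int.sign ((v * w) i : ℤ) =
      Int.sign (v (a i) : ℤ) * Int.sign (w i : ℤ) := by
    intro i _
    have h0 := PM.coe_ne_zero (w i)
    simp only [a, Equiv.Perm.mul_apply]
    split_ifs with h
    · rw [hv, PM.coe_neg, Int.sign_neg, Int.sign_eq_neg_one_of_neg h]; ring
    · rw [Int.sign_eq_one_of_pos (a := (w i : ℤ)) (by omega)]; ring
  rw [Finset.prod_congr rfl hs, Finset.prod_mul_distrib]
  congr 1
  conv_rhs => rw [← himg]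
  rw [Finset.prod_image hinj]

lemma even_negCount_mul {n : ℕ} {v w : Equiv.Perm (PM n)} (hv : v ∈ B n) (hw : w ∈ B n) :
    Even (negCount (v * w)) ↔ Even (negCount v + negCount w) := by
  have h := prod_sign_mul hv hw
  rw [prod_sign, prod_sign, prod_sign, ← pow_add] at h
  rw [← neg_one_pow_eq_one_iff_even (R := ℤ) (by decide), h,
    neg_one_pow_eq_one_iff_even (by decide)]

lemma negCount_one (n : ℕ) : negCount (1 : Equiv.Perm (PM n)) = 0 := by
  rw [negCount, Finset.card_eq_zero, Finset.filter_eq_empty_iff]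
  intro i _
  simp only [Equiv.Perm.one_apply]
  omega

/-- The group `D_n` of even signed permutations: the elements of `B_n` that send an even number of
positive integers to negative integers. -/
def D (n : ℕ) : Subgroup (Equiv.Perm (PM n)) where
  carrier := {w | w ∈ B n ∧ Even (negCount w)}
  one_mem' := ⟨(B n).one_mem, by rw [negCount_one]; exact Even.zero⟩
  mul_mem' {v w} hv hw :=
    ⟨(B n).mul_mem hv.1 hw.1, (even_negCount_mul hv.1 hw.1).mpr (hv.2.add hw.2)⟩
  inv_mem' {w} hw := by
    refine ⟨(B n).inv_mem hw.1, ?_⟩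
    have h := even_negCount_mul hw.1 ((B n).inv_mem hw.1)
    rw [mul_inv_cancel, negCount_one, Nat.even_add] at h
    exact (h.mp Even.zero).mp hw.2

lemma mem_D {n : ℕ} {w : Equiv.Perm (PM n)} : w ∈ D n ↔ w ∈ B n ∧ Even (negCount w) := Iff.rfl

noncomputable instance (n : ℕ) : DecidablePred (· ∈ B n) := fun w =>
  inferInstanceAs (Decidable (∀ i, w (-i) = -w i))

noncomputable instance (n : ℕ) : DecidablePred (· ∈ D n) := fun w =>
  inferInstanceAs (Decidable (w ∈ B n ∧ Even (negCount w)))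

/-- The permutation `(a b)(-a -b)` of `[±n]`. -/
def doubleSwap {n : ℕ} (a b : PM n) : Equiv.Perm (PM n) :=
  Equiv.swap a b * Equiv.swap (-a) (-b)

lemma doubleSwap_mem_B {n : ℕ} {a b : PM n} (h : a ≠ -b) : doubleSwap a b ∈ B n := by
  intro i
  have ha := PM.coe_ne_zero a
  have hb := PM.coe_ne_zero b
  have hi := PM.coe_ne_zero i
  simp only [doubleSwap, Equiv.Perm.mul_apply, Equiv.swap_apply_def, ne_eq, Subtype.ext_iff,
    PM.coe_neg] at h ⊢
  split_ifs <;> simp only [PM.coe_neg] at * <;> omega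

/-- The generator `s_i = (i i+1)(-i -i-1)`, for `1 ≤ i ≤ n - 1`. -/
def adjSwap {n : ℕ} (i : ℕ) (h1 : 1 ≤ i) (h2 : i < n) : Equiv.Perm (PM n) :=
  doubleSwap (PM.ofNat i h1 h2.le) (PM.ofNat (i + 1) (by omega) h2)

lemma adjSwap_mem_D {n : ℕ} (i : ℕ) (h1 : 1 ≤ i) (h2 : i < n) : adjSwap i h1 h2 ∈ D n := by
  refine ⟨doubleSwap_mem_B ?_, ?_⟩
  · rw [ne_eq, Subtype.ext_iff]
    simp only [PM.coe_ofNat, PM.coe_neg]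
    omega
  · have : negCount (adjSwap i h1 h2) = 0 := by
      rw [negCount, Finset.card_eq_zero, Finset.filter_eq_empty_iff]
      intro x _
      simp only [adjSwap, doubleSwap, Equiv.Perm.mul_apply, Equiv.swap_apply_def, Subtype.ext_iff]
      split_ifs <;> simp_all <;> omega
    rw [this]; exact Even.zero

/-- The generators `s_0 = (-1 1)` and `s_i = (i i+1)(-i -i-1)`, `1 ≤ i ≤ n - 1`, of `B_n`. -/
def genB (n : ℕ) (i : Fin n) : B n :=
  if h : 1 ≤ i.1 then ⟨adjSwap i.1 h i.2, (adjSwap_mem_D i.1 h i.2).1⟩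
  else
    ⟨Equiv.swap (-PM.ofNat 1 le_rfl (by have := i.2; omega))
        (PM.ofNat 1 le_rfl (by have := i.2; omega)), by
      intro x
      simp only [Equiv.swap_apply_def, Subtype.ext_iff, PM.coe_neg, PM.coe_ofNat]
      split_ifs <;> simp_all <;> omega⟩

/-- The generator `s_0 = (-1 2)(1 -2)` of `D_n`. -/
def swapZeroD {n : ℕ} (hn : 2 ≤ n) : Equiv.Perm (PM n) :=
  doubleSwap (-PM.ofNat 1 le_rfl (by omega)) (PM.ofNat 2 (by omega) hn)

lemma swapZeroD_mem_D {n : ℕ} (hn : 2 ≤ n) : swapZeroD hn ∈ D n := by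
  refine ⟨doubleSwap_mem_B ?_, ?_⟩
  · rw [ne_eq, Subtype.ext_iff]
    simp
  · have : negCount (swapZeroD hn) = 2 := by
      rw [negCount, Finset.card_eq_two]
      refine ⟨PM.ofNat 1 le_rfl (by omega), PM.ofNat 2 (by omega) hn, ?_, ?_⟩
      · rw [ne_eq, Subtype.ext_iff]; simp
      · ext x
        have hx := PM.coe_ne_zero x
        simp only [Finset.mem_filter, Finset.mem_univ, true_and, Finset.mem_insert,
          Finset.mem_singleton, swapZeroD, doubleSwap, Equiv.Perm.mul_apply, Equiv.swap_apply_def,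
          Subtype.ext_iff]
        split_ifs <;> simp_all <;> omega
    rw [this]; exact even_two

/-- The generators `s_0 = (-1 2)(1 -2)` and `s_i = (i i+1)(-i -i-1)`, `1 ≤ i ≤ n - 1`, of `D_n`.
(For `n = 1` the group is trivial and `s_0` is set to `1`.) -/
def genD (n : ℕ) (i : Fin n) : D n :=
  if h : 1 ≤ i.1 then ⟨adjSwap i.1 h i.2, adjSwap_mem_D i.1 h i.2⟩
  else if hn : 2 ≤ n then ⟨swapZeroD hn, swapZeroD_mem_D hn⟩
  else 1

end SignedPermutations

section Probability

variable {Ω Ω' : Type*} [MeasurableSpace Ω] [MeasurableSpace Ω']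

/-- `Γ(A, B)`: the couplings of the real random variables `A` on `(Ω, P)` and `B` on `(Ω', Q)`,
as joint laws on `ℝ × ℝ` whose marginals are the laws of `A` and of `B`. -/
def couplings (P : Measure Ω) (A : Ω → ℝ) (Q : Measure Ω') (B : Ω' → ℝ) :
    Set (Measure (ℝ × ℝ)) :=
  {γ | γ.map Prod.fst = P.map A ∧ γ.map Prod.snd = Q.map B}

/-- The Wasserstein 1-distance `d_W(A, B) = inf E|A' - B'|` over the couplings `(A', B')`
of `(A, B)`, a value in `[0, ∞]`. -/
noncomputable def wassersteinOne (P : Measure Ω) (A : Ω → ℝ) (Q : Measure Ω') (B : Ω' → ℝ) :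
    ℝ≥0∞ :=
  ⨅ γ ∈ couplings P A Q B, ∫⁻ p : ℝ × ℝ, ENNReal.ofReal |p.1 - p.2| ∂γ

/-- The normalization `(X - μ) / σ` of a real random variable `X` with mean `μ` and
variance `σ²`. -/
noncomputable def normalized (P : Measure Ω) (X : Ω → ℝ) (ω : Ω) : ℝ :=
  (X ω - ∫ ω', X ω' ∂P) / √(variance X P)

end Probability

end Mallows

/-! Write T(w) = des(w) + des(w⁻¹). Right multiplication by s_i pairs the ascents at i with the
descents at i and multiplies the Mallows weight by q, so a descent at i is a Bernoulli(q/(1+q))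
event independent of the coset {w, w s_i}. This yields an exact integration by parts
(`malE_descent_sub`). The Mallows law is invariant under inversion, so it extends to T
(`malE_twoSidedDes_sub_mul`): E[(T − μ) F(T)] is 2q/(1+q)² times the expected sum over i of the
signed changes of F(T) across the edges {w, w s_i}. For linear F this reads σ² = 2q/(1+q)² · E J
with J = `totalJump`. For F a Stein solution, a Taylor expansion bounds the distance to the normal
law by the relative fluctuation √Var(J) / E J plus a remainder controlled by the squared jumps
(`stein_bound`).

It remains to see that E J is of order n uniformly in q, that Var J = O(n) and that single jumps are
bounded. Away from the ends, the jump of des at i is 1 minus two indicators that an entry is the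
median of three adjacent entries. Such an indicator has mean q/(1+q+q²) ≤ 1/3, and indicators over
disjoint windows are uncorrelated (`malE_med_mul`). The jump of des(w⁻¹) is 1 if w s_i w⁻¹ is again
a generator and 0 otherwise; the number of such i is, up to 3, the number of adjacent places
carrying consecutive integers (`gapSum`). Its variance is bounded by building w through independent
insertions of ±1, ±2, …, each of which moves the statistic by O(1) (`exists_insSum_sq_gapSum_le`).

On the analytic side, d_W is at most the L¹ distance of the distribution functions, which by duality
is tested against continuous g with |g| ≤ 1; each such g is the derivative of a test function with
an explicit Stein solution (`wassersteinOne_le_of_stein`). Types B and D are treated together by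
`IsRootSystem`, where the length counts the positive roots made negative. The parameter q survives
only through √(q/(1+q)²). -/

namespace Mallows

/-! ### Wasserstein distance and distribution functions. -/

section QuantileCoupling

open Set Filter Topology

/-- The quantile function of a probability measure on `ℝ`. -/
noncomputable def quantile (α : Measure ℝ) (u : ℝ) : ℝ := sInf {x | u ≤ cdf α x}

/-- Right continuity of the distribution function puts the infimum itself into the set, which makes
`quantile α` and `cdf α` a Galois connection. The condition 0 < u < 1 keeps the set nonempty and
bounded below. -/
lemma quantile_le_iff (α : Measure ℝ) {u : ℝ} (h0 : 0 < u) (h1 : u < 1) (x : ℝ) :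
    quantile α u ≤ x ↔ u ≤ cdf α x := by
  have hne : {x | u ≤ cdf α x}.Nonempty := by
    obtain ⟨y, hy⟩ := ((tendsto_cdf_atTop α).eventually (lt_mem_nhds h1)).exists
    exact ⟨y, hy.le⟩
  have hbdd : BddBelow {x | u ≤ cdf α x} := by
    obtain ⟨y, hy⟩ := ((tendsto_cdf_atBot α).eventually (gt_mem_nhds h0)).exists
    refine ⟨y, fun z hz => ?_⟩
    by_contra! hlt
    exact absurd (hz.trans (monotone_cdf α hlt.le)) (not_le.mpr hy)
  refine ⟨fun h => ?_, fun h => csInf_le hbdd h⟩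
  have hr : Tendsto (cdf α) (𝓝[>] x) (𝓝 (cdf α x)) :=
    ((cdf α).right_continuous x).tendsto.mono_left (nhdsWithin_mono _ Ioi_subset_Ici_self)
  refine ge_of_tendsto hr ?_
  filter_upwards [self_mem_nhdsWithin] with y hy
  obtain ⟨z, hz, hzy⟩ := (csInf_lt_iff hbdd hne).mp (lt_of_le_of_lt h hy)
  exact le_trans hz (monotone_cdf α hzy.le)

lemma aemeasurable_quantile (α : Measure ℝ) :
    AEMeasurable (quantile α) (volume.restrict (Ioo (0 : ℝ) 1)) := by
  refine aemeasurable_restrict_of_monotoneOn measurableSet_Ioo fun u hu v hv huv => ?_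
  rw [quantile_le_iff α hu.1 hu.2]
  exact huv.trans ((quantile_le_iff α hv.1 hv.2 _).mp le_rfl)

lemma map_quantile (α : Measure ℝ) [IsProbabilityMeasure α] :
    (volume.restrict (Ioo (0 : ℝ) 1)).map (quantile α) = α := by
  have : IsProbabilityMeasure (volume.restrict (Ioo (0 : ℝ) 1)) := ⟨by simp⟩
  have := Measure.isProbabilityMeasure_map (aemeasurable_quantile α)
  refine Measure.ext_of_Iic _ _ fun x => ?_
  rw [Measure.map_apply_of_aemeasurable (aemeasurable_quantile α) measurableSet_Iic,
    Measure.restrict_apply' measurableSet_Ioo, ← ofReal_cdf]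
  have h0 := cdf_nonneg α x
  have h1 := cdf_le_one α x
  have : quantile α ⁻¹' Iic x ∩ Ioo 0 1 = Iic (cdf α x) ∩ Ioo (0 : ℝ) 1 := by
    ext u
    simp only [mem_inter_iff, mem_preimage, mem_Iic, mem_Ioo, and_congr_left_iff]
    exact fun hu => quantile_le_iff α hu.1 hu.2 x
  rw [this]
  refine le_antisymm ?_ ?_
  · refine (measure_mono (t := Ioc 0 (cdf α x)) fun u hu => ⟨hu.2.1, hu.1⟩).trans ?_
    simp
  · refine le_trans ?_ (measure_mono (s := Ioo 0 (cdf α x)) fun u hu =>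
      ⟨hu.2.le, hu.1, hu.2.trans_le h1⟩)
    simp

lemma ofReal_abs_sub_eq_lintegral (a b : ℝ) :
    ENNReal.ofReal |a - b| = ∫⁻ x, (uIoc a b).indicator 1 x := by
  rw [lintegral_indicator_one measurableSet_uIoc, Real.volume_uIoc, abs_sub_comm]

variable {Ω Ω' : Type*} [MeasurableSpace Ω] [MeasurableSpace Ω']

/-- The quantile coupling bounds the Wasserstein distance by the `L¹` distance of the distribution
functions. -/
theorem wassersteinOne_le_lintegral_cdf (P : Measure Ω) [IsProbabilityMeasure P]
    (Q : Measure Ω') [IsProbabilityMeasure Q] {A : Ω → ℝ} {B : Ω' → ℝ}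
    (hA : AEMeasurable A P) (hB : AEMeasurable B Q) :
    wassersteinOne P A Q B ≤
      ∫⁻ x, ENNReal.ofReal |cdf (P.map A) x - cdf (Q.map B) x| := by
  have := Measure.isProbabilityMeasure_map hA
  have := Measure.isProbabilityMeasure_map hB
  set α := P.map A
  set β := Q.map B
  set lam := volume.restrict (Ioo (0 : ℝ) 1)
  have hα := aemeasurable_quantile α
  have hβ := aemeasurable_quantile β
  -- `S` is the region between the two graphs. Its slice at height u has length |quantile α u −
  -- quantile β u| up to a null set, its slice at x has length at most the difference of the
  -- distribution functions, and Tonelli compares the two. The coupling feeds the same uniform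
  -- variable into both quantile functions.
  let S : Set (ℝ × ℝ) := {p | ¬ (p.1 ≤ cdf α p.2 ↔ p.1 ≤ cdf β p.2)}
  have hS : MeasurableSet S := by
    have h1 : MeasurableSet {p : ℝ × ℝ | p.1 ≤ cdf α p.2} :=
      measurableSet_le measurable_fst ((monotone_cdf α).measurable.comp measurable_snd)
    have h2 : MeasurableSet {p : ℝ × ℝ | p.1 ≤ cdf β p.2} :=
      measurableSet_le measurable_fst ((monotone_cdf β).measurable.comp measurable_snd)
    exact (h1.iff h2).compl
  refine (iInf₂_le (lam.map fun u => (quantile α u, quantile β u)) ⟨?_, ?_⟩).trans ?_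
  rotate_left
  · rw [AEMeasurable.map_map_of_aemeasurable measurable_fst.aemeasurable (hα.prodMk hβ)]
    exact map_quantile α
  · rw [AEMeasurable.map_map_of_aemeasurable measurable_snd.aemeasurable (hα.prodMk hβ)]
    exact map_quantile β
  · rw [lintegral_map' (by fun_prop) (hα.prodMk hβ)]
    calc ∫⁻ u, ENNReal.ofReal |quantile α u - quantile β u| ∂lam
        = ∫⁻ u, (∫⁻ x, S.indicator 1 (u, x)) ∂lam := by
          refine setLIntegral_congr_fun (μ := volume) (s := Ioo (0 : ℝ) 1) measurableSet_Ioo fun u hu => ?_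
          rw [ofReal_abs_sub_eq_lintegral]
          have hne : ∀ᵐ x : ℝ, x ≠ quantile α u ∧ x ≠ quantile β u := by
            rw [eventually_and]
            exact ⟨Measure.ae_ne volume _, Measure.ae_ne volume _⟩
          refine lintegral_congr_ae ?_
          filter_upwards [hne] with x hx
          have : x ∈ uIoc (quantile α u) (quantile β u) ↔ (u, x) ∈ S := by
            simp only [S, mem_ofPred_eq]
            rw [← quantile_le_iff α hu.1 hu.2, ← quantile_le_iff β hu.1 hu.2, mem_uIoc]
            obtain ⟨h1, h2⟩ := hx
            rcases lt_or_gt_of_ne h1 with h1 | h1 <;> rcases lt_or_gt_of_ne h2 with h2 | h2 <;>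
              simp [h1.le, h2.le, h1.not_ge, h2.not_ge, h1, h2, h1.not_gt, h2.not_gt]
          by_cases h : (u, x) ∈ S
          · simp [h, this.mpr h]
          · simp [h, mt this.mp h]
      _ = ∫⁻ x, ∫⁻ u, S.indicator 1 (u, x) ∂lam := by
          exact lintegral_lintegral_swap (f := fun u x => S.indicator 1 (u, x))
            (measurable_one.indicator hS).aemeasurable
      _ ≤ _ := by
          refine lintegral_mono fun x => ?_
          have hm : MeasurableSet {u | (u, x) ∈ S} := measurable_prodMk_right hS
          have : (fun u => S.indicator (1 : ℝ × ℝ → ℝ≥0∞) (u, x)) =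
              {u | (u, x) ∈ S}.indicator 1 := rfl
          rw [this, lintegral_indicator_one hm, abs_sub_comm, ← Real.volume_uIoc]
          refine (Measure.restrict_apply_le _ _).trans (measure_mono fun u hu => ?_)
          simp only [S, mem_ofPred_eq] at hu
          rw [mem_uIoc]
          by_contra! hcon
          apply hu
          constructor <;> intro h <;> by_contra! h'
          · exact absurd h (not_le.mpr (hcon.2 h'))
          · exact absurd h (not_le.mpr (hcon.1 h'))

end QuantileCoupling

/-! ### Iterated Gaussian tail integrals. -/

section GaussianTails

open Set Filter Topology

/-- The unnormalized standard Gaussian density. -/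
noncomputable def gphi (x : ℝ) : ℝ := Real.exp (-x ^ 2 / 2)

lemma gphi_pos (x : ℝ) : 0 < gphi x := Real.exp_pos _

lemma gphi_neg (x : ℝ) : gphi (-x) = gphi x := by simp [gphi]

lemma hasDerivAt_gphi (x : ℝ) : HasDerivAt gphi (-x * gphi x) x := by
  have h : HasDerivAt (fun x : ℝ => -x ^ 2 / 2) (-x) x := by
    exact (((hasDerivAt_pow 2 x).neg).div_const 2).congr_deriv (by simp; ring)
  exact h.exp.congr_deriv (by simp [gphi, mul_comm])

lemma continuous_gphi : Continuous gphi := by unfold gphi; fun_prop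

lemma gphi_eq (x : ℝ) : gphi x = Real.exp (-(1 / 2) * x ^ 2) := by
  unfold gphi; ring_nf

lemma integrable_gphi : Integrable gphi :=
  (integrable_exp_neg_mul_sq (b := 1 / 2) (by norm_num)).congr
    (Eventually.of_forall fun x => (gphi_eq x).symm)

lemma integrable_mul_gphi : Integrable fun x => x * gphi x :=
  (integrable_mul_exp_neg_mul_sq (b := 1 / 2) (by norm_num)).congr
    (Eventually.of_forall fun x => by simp only [gphi_eq])

/-- The constant `√(2π)`. -/
noncomputable def kap : ℝ := √(2 * Real.pi)

lemma kap_pos : 0 < kap := by unfold kap; positivity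

lemma integral_gphi : ∫ x, gphi x = kap := by
  simp_rw [gphi_eq]
  rw [integral_gaussian, kap]
  congr 1
  ring

lemma tendsto_gphi_atTop : Tendsto gphi atTop (𝓝 0) := by
  unfold gphi
  refine Real.tendsto_exp_atBot.comp ?_
  have := (tendsto_pow_atTop (α := ℝ) (n := 2) two_ne_zero).atTop_div_const (r := 2) (by norm_num)
  refine (tendsto_neg_atTop_atBot.comp this).congr fun x => ?_
  simp only [Function.comp]; ring

lemma tendsto_mul_gphi_atTop : Tendsto (fun x => x * gphi x) atTop (𝓝 0) := by
  have h2 : Tendsto (fun x : ℝ => x ^ 1 * Real.exp (-x)) atTop (𝓝 0) :=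
    Real.tendsto_pow_mul_exp_neg_atTop_nhds_zero 1
  refine tendsto_of_tendsto_of_tendsto_of_le_of_le' tendsto_const_nhds h2 ?_ ?_
  · filter_upwards [eventually_ge_atTop 0] with x hx using mul_nonneg hx (gphi_pos x).le
  · filter_upwards [eventually_ge_atTop 2] with x hx
    rw [pow_one]
    refine mul_le_mul_of_nonneg_left (Real.exp_le_exp.mpr ?_) (by linarith)
    nlinarith

lemma hasDerivAt_integral_Ioi {f : ℝ → ℝ} (hf : Continuous f)
    (hi : ∀ x, IntegrableOn f (Ioi x)) (x : ℝ) :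
    HasDerivAt (fun x => ∫ t in Ioi x, f t) (-f x) x := by
  have h : ∀ y, ∫ t in Ioi y, f t = (∫ t in Ioi x, f t) - ∫ t in x..y, f t := fun y => by
    rw [← intervalIntegral.integral_Ioi_sub_Ioi' (hi x) (hi y)]; ring
  have h2 : HasDerivAt (fun y => ∫ t in x..y, f t) (f x) x :=
    intervalIntegral.integral_hasDerivAt_right (hf.intervalIntegrable _ _)
      (hf.stronglyMeasurableAtFilter _ _) hf.continuousAt
  simpa [funext h] using h2.const_sub (∫ t in Ioi x, f t)

/-- The upper Gaussian tail. -/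
noncomputable def gB (x : ℝ) : ℝ := ∫ t in Ioi x, gphi t

lemma hasDerivAt_gB (x : ℝ) : HasDerivAt gB (-gphi x) x :=
  hasDerivAt_integral_Ioi continuous_gphi (fun _ => integrable_gphi.integrableOn) x

lemma continuous_gB : Continuous gB :=
  continuous_iff_continuousAt.mpr fun x => (hasDerivAt_gB x).continuousAt

lemma gB_nonneg (x : ℝ) : 0 ≤ gB x :=
  setIntegral_nonneg measurableSet_Ioi fun t _ => (gphi_pos t).le

lemma gB_add_gB_neg (x : ℝ) : gB x + gB (-x) = kap := by
  have h : gB (-x) = ∫ t in Iic x, gphi t := by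
    unfold gB
    rw [← integral_comp_neg_Iic]
    simp_rw [gphi_neg]
  rw [h, ← integral_gphi, add_comm, gB]
  exact intervalIntegral.integral_Iic_add_Ioi integrable_gphi.integrableOn
    integrable_gphi.integrableOn

lemma integral_Ioi_mul_gphi (x : ℝ) : ∫ t in Ioi x, t * gphi t = gphi x := by
  have := integral_Ioi_of_hasDerivAt_of_tendsto' (f := fun t => -gphi t) (f' := fun t => t * gphi t)
    (a := x) (m := 0) (fun t _ => (hasDerivAt_gphi t).neg.congr_deriv (by simp))
    integrable_mul_gphi.integrableOn (by simpa using tendsto_gphi_atTop.neg)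
  simpa using this

/-- The integrated upper Gaussian tail `∫_x^∞ gB`, in closed form. -/
noncomputable def gb (x : ℝ) : ℝ := gphi x - x * gB x

/-- `gb x` is the integral of (t − x) `gphi` t over t > x. -/
lemma gb_nonneg (x : ℝ) : 0 ≤ gb x := by
  rw [gb, ← integral_Ioi_mul_gphi, gB, ← integral_const_mul, ← integral_sub
    integrable_mul_gphi.integrableOn (integrable_gphi.integrableOn.const_mul _)]
  refine setIntegral_nonneg measurableSet_Ioi fun t ht => ?_
  rw [← sub_mul]
  exact mul_nonneg (by linarith [mem_Ioi.mp ht]) (gphi_pos t).le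

lemma hasDerivAt_gb (x : ℝ) : HasDerivAt gb (-gB x) x := by
  exact ((hasDerivAt_gphi x).sub ((hasDerivAt_id x).mul (hasDerivAt_gB x))).congr_deriv (by simp)

lemma gb_le_gphi {x : ℝ} (hx : 0 ≤ x) : gb x ≤ gphi x := by
  have := mul_nonneg hx (gB_nonneg x)
  unfold gb; linarith

lemma tendsto_gb_atTop : Tendsto gb atTop (𝓝 0) :=
  tendsto_of_tendsto_of_tendsto_of_le_of_le' tendsto_const_nhds tendsto_gphi_atTop
    (Eventually.of_forall gb_nonneg) ((eventually_ge_atTop 0).mono fun _ hx => gb_le_gphi hx)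

lemma integrableOn_gB (x : ℝ) : IntegrableOn gB (Ioi x) := by
  have := (integrableOn_Ioi_deriv_of_nonpos' (a := x) (fun t _ => hasDerivAt_gb t)
    (fun t _ => by simpa using gB_nonneg t) tendsto_gb_atTop).neg
  simpa using this

lemma integral_gB (x : ℝ) : ∫ t in Ioi x, gB t = gb x := by
  have := integral_Ioi_of_hasDerivAt_of_tendsto' (f := fun t => -gb t) (f' := gB)
    (a := x) (m := 0) (fun t _ => (hasDerivAt_gb t).neg.congr_deriv (by simp))
    (integrableOn_gB x) (by simpa using tendsto_gb_atTop.neg)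
  simpa using this

lemma tendsto_gB_atTop : Tendsto gB atTop (𝓝 0) := by
  refine tendsto_of_tendsto_of_tendsto_of_le_of_le' tendsto_const_nhds tendsto_gphi_atTop
    (Eventually.of_forall gB_nonneg) ((eventually_ge_atTop 1).mono fun x hx => ?_)
  have h1 := gb_nonneg x
  have h2 := gB_nonneg x
  unfold gb at h1
  nlinarith

/-- Twice the doubly integrated upper Gaussian tail, in closed form. -/
noncomputable def gc (x : ℝ) : ℝ := gB x - x * gb x

/-- `gc` has derivative −2 `gb` ≤ 0 and tends to 0 at +∞. -/
lemma gc_nonneg (x : ℝ) : 0 ≤ gc x := by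
  have hd : ∀ x, HasDerivAt gc (-2 * gb x) x := fun x => by
    refine ((hasDerivAt_gB x).sub ((hasDerivAt_id x).mul (hasDerivAt_gb x))).congr_deriv ?_
    simp only [gb, id]; ring
  have hanti : Antitone gc := antitone_of_deriv_nonpos (fun x => (hd x).differentiableAt)
    fun x => by rw [(hd x).deriv]; linarith [gb_nonneg x]
  have hlim : Tendsto gc atTop (𝓝 0) := by
    have : Tendsto (fun x => x * gb x) atTop (𝓝 0) :=
      tendsto_of_tendsto_of_tendsto_of_le_of_le' tendsto_const_nhds tendsto_mul_gphi_atTop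
        ((eventually_ge_atTop 0).mono fun x hx => mul_nonneg hx (gb_nonneg x))
        ((eventually_ge_atTop 0).mono fun x hx => mul_le_mul_of_nonneg_left (gb_le_gphi hx) hx)
    have h : Tendsto (fun x => gB x - x * gb x) atTop (𝓝 0) := by
      simpa using tendsto_gB_atTop.sub this
    exact h
  exact hanti.le_of_tendsto hlim x

/-- This identity and the next evaluate exactly the expressions obtained when the head and tail
integrals of `g` are replaced by their bounds; the denominators of the Stein solution then cancel.
-/
lemma gB_mul_gb_add (x : ℝ) : gB (-x) * gb x + gB x * gb (-x) = kap * gphi x := by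
  rw [← gB_add_gB_neg x, gb, gb, gphi_neg]; ring

lemma gb_mul_gc_add (x : ℝ) : gb (-x) * gc x + gb x * gc (-x) = kap * gphi x := by
  rw [← gB_mul_gb_add x, gc, gc]; ring

end GaussianTails

/-! ### The Stein equation and bounds on its solution. -/

section SteinSolution

open Set Filter Topology

/-- The upper tail integral `∫_x^∞ g gB`. -/
noncomputable def tailInt (g : ℝ → ℝ) (x : ℝ) : ℝ := ∫ t in Ioi x, g t * gB t

variable {g : ℝ → ℝ}

lemma integrableOn_mul_gB (hg : Continuous g) (hg1 : ∀ x, |g x| ≤ 1) (x : ℝ) :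
    IntegrableOn (fun t => g t * gB t) (Ioi x) :=
  (integrableOn_gB x).mono' (hg.mul continuous_gB).aestronglyMeasurable
    (Eventually.of_forall fun t => by
      rw [Real.norm_eq_abs, abs_mul, abs_of_nonneg (gB_nonneg t)]
      exact mul_le_of_le_one_left (gB_nonneg t) (hg1 t))

lemma hasDerivAt_tailInt (hg : Continuous g) (hg1 : ∀ x, |g x| ≤ 1) (x : ℝ) :
    HasDerivAt (tailInt g) (-(g x * gB x)) x :=
  hasDerivAt_integral_Ioi (hg.mul continuous_gB) (integrableOn_mul_gB hg hg1) x

lemma abs_tailInt_le (hg1 : ∀ x, |g x| ≤ 1) (x : ℝ) :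
    |tailInt g x| ≤ gb x := by
  rw [← integral_gB, ← Real.norm_eq_abs]
  refine norm_integral_le_of_norm_le (integrableOn_gB x) (Eventually.of_forall fun t => ?_)
  rw [Real.norm_eq_abs, abs_mul, abs_of_nonneg (gB_nonneg t)]
  exact mul_le_of_le_one_left (gB_nonneg t) (hg1 t)

/-- The lower tail integral `∫_{-∞}^x g(t) gB(-t) dt`. -/
noncomputable def headInt (g : ℝ → ℝ) (x : ℝ) : ℝ := tailInt (fun t => g (-t)) (-x)

lemma hasDerivAt_headInt (hg : Continuous g) (hg1 : ∀ x, |g x| ≤ 1) (x : ℝ) :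
    HasDerivAt (headInt g) (g x * gB (-x)) x := by
  exact ((hasDerivAt_tailInt (g := fun t => g (-t)) (hg.comp continuous_neg)
    (fun x => hg1 (-x)) (-x)).comp x (hasDerivAt_neg x)).congr_deriv (by simp)

lemma abs_headInt_le (hg1 : ∀ x, |g x| ≤ 1) (x : ℝ) :
    |headInt g x| ≤ gb (-x) :=
  abs_tailInt_le (g := fun t => g (-t)) (fun x => hg1 (-x)) (-x)

/-- The solution of the Stein equation for a test function with derivative `g`. -/
noncomputable def steinSol (g : ℝ → ℝ) (x : ℝ) : ℝ :=
  -(gB x * headInt g x + gB (-x) * tailInt g x) / (kap * gphi x)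

/-- The derivative of `steinSol`. -/
noncomputable def steinSol' (g : ℝ → ℝ) (x : ℝ) : ℝ :=
  (headInt g x * gb x - tailInt g x * gb (-x)) / (kap * gphi x)

lemma hasDerivAt_gB_neg (x : ℝ) : HasDerivAt (fun x => gB (-x)) (gphi x) x := by
  exact ((hasDerivAt_gB (-x)).comp x (hasDerivAt_neg x)).congr_deriv (by simp [gphi_neg])

lemma hasDerivAt_gb_neg (x : ℝ) : HasDerivAt (fun x => gb (-x)) (gB (-x)) x := by
  exact ((hasDerivAt_gb (-x)).comp x (hasDerivAt_neg x)).congr_deriv (by simp)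

lemma hasDerivAt_steinSol (hg : Continuous g) (hg1 : ∀ x, |g x| ≤ 1) (x : ℝ) :
    HasDerivAt (steinSol g) (steinSol' g x) x := by
  have hk := kap_pos.ne'
  have hp := (gphi_pos x).ne'
  have h := ((((hasDerivAt_gB x).mul (hasDerivAt_headInt hg hg1 x)).add
    ((hasDerivAt_gB_neg x).mul (hasDerivAt_tailInt hg hg1 x))).neg).div
    ((hasDerivAt_gphi x).const_mul kap) (mul_ne_zero hk hp)
  refine h.congr_deriv ?_
  simp only [steinSol', gb, gphi_neg, Pi.mul_apply, Pi.add_apply, Pi.neg_apply]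
  field_simp
  ring

lemma hasDerivAt_steinSol' (hg : Continuous g) (hg1 : ∀ x, |g x| ≤ 1) (x : ℝ) :
    HasDerivAt (steinSol' g)
      (g x - (headInt g x * gc x + tailInt g x * gc (-x)) / (kap * gphi x)) x := by
  have hk := kap_pos.ne'
  have hp := (gphi_pos x).ne'
  have h := (((hasDerivAt_headInt hg hg1 x).mul (hasDerivAt_gb x)).sub
    ((hasDerivAt_tailInt hg hg1 x).mul (hasDerivAt_gb_neg x))).div
    ((hasDerivAt_gphi x).const_mul kap) (mul_ne_zero hk hp)
  refine h.congr_deriv ?_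
  have := gB_mul_gb_add x
  have hG : g x = g x * (gB (-x) * gb x + gB x * gb (-x)) / (kap * gphi x) := by
    rw [this]; field_simp
  conv_rhs => rw [hG]
  simp only [gc, Pi.mul_apply, Pi.sub_apply]
  field_simp
  ring

lemma abs_steinSol_le (hg1 : ∀ x, |g x| ≤ 1) (x : ℝ) : |steinSol g x| ≤ 1 := by
  have hpos : 0 < kap * gphi x := mul_pos kap_pos (gphi_pos x)
  rw [steinSol, abs_div, abs_of_pos hpos, div_le_one hpos, abs_neg, ← gB_mul_gb_add]
  refine (abs_add_le _ _).trans ?_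
  rw [abs_mul, abs_mul, abs_of_nonneg (gB_nonneg _), abs_of_nonneg (gB_nonneg _)]
  have h1 := mul_le_mul_of_nonneg_left (abs_headInt_le hg1 x) (gB_nonneg x)
  have h2 := mul_le_mul_of_nonneg_left (abs_tailInt_le hg1 x) (gB_nonneg (-x))
  linarith

/-- The second derivative is `g` minus a quotient which `gb_mul_gc_add` bounds by 1. -/
lemma lipschitzWith_steinSol' (hg : Continuous g) (hg1 : ∀ x, |g x| ≤ 1) :
    LipschitzWith 2 (steinSol' g) := by
  refine lipschitzWith_of_nnnorm_deriv_le
    (fun x => (hasDerivAt_steinSol' hg hg1 x).differentiableAt) fun x => ?_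
  rw [(hasDerivAt_steinSol' hg hg1 x).deriv, ← NNReal.coe_le_coe, coe_nnnorm, Real.norm_eq_abs]
  have hpos : 0 < kap * gphi x := mul_pos kap_pos (gphi_pos x)
  have : |(headInt g x * gc x + tailInt g x * gc (-x)) / (kap * gphi x)| ≤ 1 := by
    rw [abs_div, abs_of_pos hpos, div_le_one hpos, ← gb_mul_gc_add]
    refine (abs_add_le _ _).trans ?_
    rw [abs_mul, abs_mul, abs_of_nonneg (gc_nonneg _), abs_of_nonneg (gc_nonneg _)]
    have h1 := mul_le_mul_of_nonneg_right (abs_headInt_le hg1 x) (gc_nonneg x)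
    have h2 := mul_le_mul_of_nonneg_right (abs_tailInt_le hg1 x) (gc_nonneg (-x))
    linarith
  have h3 := abs_sub (g x) ((headInt g x * gc x + tailInt g x * gc (-x)) / (kap * gphi x))
  have h4 := hg1 x
  push_cast
  linarith

/-- A Taylor bound for functions with Lipschitz derivative. -/
lemma abs_sub_sub_mul_le {f f' : ℝ → ℝ} (hf : ∀ x, HasDerivAt f (f' x) x) {K : NNReal}
    (hL : LipschitzWith K f') (a b t : ℝ) (ht : t = a ∨ t = b) :
    |f b - f a - f' t * (b - a)| ≤ K * (b - a) ^ 2 := by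
  wlog hab : a < b generalizing a b
  · rcases eq_or_lt_of_le (not_lt.mp hab) with rfl | h
    · simp
    · have := this b a ht.symm h
      rw [show f b - f a - f' t * (b - a) = -(f a - f b - f' t * (a - b)) by ring, abs_neg]
      exact this.trans_eq (by ring)
  obtain ⟨c, hc, hc'⟩ := exists_hasDerivAt_eq_slope f f' hab
    (fun x _ => (hf x).continuousAt.continuousWithinAt) (fun x _ => hf x)
  have hba : 0 < b - a := sub_pos.mpr hab
  have h1 : f b - f a = f' c * (b - a) := by rw [hc']; field_simp
  have h2 : |f' c - f' t| ≤ K * |c - t| := by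
    simpa [Real.dist_eq] using hL.dist_le_mul c t
  have h3 : |c - t| ≤ b - a := by
    rw [abs_le]
    rcases ht with rfl | rfl <;> constructor <;> linarith [hc.1, hc.2]
  rw [h1, ← sub_mul, abs_mul, abs_of_pos hba]
  have h4 : |f' c - f' t| ≤ K * (b - a) :=
    h2.trans (mul_le_mul_of_nonneg_left h3 K.coe_nonneg)
  calc _ ≤ K * (b - a) * (b - a) := mul_le_mul_of_nonneg_right h4 hba.le
    _ = _ := by ring

lemma two_le_kap : 2 ≤ kap := by
  unfold kap
  exact Real.le_sqrt_of_sq_le (by nlinarith [Real.pi_gt_three])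

/-- Nonnegativity of `gc` gives (1 + x²) `gb x` ≤ `gphi x`, while `gb (-x)` ≤ 1 + x `kap` ≤ `kap` (1
+ x²); the factors 1 + x² cancel. -/
lemma two_mul_gb_mul_gb_le {x : ℝ} (hx : 0 ≤ x) : 2 * (gb (-x) * gb x) ≤ 2 * (kap * gphi x) := by
  have hk := two_le_kap
  have hB : gB (-x) ≤ kap := by linarith [gB_add_gB_neg x, gB_nonneg x]
  have hp1 : gphi x ≤ 1 := Real.exp_le_one_iff.mpr (by nlinarith)
  have h1 : gb (-x) ≤ 1 + x * kap := by
    unfold gb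
    rw [gphi_neg]
    nlinarith [mul_le_mul_of_nonneg_left hB hx]
  have h2 : (1 + x ^ 2) * gb x ≤ gphi x := by
    have := mul_nonneg hx (gc_nonneg x)
    unfold gc at this
    have h : gb x = gphi x - x * gB x := rfl
    nlinarith
  have h3 : 1 + x * kap ≤ kap * (1 + x ^ 2) := by nlinarith [sq_nonneg (2 * x - 1)]
  have h4 : gb (-x) * gb x ≤ kap * (1 + x ^ 2) * gb x :=
    mul_le_mul_of_nonneg_right (h1.trans h3) (gb_nonneg x)
  nlinarith [mul_le_mul_of_nonneg_left h2 kap_pos.le]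

lemma abs_steinSol'_le (hg1 : ∀ x, |g x| ≤ 1) (x : ℝ) :
    |steinSol' g x| ≤ 2 := by
  have hpos : 0 < kap * gphi x := mul_pos kap_pos (gphi_pos x)
  rw [steinSol', abs_div, abs_of_pos hpos, div_le_iff₀ hpos]
  have h0 : 2 * (gb (-x) * gb x) ≤ 2 * (kap * gphi x) := by
    rcases le_total 0 x with hx | hx
    · exact two_mul_gb_mul_gb_le hx
    · have := two_mul_gb_mul_gb_le (neg_nonneg.mpr hx)
      rwa [neg_neg, gphi_neg, mul_comm (gb x)] at this
  refine (abs_sub _ _).trans (le_trans ?_ h0)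
  rw [abs_mul, abs_mul, abs_of_nonneg (gb_nonneg _), abs_of_nonneg (gb_nonneg _)]
  have h1 := mul_le_mul_of_nonneg_right (abs_headInt_le hg1 x) (gb_nonneg x)
  have h2 := mul_le_mul_of_nonneg_right (abs_tailInt_le hg1 x) (gb_nonneg (-x))
  linarith

end SteinSolution

/-! ### Duality for the L¹ distance and Stein's method. -/

section SteinMethod

open Set Filter Topology

variable {g : ℝ → ℝ}

/-- The right side is h(x) − E h(Z) for any h with derivative `g`. It is kept in this form to match
`integral_mul_cdfDiff`, where no antiderivative of `g` is needed. -/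
lemma steinSol'_sub_mul (g : ℝ → ℝ) (x : ℝ) :
    steinSol' g x - x * steinSol g x = (headInt g x - tailInt g x) / kap := by
  have hk := kap_pos.ne'
  have hp := (gphi_pos x).ne'
  simp only [steinSol', steinSol, gb, gphi_neg]
  field_simp
  ring

lemma headInt_eq (g : ℝ → ℝ) (x : ℝ) : headInt g x = ∫ t in Iic x, g t * gB (-t) := by
  have := integral_comp_neg_Ioi (-x) (fun t => g t * gB (-t))
  simpa [headInt, tailInt] using this

lemma integrableOn_Iic_mul_gB (hg : Continuous g) (hg1 : ∀ x, |g x| ≤ 1) (x : ℝ) :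
    IntegrableOn (fun t => g t * gB (-t)) (Iic x) := by
  have h := integrableOn_mul_gB (g := fun t => g (-t)) (hg.comp continuous_neg)
    (fun x => hg1 (-x)) (-x)
  have h2 := (Measure.measurePreserving_neg (volume : Measure ℝ)).integrableOn_comp_preimage
    (Homeomorph.neg ℝ).measurableEmbedding (f := fun t => g (-t) * gB t) (s := Ioi (-x))
  have h3 := h2.mpr h
  have h4 : (Neg.neg ⁻¹' Ioi (-x) : Set ℝ) = Iio x := by ext; simp
  rw [h4] at h3
  refine (integrableOn_Iic_iff_integrableOn_Iio).mpr (h3.congr_fun (fun t _ => ?_) measurableSet_Iio)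
  simp

lemma cdf_gaussianReal (t : ℝ) : cdf (gaussianReal 0 1) t = gB (-t) / kap := by
  have h0 : ∫ x in Iic t, gaussianPDFReal 0 1 x = gB (-t) / kap := by
    have h1 : ∀ x, gaussianPDFReal 0 1 x = kap⁻¹ * gphi x := fun x => by
      simp [gaussianPDFReal, kap, gphi]
    simp_rw [h1]
    rw [integral_const_mul, gB, div_eq_inv_mul, ← integral_comp_neg_Iic]
    simp_rw [gphi_neg]
  rw [cdf_eq_real, Measure.real, gaussianReal_apply_eq_integral _ one_ne_zero,
    h0, ENNReal.toReal_ofReal (div_nonneg (gB_nonneg _) kap_pos.le)]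

/-- The difference of the distribution functions of the standard Gaussian and of a Dirac mass. -/
noncomputable def cdfDiff (x t : ℝ) : ℝ := gB (-t) / kap - if x ≤ t then 1 else 0

lemma integral_mul_cdfDiff (hg : Continuous g) (hg1 : ∀ x, |g x| ≤ 1) (x : ℝ) :
    Integrable (fun t => g t * cdfDiff x t) ∧
      ∫ t, g t * cdfDiff x t = (headInt g x - tailInt g x) / kap := by
  have hk := kap_pos.ne'
  have h1 : EqOn (fun t => g t * gB (-t) / kap) (fun t => g t * cdfDiff x t) (Iio x) :=
    fun t ht => by simp [cdfDiff, not_le.mpr (mem_Iio.mp ht), mul_div_assoc]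
  have h2 : EqOn (fun t => -(g t * gB t) / kap) (fun t => g t * cdfDiff x t) (Ioi x) :=
    fun t ht => by
      have := gB_add_gB_neg t
      simp only [cdfDiff, (mem_Ioi.mp ht).le, if_true]
      rw [show gB (-t) = kap - gB t by linarith]
      field_simp
      ring
  have i1 : IntegrableOn (fun t => g t * cdfDiff x t) (Iic x) := by
    rw [integrableOn_Iic_iff_integrableOn_Iio]
    exact IntegrableOn.congr_fun (((integrableOn_Iic_mul_gB hg hg1 x).mono_set
      Iio_subset_Iic_self).div_const kap) h1 measurableSet_Iio
  have i2 : IntegrableOn (fun t => g t * cdfDiff x t) (Ioi x) :=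
    IntegrableOn.congr_fun ((integrableOn_mul_gB hg hg1 x).neg.div_const kap) h2 measurableSet_Ioi
  refine ⟨by simpa using i1.union i2, ?_⟩
  rw [← intervalIntegral.integral_Iic_add_Ioi i1 i2, integral_Iic_eq_integral_Iio,
    ← setIntegral_congr_fun measurableSet_Iio h1, ← setIntegral_congr_fun measurableSet_Ioi h2,
    integral_div, integral_div, integral_neg, headInt_eq, tailInt, integral_Iic_eq_integral_Iio]
  ring

lemma integrable_cdfDiff (x : ℝ) : Integrable (cdfDiff x) := by
  simpa using (integral_mul_cdfDiff (g := fun _ => 1) continuous_const (by simp) x).1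

/-- An integrable function whose integrals against continuous functions bounded by `1` are at most
`ε` has `L¹` norm at most `ε`. -/
lemma integral_abs_le_of_forall_continuous {D : ℝ → ℝ} (hD : Integrable D) {ε : ℝ}
    (h : ∀ g : ℝ → ℝ, Continuous g → (∀ x, |g x| ≤ 1) → ∫ t, g t * D t ≤ ε) :
    ∫ t, |D t| ≤ ε := by
  refine le_of_forall_pos_le_add fun η hη => ?_
  obtain ⟨u, hu, huD, huc, hui⟩ := hD.exists_hasCompactSupport_integral_sub_le (ε := η / 4)
    (by positivity)
  set K := tsupport u
  have hK : volume K ≠ ∞ := hu.isCompact.measure_lt_top.ne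
  set M := volume.real K
  have hM : 0 ≤ M := measureReal_nonneg
  set θ := η / (4 * (M + 1))
  have hθ : 0 < θ := by positivity
  have hθM : θ * M ≤ η / 4 := by
    have : θ * (M + 1) = η / 4 := by simp only [θ]; field_simp
    nlinarith
  -- A continuous substitute for the sign of `u`: the loss |u| − g u is at most θ on the support of
  -- `u` and 0 off it, and θ is chosen to make the total loss at most η/4.
  let g : ℝ → ℝ := fun t => u t / (|u t| + θ)
  have hpos : ∀ t, 0 < |u t| + θ := fun t => by positivity
  have hgc : Continuous g := huc.div (by fun_prop) fun t => (hpos t).ne'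
  have hg1 : ∀ t, |g t| ≤ 1 := fun t => by
    simp only [g]
    rw [abs_div, abs_of_pos (hpos t), div_le_one (hpos t)]
    linarith
  have hgD := h g hgc hg1
  have hind : Integrable (K.indicator fun _ => θ) :=
    (integrable_indicator_iff (isClosed_tsupport u).measurableSet).mpr
      (integrableOn_const hK)
  have hI : ∫ t, K.indicator (fun _ => θ) t = θ * M := by
    rw [integral_indicator (isClosed_tsupport u).measurableSet, setIntegral_const, smul_eq_mul,
      mul_comm]
  have hdiff : Integrable fun t => ‖D t - u t‖ := (hD.sub hui).norm
  have hgDi : Integrable fun t => g t * D t :=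
    hD.bdd_mul hgc.aestronglyMeasurable (c := 1) (Eventually.of_forall fun t => hg1 t)
  have key : ∀ t, |D t| ≤ g t * D t + 2 * ‖D t - u t‖ + K.indicator (fun _ => θ) t := fun t => by
    have h1 : |u t| ≤ g t * u t + K.indicator (fun _ => θ) t := by
      by_cases ht : t ∈ K
      · rw [indicator_of_mem ht]
        simp only [g]
        have : u t / (|u t| + θ) * u t = |u t| * |u t| / (|u t| + θ) := by
          rw [abs_mul_abs_self]; ring
        rw [this, ← sub_le_iff_le_add, le_div_iff₀ (hpos t)]
        nlinarith [abs_nonneg (u t), sq_nonneg θ]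
      · have : u t = 0 := image_eq_zero_of_notMem_tsupport ht
        simp [this, ht]
    have h2 : g t * u t ≤ g t * D t + ‖D t - u t‖ := by
      have h3 : g t * (u t - D t) ≤ |g t| * |u t - D t| := by
        rw [← abs_mul]; exact le_abs_self _
      have h4 : |g t| * |u t - D t| ≤ 1 * |u t - D t| :=
        mul_le_mul_of_nonneg_right (hg1 t) (abs_nonneg _)
      rw [Real.norm_eq_abs, abs_sub_comm]
      linarith
    have h3 : |D t| ≤ |u t| + ‖D t - u t‖ := by
      rw [Real.norm_eq_abs]
      have := abs_add_le (u t) (D t - u t)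
      rwa [add_sub_cancel] at this
    linarith
  calc ∫ t, |D t| ≤ ∫ t, (g t * D t + 2 * ‖D t - u t‖ + K.indicator (fun _ => θ) t) :=
        integral_mono hD.abs ((hgDi.add (hdiff.const_mul 2)).add hind) key
    _ = (∫ t, g t * D t) + 2 * (∫ t, ‖D t - u t‖) + θ * M := by
        have hsum : Integrable fun t => g t * D t + 2 * ‖D t - u t‖ :=
          hgDi.add (hdiff.const_mul 2)
        rw [integral_add hsum hind,
          integral_add hgDi (hdiff.const_mul 2), integral_const_mul, hI]
    _ ≤ ε + η := by linarith

variable {Ω Ω' : Type*} [MeasurableSpace Ω] [MeasurableSpace Ω']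

/-- Stein's method for the Wasserstein distance of a finitely supported random variable to the
standard normal distribution. -/
theorem wassersteinOne_le_of_stein {ι : Type*} [Fintype ι] (P : Measure Ω)
    [IsProbabilityMeasure P] (Q : Measure Ω') [IsProbabilityMeasure Q] {A : Ω → ℝ} {Z : Ω' → ℝ}
    (hA : AEMeasurable A P) (hZ : HasLaw Z (gaussianReal 0 1) Q) (wt x : ι → ℝ)
    (hw : ∑ i, wt i = 1)
    (hF : ∀ t, cdf (P.map A) t = ∑ i, wt i * if x i ≤ t then 1 else 0) {ε : ℝ}
    (h : ∀ f f' : ℝ → ℝ, (∀ t, HasDerivAt f (f' t) t) → (∀ t, |f t| ≤ 1) → (∀ t, |f' t| ≤ 2) →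
      LipschitzWith 2 f' → |∑ i, wt i * (f' (x i) - x i * f (x i))| ≤ ε) :
    wassersteinOne P A Q Z ≤ ENNReal.ofReal ε := by
  refine (wassersteinOne_le_lintegral_cdf P Q hA hZ.aemeasurable).trans ?_
  rw [hZ.map_eq]
  have hD : ∀ t, cdf (gaussianReal 0 1) t - cdf (P.map A) t = ∑ i, wt i * cdfDiff (x i) t :=
    fun t => by
      simp only [cdfDiff, mul_sub, Finset.sum_sub_distrib]
      rw [hF, ← Finset.sum_mul, hw, one_mul, cdf_gaussianReal]
  have hint : Integrable fun t => ∑ i, wt i * cdfDiff (x i) t :=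
    integrable_finsetSum _ fun i _ => (integrable_cdfDiff (x i)).const_mul _
  have hle : ∫ t, |∑ i, wt i * cdfDiff (x i) t| ≤ ε := by
    refine integral_abs_le_of_forall_continuous hint fun g hg hg1 => ?_
    have h1 : ∫ t, g t * ∑ i, wt i * cdfDiff (x i) t =
        ∑ i, wt i * (steinSol' g (x i) - x i * steinSol g (x i)) := by
      simp_rw [Finset.mul_sum, mul_left_comm (g _)]
      rw [integral_finsetSum _ fun i _ => (integral_mul_cdfDiff hg hg1 (x i)).1.const_mul _]
      refine Finset.sum_congr rfl fun i _ => ?_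
      rw [integral_const_mul, (integral_mul_cdfDiff hg hg1 (x i)).2, steinSol'_sub_mul]
    rw [h1]
    exact (le_abs_self _).trans (h _ _ (hasDerivAt_steinSol hg hg1) (abs_steinSol_le hg1)
      (abs_steinSol'_le hg1) (lipschitzWith_steinSol' hg hg1))
  simp_rw [abs_sub_comm (cdf (P.map A) _), hD]
  rw [← ofReal_integral_eq_lintegral_ofReal hint.abs (Eventually.of_forall fun t => abs_nonneg _)]
  exact ENNReal.ofReal_le_ofReal hle

end SteinMethod
-- Axioms for the length function; left descents along an edge.
section LengthSystem

variable {W ι : Type*} [Group W]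

/-- The properties of the length function of a Coxeter group, with respect to its simple
reflections, on which the normal approximation rests. -/
structure IsLengthSystem (s : ι → W) : Prop where
  sq : ∀ i, s i * s i = 1
  inj : Function.Injective s
  step : ∀ w i, length s (w * s i) = length s w + 1 ∨ length s w = length s (w * s i) + 1
  exch : ∀ w i j, ¬ IsDescent s w i → ¬ IsDescent s w⁻¹ j → IsDescent s (w * s i)⁻¹ j →
    s j * w = w * s i

lemma length_inv_le_of_sq {s : ι → W} (hsq : ∀ i, s i * s i = 1) (w : W) :
    {k : ℕ | ∃ l : List ι, l.length = k ∧ (l.map s).prod = w} ⊆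
      {k : ℕ | ∃ l : List ι, l.length = k ∧ (l.map s).prod = w⁻¹} := by
  rintro k ⟨l, hl, rfl⟩
  refine ⟨l.reverse, by simpa using hl, ?_⟩
  rw [List.prod_inv_reverse, List.map_reverse, List.map_map]
  congr 2
  refine List.map_congr_left fun i _ => ?_
  exact eq_inv_of_mul_eq_one_left (hsq i)

lemma length_inv {s : ι → W} (hs : IsLengthSystem s) (w : W) : length s w⁻¹ = length s w := by
  unfold length
  congr 1
  refine Set.Subset.antisymm ?_ (length_inv_le_of_sq hs.sq w)
  simpa using length_inv_le_of_sq hs.sq w⁻¹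

lemma mul_gen_mul_gen {s : ι → W} (hs : IsLengthSystem s) (w : W) (i : ι) :
    w * s i * s i = w := by rw [mul_assoc, hs.sq, mul_one]

lemma gen_inv {s : ι → W} (hs : IsLengthSystem s) (i : ι) : (s i)⁻¹ = s i :=
  (eq_inv_of_mul_eq_one_left (hs.sq i)).symm

lemma isDescent_mul_gen {s : ι → W} (hs : IsLengthSystem s) (w : W) (i : ι) :
    IsDescent s (w * s i) i ↔ ¬ IsDescent s w i := by
  have := hs.step w i
  simp only [IsDescent, mul_gen_mul_gen hs]
  omega

lemma length_mul_gen {s : ι → W} (hs : IsLengthSystem s) {w : W} {i : ι}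
    (h : ¬ IsDescent s w i) : length s (w * s i) = length s w + 1 := by
  have := hs.step w i
  simp only [IsDescent] at h
  omega

lemma isDescent_inv_iff {s : ι → W} (hs : IsLengthSystem s) (w : W) (j : ι) :
    IsDescent s w⁻¹ j ↔ length s (s j * w) < length s w := by
  rw [IsDescent, length_inv hs, ← length_inv hs (w⁻¹ * s j), mul_inv_rev, inv_inv, gen_inv hs]

lemma step_left {s : ι → W} (hs : IsLengthSystem s) (w : W) (j : ι) :
    length s (s j * w) = length s w + 1 ∨ length s w = length s (s j * w) + 1 := by
  have := hs.step w⁻¹ j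
  rwa [length_inv hs, ← length_inv hs (w⁻¹ * s j), mul_inv_rev, inv_inv, gen_inv hs] at this

open Classical in
/-- The left descents of `w * s i`, when `i` is an ascent of `w`. -/
lemma isDescent_inv_mul_gen {s : ι → W} (hs : IsLengthSystem s) {w : W} {i : ι}
    (h : ¬ IsDescent s w i) (j : ι) :
    (if IsDescent s (w * s i)⁻¹ j then 1 else 0 : ℝ) =
      (if IsDescent s w⁻¹ j then 1 else 0) + if s j * w = w * s i then 1 else 0 := by
  have hl := length_mul_gen hs h
  by_cases h1 : s j * w = w * s i
  · have h2 : ¬ IsDescent s w⁻¹ j := by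
      rw [isDescent_inv_iff hs, h1]; omega
    have h3 : IsDescent s (w * s i)⁻¹ j := by
      rw [isDescent_inv_iff hs, ← mul_assoc, h1, mul_gen_mul_gen hs]; omega
    rw [if_pos h3, if_neg h2, if_pos h1, zero_add]
  · by_cases h2 : IsDescent s w⁻¹ j
    -- A left descent j of w survives: s_j w s_i is at most one longer than s_j w, hence no longer
    -- than w, whereas w s_i is longer than w.
    · have h3 : IsDescent s (w * s i)⁻¹ j := by
        rw [isDescent_inv_iff hs] at h2 ⊢
        have h4 := step_left hs (w * s i) j
        have h5 := hs.step (s j * w) i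
        have h6 := step_left hs w j
        rw [← mul_assoc] at h4 ⊢
        omega
      rw [if_pos h3, if_pos h2, if_neg h1, add_zero]
    · have h3 : ¬ IsDescent s (w * s i)⁻¹ j := fun h3 => h1 (hs.exch w i j h h2 h3)
      rw [if_neg h3, if_neg h2, if_neg h1, add_zero]

end LengthSystem

/-! ### Mallows expectations and integration by parts. -/

section MallowsExpectation

variable {W ι : Type*} [Group W] [Fintype W]

/-- The Mallows weights. -/
noncomputable def mal (s : ι → W) (q : ℝ) (g : W) : ℝ :=
  q ^ length s g / ∑ h : W, q ^ length s h

/-- The expectation of `F` under the Mallows distribution. -/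
noncomputable def malE (s : ι → W) (q : ℝ) (F : W → ℝ) : ℝ := ∑ g, mal s q g * F g

variable {s : ι → W} {q : ℝ}

lemma sum_pow_length_pos (s : ι → W) (hq : 0 < q) : 0 < ∑ h : W, q ^ length s h :=
  Finset.sum_pos (fun _ _ => by positivity) Finset.univ_nonempty

lemma mal_pos (s : ι → W) (hq : 0 < q) (g : W) : 0 < mal s q g :=
  div_pos (by positivity) (sum_pow_length_pos s hq)

lemma sum_mal (s : ι → W) (hq : 0 < q) : ∑ g, mal s q g = 1 := by
  unfold mal
  rw [← Finset.sum_div, div_self (sum_pow_length_pos s hq).ne']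

lemma malE_const (s : ι → W) (hq : 0 < q) (c : ℝ) : malE s q (fun _ => c) = c := by
  rw [malE, ← Finset.sum_mul, sum_mal s hq, one_mul]

lemma malE_add (F G : W → ℝ) : malE s q (fun g => F g + G g) = malE s q F + malE s q G := by
  simp [malE, mul_add, Finset.sum_add_distrib]

lemma malE_sub (F G : W → ℝ) : malE s q (fun g => F g - G g) = malE s q F - malE s q G := by
  simp [malE, mul_sub, Finset.sum_sub_distrib]

lemma malE_mul_left (c : ℝ) (F : W → ℝ) : malE s q (fun g => c * F g) = c * malE s q F := by
  simp [malE, Finset.mul_sum, mul_left_comm]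

lemma malE_sum {κ : Type*} (t : Finset κ) (F : κ → W → ℝ) :
    malE s q (fun g => ∑ i ∈ t, F i g) = ∑ i ∈ t, malE s q (F i) := by
  simp only [malE, Finset.mul_sum]
  exact Finset.sum_comm

lemma malE_mono (hq : 0 < q) {F G : W → ℝ} (h : ∀ g, F g ≤ G g) : malE s q F ≤ malE s q G :=
  Finset.sum_le_sum fun g _ => mul_le_mul_of_nonneg_left (h g) (mal_pos s hq g).le

lemma abs_malE_le (hq : 0 < q) (F : W → ℝ) : |malE s q F| ≤ malE s q fun g => |F g| := by
  refine (Finset.abs_sum_le_sum_abs _ _).trans (Finset.sum_le_sum fun g _ => ?_)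
  rw [abs_mul, abs_of_pos (mal_pos s hq g)]

lemma sq_malE_le (hq : 0 < q) (F : W → ℝ) : malE s q F ^ 2 ≤ malE s q fun g => F g ^ 2 := by
  have h : 0 ≤ malE s q fun g => (F g - malE s q F) ^ 2 :=
    Finset.sum_nonneg fun g _ => mul_nonneg (mal_pos s hq g).le (sq_nonneg _)
  have h2 : (malE s q fun g => (F g - malE s q F) ^ 2) =
      (malE s q fun g => F g ^ 2) - malE s q F ^ 2 := by
    have : (fun g => (F g - malE s q F) ^ 2) =
        fun g => (F g ^ 2 - (2 * malE s q F) * F g) + malE s q F ^ 2 := by ext; ring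
    rw [this, malE_add, malE_sub, malE_mul_left, malE_const s hq]
    ring
  linarith

/-- The second moment is least about the mean, so centring at any `c` suffices, and Cauchy–Schwarz
passes to the first absolute moment. The variance bounds below can thus use an unspecified centre.
-/
lemma malE_abs_sub_le (hq : 0 < q) (F : W → ℝ) {c V : ℝ}
    (h : malE s q (fun g => (F g - c) ^ 2) ≤ V) :
    malE s q (fun g => |F g - malE s q F|) ≤ √V := by
  refine Real.le_sqrt_of_sq_le ((sq_malE_le hq _).trans (le_trans ?_ h))
  have h2 : (malE s q fun g => (F g - c) ^ 2) =
      (malE s q fun g => |F g - malE s q F| ^ 2) + (malE s q F - c) ^ 2 := by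
    have h3 : (fun g => (F g - c) ^ 2) = fun g => |F g - malE s q F| ^ 2 +
        ((2 * (malE s q F - c)) * (F g - malE s q F) + (malE s q F - c) ^ 2) := by
      ext g; rw [sq_abs]; ring
    rw [h3, malE_add, malE_add, malE_mul_left, malE_sub, malE_const s hq, malE_const s hq]
    ring
  rw [h2]
  nlinarith [sq_nonneg (malE s q F - c)]

lemma malE_inv (hs : IsLengthSystem s) (F : W → ℝ) :
    malE s q (fun g => F g⁻¹) = malE s q F := by
  unfold malE mal
  rw [← Equiv.sum_comp (Equiv.inv W)]
  simp [length_inv hs]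

lemma mal_mul_gen (hs : IsLengthSystem s) {g : W} {i : ι} (h : ¬ IsDescent s g i) :
    mal s q (g * s i) = q * mal s q g := by
  rw [mal, mal, length_mul_gen hs h, pow_succ]; ring

-- The map g ↦ g s_i is a bijection from the ascents at i to the descents at i and multiplies the
-- Mallows weight by q.
open Classical in
lemma malE_descent (hs : IsLengthSystem s) (i : ι) (F : W → ℝ) :
    malE s q (fun g => if IsDescent s g i then F g else 0) =
      q * malE s q fun g => if IsDescent s g i then 0 else F (g * s i) := by
  unfold malE
  rw [← Equiv.sum_comp (Equiv.mulRight (s i)), Finset.mul_sum]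
  refine Finset.sum_congr rfl fun g _ => ?_
  simp only [Equiv.coe_mulRight, isDescent_mul_gen hs]
  by_cases h : IsDescent s g i
  · simp [h]
  · simp only [h, not_false_eq_true, if_true, if_false, mal_mul_gen hs h]; ring

open Classical in
lemma malE_eq_ascent (hs : IsLengthSystem s) (i : ι) (F : W → ℝ) :
    malE s q F = malE s q fun g => if IsDescent s g i then 0 else F g + q * F (g * s i) := by
  have h : F = fun g => (if IsDescent s g i then F g else 0) +
      if IsDescent s g i then 0 else F g := by
    ext g; split_ifs <;> simp
  conv_lhs => rw [h]
  rw [malE_add, malE_descent hs, ← malE_mul_left, ← malE_add]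
  congr 1; ext g; split_ifs <;> ring

open Classical in
/-- `1` at a descent, `-1` at an ascent. -/
noncomputable def descentSign (s : ι → W) (g : W) (i : ι) : ℝ := if IsDescent s g i then 1 else -1

-- Given the edge {g, g s_i}, a descent has conditional probability q/(1+q). After grouping by
-- edges, both sides contribute q/(1+q) · (F(g s_i) − F(g)) at every ascent g.
open Classical in
lemma malE_descent_sub (hs : IsLengthSystem s) (hq : 0 < q) (i : ι) (F : W → ℝ) :
    malE s q (fun g => ((if IsDescent s g i then 1 else 0) - q / (1 + q)) * F g) =
      q / (1 + q) ^ 2 * malE s q fun g => descentSign s g i * (F g - F (g * s i)) := by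
  rw [malE_eq_ascent hs i, malE_eq_ascent hs i fun g => descentSign s g i * (F g - F (g * s i)),
    ← malE_mul_left]
  congr 1; ext g
  by_cases h : IsDescent s g i
  · simp [h]
  · have h2 := (isDescent_mul_gen hs g i).mpr h
    simp only [h, h2, descentSign, if_true, if_false, mul_gen_mul_gen hs]
    field_simp
    ring

end MallowsExpectation

open Classical in
lemma des_eq_sum {W ι : Type*} [Group W] [Fintype ι] (s : ι → W) (g : W) :
    (des s g : ℝ) = ∑ i, if IsDescent s g i then (1 : ℝ) else 0 := by
  rw [des, Finset.card_filter]; push_cast; rfl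

/-! ### Stein identity and error bound for the two-sided descents. -/

section SteinBound

variable {W ι : Type*} [Group W] [Fintype W] [Fintype ι]

/-- The change of the two-sided descent statistic across the edge `{g, g * s i}`. -/
noncomputable def desJump (s : ι → W) (g : W) (i : ι) : ℝ :=
  descentSign s g i * ((twoSidedDes s g : ℝ) - twoSidedDes s (g * s i))

/-- The sum of the changes of the two-sided descent statistic. -/
noncomputable def totalJump (s : ι → W) (g : W) : ℝ := ∑ i, desJump s g i

variable {s : ι → W} {q : ℝ}

/-- The mean of the two-sided descent statistic. -/
noncomputable def desMean (ι : Type*) [Fintype ι] (q : ℝ) : ℝ := 2 * (Fintype.card ι * (q / (1 + q)))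

/-- Inversion preserves both the Mallows law and T, and exchanges des(g) with des(g⁻¹). The two
halves of T therefore contribute equally, which accounts for the factor 2 and avoids multiplications
on the left. -/
lemma malE_twoSidedDes_sub_mul (hs : IsLengthSystem s) (hq : 0 < q) (F : ℝ → ℝ) :
    malE s q (fun g => (twoSidedDes s g - desMean ι q) * F (twoSidedDes s g)) =
      2 * (q / (1 + q) ^ 2) * ∑ i, malE s q fun g =>
        descentSign s g i * (F (twoSidedDes s g) - F (twoSidedDes s (g * s i))) := by
  classical
  set p := q / (1 + q)
  have hsym : ∀ g, twoSidedDes s g⁻¹ = twoSidedDes s g := fun g => by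
    simp [twoSidedDes, add_comm]
  have h1 : malE s q (fun g => (des s g - Fintype.card ι * p) * F (twoSidedDes s g)) =
      (q / (1 + q) ^ 2) * ∑ i, malE s q fun g =>
        descentSign s g i * (F (twoSidedDes s g) - F (twoSidedDes s (g * s i))) := by
    rw [Finset.mul_sum]
    simp_rw [← malE_descent_sub hs hq _ fun g => F (twoSidedDes s g)]
    rw [← malE_sum]
    congr 1; ext g
    rw [← Finset.sum_mul, Finset.sum_sub_distrib, des_eq_sum]
    simp [p]
  have h2 : malE s q (fun g => (des s g⁻¹ - Fintype.card ι * p) * F (twoSidedDes s g)) =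
      malE s q (fun g => (des s g - Fintype.card ι * p) * F (twoSidedDes s g)) := by
    rw [← malE_inv hs]
    simp_rw [inv_inv, hsym]
  have h3 : (fun g => ((twoSidedDes s g : ℝ) - desMean ι q) * F (twoSidedDes s g)) = fun g =>
      (des s g - Fintype.card ι * p) * F (twoSidedDes s g) +
        (des s g⁻¹ - Fintype.card ι * p) * F (twoSidedDes s g) := by
    ext g
    simp only [twoSidedDes, desMean]
    push_cast
    ring
  rw [h3, malE_add, h2, h1]
  ring

lemma malE_twoSidedDes (hs : IsLengthSystem s) (hq : 0 < q) :
    malE s q (fun g => (twoSidedDes s g : ℝ)) = desMean ι q := by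
  have := malE_twoSidedDes_sub_mul hs hq fun _ => 1
  simp only [mul_one, sub_self, mul_zero, malE_const s hq, Finset.sum_const_zero] at this
  rw [malE_sub, malE_const s hq] at this
  linarith

lemma malE_sq_twoSidedDes_sub (hs : IsLengthSystem s) (hq : 0 < q) :
    malE s q (fun g => ((twoSidedDes s g : ℝ) - desMean ι q) ^ 2) =
      2 * (q / (1 + q) ^ 2) * malE s q (totalJump s) := by
  have := malE_twoSidedDes_sub_mul hs hq fun t => t - desMean ι q
  simp only [sub_sub_sub_cancel_right, ← sq] at this
  rw [this, ← malE_sum]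
  rfl

/-- With v = 2q/(1+q)², the Stein identity and a Taylor expansion give E[X f(X)] ≈ (v/σ²) E[f'(X)
J], where v/σ² = 1/E J. Replacing J by its mean costs the first term of the bound, the Taylor
remainder costs the second. -/
lemma stein_bound (hs : IsLengthSystem s) (hq : 0 < q) {L c V S σ : ℝ} (hL : 0 < L)
    (hLE : L ≤ malE s q (totalJump s)) (hV : malE s q (fun g => (totalJump s g - c) ^ 2) ≤ V)
    (hS : malE s q (fun g => ∑ i, desJump s g i ^ 2) ≤ S)
    (hσ : σ = √(malE s q fun g => ((twoSidedDes s g : ℝ) - desMean ι q) ^ 2))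
    {f f' : ℝ → ℝ} (hf : ∀ t, HasDerivAt f (f' t) t) (hf' : ∀ t, |f' t| ≤ 2)
    (hlip : LipschitzWith 2 f') :
    |∑ g, mal s q g * (f' ((twoSidedDes s g - desMean ι q) / σ) -
      (twoSidedDes s g - desMean ι q) / σ * f ((twoSidedDes s g - desMean ι q) / σ))| ≤
      2 * √V / L + 2 * S / (L * √(2 * (q / (1 + q) ^ 2) * L)) := by
  set v := 2 * (q / (1 + q) ^ 2) with hv
  have hv0 : 0 < v := by positivity
  set E := malE s q (totalJump s) with hE
  have hE0 : 0 < E := hL.trans_le hLE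
  have hσ2 : σ ^ 2 = v * E := by
    rw [hσ, malE_sq_twoSidedDes_sub hs hq, Real.sq_sqrt (by positivity)]
  have hσL : √(v * L) ≤ σ := by
    rw [hσ, malE_sq_twoSidedDes_sub hs hq]
    exact Real.sqrt_le_sqrt (mul_le_mul_of_nonneg_left hLE hv0.le)
  have hσ1 : 0 < √(v * L) := Real.sqrt_pos.mpr (by positivity)
  have hσ0 : 0 < σ := hσ1.trans_le hσL
  set X : W → ℝ := fun g => (twoSidedDes s g - desMean ι q) / σ with hX
  have hS0 : 0 ≤ malE s q fun g => ∑ i, desJump s g i ^ 2 :=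
    Finset.sum_nonneg fun g _ => mul_nonneg (mal_pos s hq g).le
      (Finset.sum_nonneg fun i _ => sq_nonneg _)
  -- the Stein identity
  have hid : malE s q (fun g => X g * f (X g)) =
      v / σ * malE s q fun g => ∑ i, descentSign s g i * (f (X g) - f (X (g * s i))) := by
    have := malE_twoSidedDes_sub_mul hs hq fun t => f ((t - desMean ι q) / σ)
    rw [malE_sum, div_mul_eq_mul_div, ← this, eq_div_iff hσ0.ne', mul_comm, ← malE_mul_left]
    congr 1; ext g
    simp only [hX]
    field_simp
  have hrem : ∀ g i, |descentSign s g i * (f (X g) - f (X (g * s i))) -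
      f' (X g) * (desJump s g i / σ)| ≤ 2 * desJump s g i ^ 2 / σ ^ 2 := fun g i => by
    have h1 := abs_sub_sub_mul_le hf hlip (X (g * s i)) (X g) (X g) (Or.inr rfl)
    have h2 : X g - X (g * s i) = ((twoSidedDes s g : ℝ) - twoSidedDes s (g * s i)) / σ := by
      simp only [hX]; ring
    have h3 : |descentSign s g i| = 1 := by unfold descentSign; split_ifs <;> simp
    have h4 : descentSign s g i ^ 2 = 1 := by rw [← sq_abs, h3]; norm_num
    have h5 : descentSign s g i * (f (X g) - f (X (g * s i))) - f' (X g) * (desJump s g i / σ) =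
        descentSign s g i * (f (X g) - f (X (g * s i)) - f' (X g) * (X g - X (g * s i))) := by
      rw [h2, desJump]; ring
    rw [h5, abs_mul, h3, one_mul]
    refine h1.trans_eq ?_
    rw [h2, desJump, mul_pow, h4]
    push_cast
    ring
  have herr : |malE s q (fun g => ∑ i, descentSign s g i * (f (X g) - f (X (g * s i)))) -
      malE s q (fun g => f' (X g) * (totalJump s g / σ))| ≤ 2 * S / σ ^ 2 := by
    rw [← malE_sub]
    refine (abs_malE_le hq _).trans (le_trans (b := malE s q fun g => (2 / σ ^ 2) *
      ∑ i, desJump s g i ^ 2) (malE_mono hq fun g => ?_) ?_)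
    · rw [totalJump, Finset.sum_div, Finset.mul_sum, ← Finset.sum_sub_distrib, Finset.mul_sum]
      refine (Finset.abs_sum_le_sum_abs _ _).trans (Finset.sum_le_sum fun i _ => ?_)
      exact (hrem g i).trans_eq (by ring)
    · rw [malE_mul_left, div_mul_eq_mul_div]
      gcongr
  have hmain : |malE s q (fun g => f' (X g)) - v / σ * malE s q (fun g => f' (X g) *
      (totalJump s g / σ))| ≤ 2 * √V / E := by
    rw [← malE_mul_left, ← malE_sub]
    refine (abs_malE_le hq _).trans (le_trans (b := malE s q fun g => (2 / E) *
      |totalJump s g - malE s q (totalJump s)|) (malE_mono hq fun g => ?_) ?_)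
    · have : f' (X g) - v / σ * (f' (X g) * (totalJump s g / σ)) =
          -(f' (X g) / E * (totalJump s g - E)) := by
        have h1 : v / σ * (f' (X g) * (totalJump s g / σ)) =
            f' (X g) * totalJump s g * (v / σ ^ 2) := by ring
        rw [h1, hσ2]
        field_simp
        ring
      rw [this, abs_neg, abs_mul, abs_div, abs_of_pos hE0, ← hE]
      gcongr
      exact hf' _
    · rw [malE_mul_left, div_mul_eq_mul_div]
      gcongr
      exact malE_abs_sub_le hq _ hV
  have hfin : |malE s q (fun g => f' (X g)) - malE s q fun g => X g * f (X g)| ≤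
      2 * √V / E + v / σ * (2 * S / σ ^ 2) := by
    rw [hid]
    have h1 : 0 ≤ v / σ := by positivity
    have h2 := mul_le_mul_of_nonneg_left herr h1
    rw [← abs_of_nonneg h1, ← abs_mul, abs_of_nonneg h1, mul_sub] at h2
    rw [abs_le] at h2 hmain ⊢
    constructor <;> linarith [h2.1, h2.2, hmain.1, hmain.2]
  have hsum : ∑ g, mal s q g * (f' (X g) - X g * f (X g)) =
      malE s q (fun g => f' (X g)) - malE s q fun g => X g * f (X g) := by
    rw [← malE_sub]; rfl
  change |∑ g, mal s q g * (f' (X g) - X g * f (X g))| ≤ _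
  rw [hsum]
  refine hfin.trans (add_le_add ?_ ?_)
  · gcongr
  · have : v / σ * (2 * S / σ ^ 2) = 2 * S / (E * σ) := by
      rw [hσ2]; field_simp
    rw [this]
    have hSS : 0 ≤ S := hS0.trans hS
    gcongr

/-- The bound 2 + E|X| ≤ 3, which settles small n. A vanishing σ is harmless, as X is then 0 by the
convention for division. -/
lemma stein_bound_trivial (hq : 0 < q) {σ : ℝ}
    (hσ : σ = √(malE s q fun g => ((twoSidedDes s g : ℝ) - desMean ι q) ^ 2))
    {f f' : ℝ → ℝ} (hf : ∀ t, |f t| ≤ 1) (hf' : ∀ t, |f' t| ≤ 2) :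
    |∑ g, mal s q g * (f' ((twoSidedDes s g - desMean ι q) / σ) -
      (twoSidedDes s g - desMean ι q) / σ * f ((twoSidedDes s g - desMean ι q) / σ))| ≤ 3 := by
  set X : W → ℝ := fun g => (twoSidedDes s g - desMean ι q) / σ with hX
  have hX2 : malE s q (fun g => X g ^ 2) ≤ 1 := by
    have h1 : (fun g => X g ^ 2) = fun g =>
        (σ ^ 2)⁻¹ * ((twoSidedDes s g : ℝ) - desMean ι q) ^ 2 := by
      ext g; simp only [hX]; ring
    have h0 : 0 ≤ malE s q fun g => ((twoSidedDes s g : ℝ) - desMean ι q) ^ 2 :=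
      Finset.sum_nonneg fun g _ => mul_nonneg (mal_pos s hq g).le (sq_nonneg _)
    rw [h1, malE_mul_left, hσ, Real.sq_sqrt h0]
    exact inv_mul_le_one
  have hX1 : malE s q (fun g => |X g|) ≤ 1 := by
    have h1 := sq_malE_le (s := s) hq fun g => |X g|
    simp only [sq_abs] at h1
    nlinarith
  refine (abs_malE_le hq fun g => f' (X g) - X g * f (X g)).trans
    (le_trans (b := malE s q fun g => 2 + |X g|) (malE_mono hq fun g => ?_) ?_)
  · refine (abs_sub _ _).trans (add_le_add (hf' _) ?_)
    rw [abs_mul]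
    exact mul_le_of_le_one_right (abs_nonneg _) (hf _)
  · rw [malE_add, malE_const s hq]
    linarith

end SteinBound

/-! ### From Mallows distributed random elements to finite sums. -/

section MallowsVariables

variable {W ι : Type*} [Group W] [Fintype W] {Ω Ω' : Type*} [MeasurableSpace Ω]
  [MeasurableSpace Ω'] {s : ι → W} {q : ℝ} {P : Measure Ω} {w : Ω → W}

lemma IsMallows.measurable_comp (hw : IsMallows s q P w) {β : Type*} [MeasurableSpace β]
    (F : W → β) : Measurable fun ω => F (w ω) := by
  let _ : MeasurableSpace W := ⊤
  exact (measurable_from_top (f := F)).comp hw.1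

variable [IsProbabilityMeasure P]

lemma IsMallows.integral_comp (hw : IsMallows s q P w) (F : W → ℝ) :
    ∫ ω, F (w ω) ∂P = malE s q F := by
  have hm : ∀ g, MeasurableSet (w ⁻¹' {g}) := fun g => hw.1 trivial
  have h : ∀ ω, F (w ω) = ∑ g, (w ⁻¹' {g}).indicator (fun _ => F g) ω := fun ω => by
    rw [Finset.sum_eq_single (w ω)]
    · simp
    · intro g _ hg
      simp [Set.indicator, Ne.symm hg]
    · simp
  simp_rw [h]
  rw [integral_finsetSum _ fun g _ => (integrable_const _).indicator (hm g)]
  refine Finset.sum_congr rfl fun g _ => ?_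
  rw [integral_indicator (hm g), setIntegral_const, hw.2 g, smul_eq_mul, mal]

variable [Fintype ι]

lemma IsMallows.normalized_eq (hs : IsLengthSystem s) (hq : 0 < q) (hw : IsMallows s q P w)
    (ω : Ω) :
    normalized P (fun ω => (twoSidedDes s (w ω) : ℝ)) ω = (twoSidedDes s (w ω) - desMean ι q) /
      √(malE s q fun g => ((twoSidedDes s g : ℝ) - desMean ι q) ^ 2) := by
  have h1 : ∫ ω, (twoSidedDes s (w ω) : ℝ) ∂P = desMean ι q := by
    rw [hw.integral_comp fun g => (twoSidedDes s g : ℝ), malE_twoSidedDes hs hq]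
  have h2 : variance (fun ω => (twoSidedDes s (w ω) : ℝ)) P =
      malE s q fun g => ((twoSidedDes s g : ℝ) - desMean ι q) ^ 2 := by
    rw [variance_eq_integral (hw.measurable_comp fun g => (twoSidedDes s g : ℝ)).aemeasurable, h1]
    exact hw.integral_comp fun g => ((twoSidedDes s g : ℝ) - desMean ι q) ^ 2
  rw [normalized, h1, h2]

lemma IsMallows.wassersteinOne_le (hs : IsLengthSystem s) (hq : 0 < q) (hw : IsMallows s q P w)
    (Q : Measure Ω') [IsProbabilityMeasure Q] {Z : Ω' → ℝ} (hZ : HasLaw Z (gaussianReal 0 1) Q)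
    {ε : ℝ} (h : ∀ f f' : ℝ → ℝ, (∀ t, HasDerivAt f (f' t) t) → (∀ t, |f t| ≤ 1) →
      (∀ t, |f' t| ≤ 2) → LipschitzWith 2 f' → ∀ σ,
      σ = √(malE s q fun g => ((twoSidedDes s g : ℝ) - desMean ι q) ^ 2) →
      |∑ g, mal s q g * (f' ((twoSidedDes s g - desMean ι q) / σ) -
      (twoSidedDes s g - desMean ι q) / σ * f ((twoSidedDes s g - desMean ι q) / σ))| ≤ ε) :
    wassersteinOne P (normalized P fun ω => (twoSidedDes s (w ω) : ℝ)) Q Z ≤ ENNReal.ofReal ε := by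
  set σ := √(malE s q fun g => ((twoSidedDes s g : ℝ) - desMean ι q) ^ 2) with hσ
  set x : W → ℝ := fun g => (twoSidedDes s g - desMean ι q) / σ
  have hA : normalized P (fun ω => (twoSidedDes s (w ω) : ℝ)) = fun ω => x (w ω) :=
    funext fun ω => hw.normalized_eq hs hq ω
  have hAm : Measurable fun ω => x (w ω) := hw.measurable_comp x
  rw [hA]
  refine wassersteinOne_le_of_stein P Q hAm.aemeasurable hZ (mal s q) x (sum_mal s hq)
    (fun t => ?_) fun f f' h1 h2 h3 h4 => h f f' h1 h2 h3 h4 σ hσ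
  have := Measure.isProbabilityMeasure_map (μ := P) hAm.aemeasurable
  rw [cdf_eq_real, map_measureReal_apply hAm measurableSet_Iic, ← integral_indicator_one
    (hAm measurableSet_Iic)]
  have h5 : ((fun ω => x (w ω)) ⁻¹' Set.Iic t).indicator (1 : Ω → ℝ) =
      fun ω => (fun g => if x g ≤ t then (1 : ℝ) else 0) (w ω) := by
    ext ω; simp [Set.indicator]
  rw [h5]
  exact hw.integral_comp fun g => if x g ≤ t then (1 : ℝ) else 0

end MallowsVariables
-- A criterion for computing the length.
section LengthStatistic

variable {W ι : Type*} [Group W]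

/-- A statistic which changes by `2` along every edge and has a descent at every element other
than `1` is twice the length. -/
lemma two_mul_length_eq {s : ι → W} (f : W → ℕ) (h1 : f 1 = 0) (hsq : ∀ i, s i * s i = 1)
    (hstep : ∀ w i, f (w * s i) = f w + 2 ∨ f w = f (w * s i) + 2)
    (hdesc : ∀ w, w ≠ 1 → ∃ i, f (w * s i) < f w) (w : W) : 2 * length s w = f w := by
  have hle : ∀ l : List ι, ∀ v : W, f (v * (l.map s).prod) ≤ f v + 2 * l.length := by
    intro l
    induction l with
    | nil => simp
    | cons i l ih =>
      intro v
      rw [List.map_cons, List.prod_cons, ← mul_assoc, List.length_cons]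
      have := ih (v * s i)
      have := hstep v i
      omega
  -- Following descents down to 1 produces a word of length f/2; by `hle` no word is shorter.
  have hex : ∀ m : ℕ, ∀ v : W, f v = m → ∃ l : List ι, 2 * l.length = f v ∧ (l.map s).prod = v := by
    intro m
    induction m using Nat.strong_induction_on with
    | _ m ih =>
      intro v hv
      by_cases hv1 : v = 1
      · exact ⟨[], by simp [hv1, h1], by simp [hv1]⟩
      · obtain ⟨i, hi⟩ := hdesc v hv1
        obtain ⟨l, hl, hl'⟩ := ih _ (hv ▸ hi) (v * s i) rfl
        have := hstep v i
        refine ⟨l ++ [i], by simp; omega, ?_⟩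
        rw [List.map_append, List.prod_append, hl']
        simp [mul_assoc, hsq]
  obtain ⟨l, hl, hl'⟩ := hex _ w rfl
  have hmem : length s w ∈ {k : ℕ | ∃ l : List ι, l.length = k ∧ (l.map s).prod = w} :=
    Nat.sInf_mem ⟨_, l, rfl, hl'⟩
  obtain ⟨l', hl1, hl2⟩ := hmem
  have h3 := hle l' 1
  rw [one_mul, hl2, h1, hl1] at h3
  have h4 : length s w ≤ l.length := Nat.sInf_le ⟨l, rfl, hl'⟩
  omega

end LengthStatistic

/-! ### Reflections of [±n]. -/

section Reflections

variable {n : ℕ}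

/-- The reflection of `[±n]` exchanging `a` with `b` and `-a` with `-b`. -/
def refl (a b : PM n) : Equiv.Perm (PM n) := if a = -b then Equiv.swap a b else doubleSwap a b

lemma coe_refl_apply (a b c : PM n) : ((refl a b c : PM n) : ℤ) =
    if (c : ℤ) = a then (b : ℤ) else if (c : ℤ) = b then (a : ℤ) else
      if (c : ℤ) = -a then -(b : ℤ) else if (c : ℤ) = -b then -(a : ℤ) else c := by
  have ha := PM.coe_ne_zero a
  have hb := PM.coe_ne_zero b
  unfold refl
  split_ifs with h <;>
  simp only [doubleSwap, Equiv.Perm.mul_apply, Equiv.swap_apply_def, Subtype.ext_iff,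
    PM.coe_neg] at * <;> split_ifs <;> (try simp only [PM.coe_neg] at *) <;> omega

lemma refl_left (a b : PM n) : refl a b a = b := Subtype.ext (by rw [coe_refl_apply]; simp)

lemma refl_right (a b : PM n) : refl a b b = a :=
  Subtype.ext (by rw [coe_refl_apply]; split_ifs <;> omega)

lemma refl_mem_B (a b : PM n) : refl a b ∈ B n := fun c => by
  have ha := PM.coe_ne_zero a
  have hb := PM.coe_ne_zero b
  have hc := PM.coe_ne_zero c
  apply Subtype.ext
  simp only [coe_refl_apply, PM.coe_neg]
  split_ifs <;> omega

lemma refl_mul_self (a b : PM n) : refl a b * refl a b = 1 := by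
  have ha := PM.coe_ne_zero a
  have hb := PM.coe_ne_zero b
  ext c
  simp only [Equiv.Perm.mul_apply, coe_refl_apply, Equiv.Perm.one_apply]
  split_ifs <;> omega

lemma refl_neg_neg (a b : PM n) : refl (-b) (-a) = refl a b := by
  have ha := PM.coe_ne_zero a
  have hb := PM.coe_ne_zero b
  ext c
  simp only [coe_refl_apply, PM.coe_neg]
  split_ifs <;> omega

lemma conj_refl {w : Equiv.Perm (PM n)} (hw : w ∈ B n) (a b : PM n) :
    w * refl a b = refl (w a) (w b) * w := by
  have hneg : a = -b ↔ w a = -(w b) := by rw [← hw b, w.injective.eq_iff]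
  unfold refl
  split_ifs with h1 h2 h2
  · rw [Equiv.swap_apply_apply]; group
  · exact absurd (hneg.mp h1) h2
  · exact absurd (hneg.mpr h2) h1
  · simp only [doubleSwap]
    rw [← hw, ← hw, Equiv.swap_apply_apply, Equiv.swap_apply_apply]; group

end Reflections

/-! ### Length as the number of positive roots made negative. -/

section RootSystem

variable {n : ℕ}

/-- A group of signed permutations with generators the reflections in the simple roots
`(x i, y i)`. A pair `(a, b)` with `R a b` stands for the root `e_b - e_a`, positive if
`a < b`. -/
structure IsRootSystem (G : Subgroup (Equiv.Perm (PM n))) (R : PM n → PM n → Prop)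
    (s : Fin n → G) (x y : Fin n → PM n) : Prop where
  le : G ≤ B n
  map : ∀ w ∈ G, ∀ a b, R a b → R (w a) (w b)
  symm : ∀ a b, R a b → R b a
  neg : ∀ a b, R a b → R (-a) (-b)
  root : ∀ i, R (x i) (y i)
  lt : ∀ i, x i < y i
  gen : ∀ i, (s i : Equiv.Perm (PM n)) = refl (x i) (y i)
  inj : Function.Injective s
  flip : ∀ i a b, R a b → a < b → refl (x i) (y i) b < refl (x i) (y i) a →
    (a = x i ∧ b = y i) ∨ (a = -y i ∧ b = -x i)
  ident : ∀ w ∈ G, (∀ i, w (x i) < w (y i)) → w = 1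

/-- The weight of a pair in the count of inversions; each root is represented by pairs of total
weight `2`. -/
def pairWt (p : PM n × PM n) : ℕ := if p.1 = -p.2 then 2 else 1

open Classical in
/-- The inversions of `w`: the roots that `w` makes negative. -/
noncomputable def inversions (R : PM n → PM n → Prop) (w : Equiv.Perm (PM n)) :
    Finset (PM n × PM n) :=
  Finset.univ.filter fun p => R p.1 p.2 ∧ p.1 < p.2 ∧ w p.2 < w p.1

lemma mem_inversions {R : PM n → PM n → Prop} {w : Equiv.Perm (PM n)} {a b : PM n} :
    (a, b) ∈ inversions R w ↔ R a b ∧ a < b ∧ w b < w a := by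
  simp [inversions]

/-- Twice the number of positive roots that `w` makes negative. -/
noncomputable def invStat (R : PM n → PM n → Prop) (w : Equiv.Perm (PM n)) : ℕ :=
  ∑ p ∈ inversions R w, pairWt p

lemma PM.neg_lt_neg {a b : PM n} : -a < -b ↔ b < a := by
  rw [← Subtype.coe_lt_coe, ← Subtype.coe_lt_coe, PM.coe_neg, PM.coe_neg, _root_.neg_lt_neg_iff]

variable {G : Subgroup (Equiv.Perm (PM n))} {R : PM n → PM n → Prop} {s : Fin n → G}
  {x y : Fin n → PM n}

/-- A simple reflection r permutes the positive roots other than its own (`flip`). Hence the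
inversions of w r are the images under r of those of w, together with the simple root itself,
represented by (x, y) and by (−y, −x). -/
lemma IsRootSystem.invStat_mul_gen (h : IsRootSystem G R s x y) {w : Equiv.Perm (PM n)}
    (hw : w ∈ G) {i : Fin n} (hi : w (x i) < w (y i)) :
    invStat R (w * refl (x i) (y i)) = invStat R w + 2 := by
  classical
  set r := refl (x i) (y i) with hr
  have hrG : r ∈ G := by rw [hr, ← h.gen]; exact (s i).2
  have hrr : ∀ c, r (r c) = c := fun c => by
    have := refl_mul_self (x i) (y i)
    rw [← hr] at this
    rw [← Equiv.Perm.mul_apply, this, Equiv.Perm.one_apply]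
  have hrx : r (x i) = y i := refl_left _ _
  have hry : r (y i) = x i := refl_right _ _
  have hwn := h.le hw
  have hrn := h.le hrG
  have hset : inversions R (w * r) = (inversions R w ∪ {(y i, x i), (-x i, -y i)}).image
      (Prod.map r r) := by
    ext ⟨a, b⟩
    simp only [mem_inversions, Equiv.Perm.mul_apply,
      Finset.mem_image, Finset.mem_union, Finset.mem_insert, Finset.mem_singleton, Prod.exists,
      Prod.map_apply, Prod.mk.injEq]
    constructor
    · rintro ⟨hR, hab, hwab⟩
      refine ⟨r a, r b, ?_, hrr a, hrr b⟩
      rcases lt_trichotomy (r a) (r b) with hlt | heq | hgt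
      · exact Or.inl ⟨h.map r hrG _ _ hR, hlt, hwab⟩
      · exact absurd (r.injective heq) hab.ne
      · right
        rcases h.flip i a b hR hab hgt with ⟨rfl, rfl⟩ | ⟨rfl, rfl⟩
        · left; exact ⟨hrx, hry⟩
        · right; rw [hrn, hrn, hrx, hry]; exact ⟨rfl, rfl⟩
    · rintro ⟨c, d, hcd, rfl, rfl⟩
      simp only [hrr]
      rcases hcd with ⟨hR, hlt, hwcd⟩ | ⟨rfl, rfl⟩ | ⟨rfl, rfl⟩
      · refine ⟨h.map r hrG _ _ hR, ?_, hwcd⟩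
        by_contra hcon
        have hne : r d ≠ r c := fun he => hlt.ne' (r.injective he)
        rcases h.flip i c d hR hlt (lt_of_le_of_ne (not_lt.mp hcon) hne) with ⟨rfl, rfl⟩ | ⟨rfl, rfl⟩
        · exact absurd hwcd hi.not_gt
        · rw [hwn, hwn, PM.neg_lt_neg] at hwcd
          exact absurd hwcd hi.not_gt
      · rw [hrx, hry]
        exact ⟨h.root i, h.lt i, hi⟩
      · rw [hrn, hrn, hrx, hry, hwn, hwn, PM.neg_lt_neg, PM.neg_lt_neg]
        exact ⟨h.neg _ _ (h.symm _ _ (h.root i)), h.lt i, hi⟩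
  have hdisj : Disjoint (inversions R w) {(y i, x i), (-x i, -y i)} := by
    rw [Finset.disjoint_left]
    rintro ⟨a, b⟩ hab hab'
    simp only [mem_inversions, Finset.mem_insert,
      Finset.mem_singleton, Prod.mk.injEq] at hab hab'
    rcases hab' with ⟨rfl, rfl⟩ | ⟨rfl, rfl⟩
    · exact absurd hab.2.1 (h.lt i).not_gt
    · exact absurd (PM.neg_lt_neg.mp hab.2.1) (h.lt i).not_gt
  have hwt : ∀ p : PM n × PM n, pairWt (Prod.map r r p) = pairWt p := fun p => by
    have : r p.1 = -r p.2 ↔ p.1 = -p.2 := by rw [← hrn, r.injective.eq_iff]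
    simp [pairWt, this]
  rw [invStat, hset, Finset.sum_image fun p _ p' _ hp => by
    exact r.injective.prodMap r.injective hp]
  simp only [hwt]
  rw [Finset.sum_union hdisj, invStat, add_right_inj]
  -- For x = −y the two representatives coincide, and the single pair has weight 2.
  by_cases he : x i = -y i
  · rw [he, PM.neg_neg, Finset.pair_eq_singleton, Finset.sum_singleton]
    simp [pairWt]
  · have hne : (y i, x i) ≠ (-x i, -y i) := fun hh => he (Prod.mk.inj hh).2
    have he' : y i ≠ -x i := fun hh => he (by rw [hh, PM.neg_neg])
    rw [Finset.sum_pair hne]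
    simp [pairWt, he', he'.symm]

lemma invStat_one (R : PM n → PM n → Prop) : invStat R 1 = 0 := by
  classical
  rw [invStat, inversions, Finset.filter_false_of_mem, Finset.sum_empty]
  rintro p _ ⟨_, h1, h2⟩
  exact absurd h2 (not_lt.mpr h1.le)

lemma IsRootSystem.gen_sq (h : IsRootSystem G R s x y) (i : Fin n) : s i * s i = 1 :=
  Subtype.ext (by rw [Subgroup.coe_mul, h.gen, refl_mul_self]; rfl)

lemma IsRootSystem.lt_or_lt (h : IsRootSystem G R s x y) (w : Equiv.Perm (PM n)) (i : Fin n) :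
    w (x i) < w (y i) ∨ w (y i) < w (x i) :=
  lt_or_gt_of_ne fun he => (h.lt i).ne (w.injective he)

lemma IsRootSystem.mul_gen_apply (h : IsRootSystem G R s x y) (w : G) (i : Fin n) (a : PM n) :
    ((w * s i : G) : Equiv.Perm (PM n)) a = (w : Equiv.Perm (PM n)) (refl (x i) (y i) a) := by
  rw [Subgroup.coe_mul, h.gen, Equiv.Perm.mul_apply]

lemma IsRootSystem.invStat_of_descent (h : IsRootSystem G R s x y) (w : G) {i : Fin n}
    (hi : (w : Equiv.Perm (PM n)) (y i) < (w : Equiv.Perm (PM n)) (x i)) :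
    invStat R w = invStat R (w * s i : G) + 2 := by
  have h1 := h.invStat_mul_gen (w * s i).2 (i := i)
    (by rw [h.mul_gen_apply, h.mul_gen_apply, refl_left, refl_right]; exact hi)
  rw [← h1, Subgroup.coe_mul, h.gen, mul_assoc, refl_mul_self, mul_one]

/-- Twice the length is the inversion statistic. -/
lemma IsRootSystem.two_mul_length (h : IsRootSystem G R s x y) (w : G) :
    2 * length s w = invStat R w := by
  refine two_mul_length_eq (fun w : G => invStat R w) (invStat_one R) h.gen_sq (fun w i => ?_)
    (fun w hw => ?_) w
  · rcases h.lt_or_lt w i with hi | hi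
    · left
      have := h.invStat_mul_gen w.2 hi
      rwa [← h.gen, ← Subgroup.coe_mul] at this
    · exact Or.inr (h.invStat_of_descent w hi)
  · by_contra! hcon
    refine hw (Subtype.ext (h.ident w w.2 fun i => ?_))
    rcases h.lt_or_lt w i with hi | hi
    · exact hi
    · have := h.invStat_of_descent w hi
      have := hcon i
      omega

lemma IsRootSystem.isDescent_iff (h : IsRootSystem G R s x y) (w : G) (i : Fin n) :
    IsDescent s w i ↔ (w : Equiv.Perm (PM n)) (y i) < (w : Equiv.Perm (PM n)) (x i) := by
  have h1 := h.two_mul_length w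
  have h2 := h.two_mul_length (w * s i)
  unfold IsDescent
  rcases h.lt_or_lt w i with hi | hi
  · have := h.invStat_mul_gen w.2 hi
    rw [← h.gen, ← Subgroup.coe_mul] at this
    simp only [hi.not_gt, iff_false]
    omega
  · have := h.invStat_of_descent w hi
    simp only [hi, iff_true]
    omega

lemma IsRootSystem.gen_mul_eq_iff (h : IsRootSystem G R s x y) (w : G) (i j : Fin n) :
    s j * w = w * s i ↔ refl (x j) (y j) =
      refl ((w : Equiv.Perm (PM n)) (x i)) ((w : Equiv.Perm (PM n)) (y i)) := by
  rw [Subtype.ext_iff, Subgroup.coe_mul, Subgroup.coe_mul, h.gen, h.gen, conj_refl (h.le w.2),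
    mul_left_inj]

/-- The exchange property: if j is a left descent of w s_i but not of w, then s_i makes the positive
root w⁻¹(α_j) negative. By `flip` that root is α_i, and conjugating the reflection gives s_j = w s_i
w⁻¹. -/
lemma IsRootSystem.isLengthSystem (h : IsRootSystem G R s x y) : IsLengthSystem s where
  sq := h.gen_sq
  inj := h.inj
  step w i := by
    have h1 := h.two_mul_length w
    have h2 := h.two_mul_length (w * s i)
    rcases h.lt_or_lt w i with hi | hi
    · have := h.invStat_mul_gen w.2 hi
      rw [← h.gen, ← Subgroup.coe_mul] at this
      omega
    · have := h.invStat_of_descent w hi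
      omega
  exch w i j h1 h2 h3 := by
    rw [h.isDescent_iff] at h1 h2 h3
    rw [h.gen_mul_eq_iff]
    have hlt := (h.lt_or_lt (w⁻¹ : G) j).resolve_right h2
    have happ : ∀ a, ((w * s i)⁻¹ : G).1 a = refl (x i) (y i) ((w⁻¹ : G).1 a) := fun a => by
      rw [mul_inv_rev, Subgroup.coe_mul, (eq_inv_of_mul_eq_one_left (h.gen_sq i)).symm, h.gen,
        Equiv.Perm.mul_apply]
    rw [happ, happ] at h3
    have hinv : ∀ a b, (w⁻¹ : G).1 a = b → a = w.1 b := fun a b hab => by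
      rwa [Subgroup.coe_inv, Equiv.Perm.inv_eq_iff_eq] at hab
    rcases h.flip i _ _ (h.map _ (w⁻¹).2 _ _ (h.root j)) hlt h3 with ⟨ha, hb⟩ | ⟨ha, hb⟩
    · rw [← hinv _ _ ha, ← hinv _ _ hb]
    · have hx := hinv _ _ ha
      have hy := hinv _ _ hb
      rw [h.le w.2] at hx hy
      rw [hx, hy, refl_neg_neg]

end RootSystem
-- Random insertions and the variance of the number of adjacencies.
section Insertion

open Finset

lemma sum_range_succ_eq_skip {M : Type*} [AddCommMonoid M] (f : ℕ → M) {K e : ℕ} (he : e ≤ K) :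
    ∑ r ∈ range (K + 1), f r = f e + ∑ r ∈ range K, f (if r < e then r else r + 1) := by
  have h := Fin.sum_univ_succAbove (fun i : Fin (K + 1) => f i) ⟨e, by omega⟩
  rw [Fin.sum_univ_eq_sum_range] at h
  rw [h, ← Fin.sum_univ_eq_sum_range fun r => f (if r < e then r else r + 1)]
  congr 1
  refine Finset.sum_congr rfl fun i _ => ?_
  simp only [Fin.succAbove, Fin.lt_def, Fin.val_castSucc]
  split_ifs <;> simp

/-- Insertion of `x` into the sequence `b` at position `e`. -/
def insertAt (b : ℕ → ℤ) (e : ℕ) (x : ℤ) (i : ℕ) : ℤ :=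
  if i < e then b i else if i = e then x else b (i - 1)

lemma insertAt_of_lt {b : ℕ → ℤ} {e i : ℕ} {x : ℤ} (h : i < e) : insertAt b e x i = b i := by
  simp [insertAt, h]

lemma insertAt_self (b : ℕ → ℤ) (e : ℕ) (x : ℤ) : insertAt b e x e = x := by simp [insertAt]

lemma insertAt_succ {b : ℕ → ℤ} {e i : ℕ} {x : ℤ} (h : e ≤ i) :
    insertAt b e x (i + 1) = b i := by
  rw [insertAt, if_neg (by omega), if_neg (by omega), Nat.add_sub_cancel]

lemma insertAt_skip (b : ℕ → ℤ) (e i : ℕ) (x : ℤ) :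
    insertAt b e x (if i < e then i else i + 1) = b i := by
  split_ifs with h
  · exact insertAt_of_lt h
  · exact insertAt_succ (not_lt.mp h)

/-- The new largest entry `m + 1` or `-(m + 1)`. -/
def newVal (m : ℕ) (ε : Bool) : ℤ := if ε then (m : ℤ) + 1 else -((m : ℤ) + 1)

/-- The weight of the insertion of `newVal m ε` at position `e`. -/
noncomputable def insWt (q z : ℝ) (m e : ℕ) (ε : Bool) : ℝ :=
  if ε then q ^ (m - e) else z * q ^ (m + e)

/-- The total weight of the insertions at level `m`. -/
noncomputable def insTotal (q z : ℝ) (m : ℕ) : ℝ := ∑ e ∈ range (m + 1), ∑ ε, insWt q z m e ε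

/-- The weighted sum over all signed permutations of `{1, …, m}`, built by insertions. -/
noncomputable def insSum (q z : ℝ) : ℕ → ((ℕ → ℤ) → ℝ) → ℝ
  | 0, F => F 0
  | m + 1, F => insSum q z m fun b =>
      ∑ e ∈ range (m + 1), ∑ ε, insWt q z m e ε * F (insertAt b e (newVal m ε))

/-- A sequence with entries of absolute value at most `m`, supported on the first `m` places. -/
def IsBounded (m : ℕ) (b : ℕ → ℤ) : Prop := (∀ i, (b i).natAbs ≤ m) ∧ ∀ i, m ≤ i → b i = 0

lemma IsBounded.insertAt {m : ℕ} {b : ℕ → ℤ} (hb : IsBounded m b) {e : ℕ} (he : e ≤ m) (ε : Bool) :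
    IsBounded (m + 1) (insertAt b e (newVal m ε)) := by
  refine ⟨fun i => ?_, fun i hi => ?_⟩
  · unfold Mallows.insertAt newVal
    have h1 := hb.1 i
    have h2 := hb.1 (i - 1)
    split_ifs <;> omega
  · obtain ⟨k, rfl⟩ : ∃ k, i = k + 1 := ⟨i - 1, by omega⟩
    rw [insertAt_succ (by omega)]
    exact hb.2 k (by omega)

variable {q z : ℝ}

lemma insWt_pos (hq : 0 < q) (hz : 0 < z) (m e : ℕ) (ε : Bool) : 0 < insWt q z m e ε := by
  unfold insWt; split_ifs <;> positivity

lemma insTotal_pos (hq : 0 < q) (hz : 0 < z) (m : ℕ) : 0 < insTotal q z m :=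
  sum_pos (fun _ _ => sum_pos (fun _ _ => insWt_pos hq hz _ _ _) univ_nonempty) (by simp)

lemma insSum_mono (hq : 0 < q) (hz : 0 < z) (m : ℕ) {F G : (ℕ → ℤ) → ℝ}
    (h : ∀ b, IsBounded m b → F b ≤ G b) : insSum q z m F ≤ insSum q z m G := by
  induction m generalizing F G with
  | zero => exact h 0 ⟨fun _ => by simp, fun _ _ => rfl⟩
  | succ m ih =>
    refine ih fun b hb => sum_le_sum fun e he => sum_le_sum fun ε _ => ?_
    exact mul_le_mul_of_nonneg_left (h _ (hb.insertAt (by simpa [Nat.lt_succ_iff] using he) ε))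
      (insWt_pos hq hz _ _ _).le

lemma insSum_add (m : ℕ) (F G : (ℕ → ℤ) → ℝ) :
    insSum q z m (fun b => F b + G b) = insSum q z m F + insSum q z m G := by
  induction m generalizing F G with
  | zero => rfl
  | succ m ih => simp only [insSum, mul_add, sum_add_distrib, ih]

lemma insSum_mul_left (m : ℕ) (c : ℝ) (F : (ℕ → ℤ) → ℝ) :
    insSum q z m (fun b => c * F b) = c * insSum q z m F := by
  induction m generalizing F with
  | zero => rfl
  | succ m ih => simp only [insSum, mul_left_comm _ c, ← mul_sum, ih]

/-- Two entries that are consecutive integers, both of absolute value at least `2`. -/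
def IsAdj (a b : ℤ) : Prop := (a - b = 1 ∨ b - a = 1) ∧ 2 ≤ a.natAbs ∧ 2 ≤ b.natAbs

instance (a b : ℤ) : Decidable (IsAdj a b) := by unfold IsAdj; infer_instance

/-- The sum of `h` over the places at which adjacent entries are consecutive integers. -/
noncomputable def gapSum (K : ℕ) (h : ℕ → ℝ) (b : ℕ → ℤ) : ℝ :=
  ∑ r ∈ range K, if IsAdj (b r) (b (r + 1)) then h r else 0

/-- The weight carried by the gap `r` after an insertion at `e`. -/
noncomputable def gapShift (h : ℕ → ℝ) (e r : ℕ) : ℝ :=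
  if r < e then (if r + 1 < e then h r else 0) else h (r + 1)

lemma not_isAdj_zero_right (a : ℤ) : ¬ IsAdj a 0 := by simp [IsAdj]

lemma gapSum_succ_of_eq_zero {K : ℕ} {h : ℕ → ℝ} {b : ℕ → ℤ} (hb : b (K + 1) = 0) :
    gapSum (K + 1) h b = gapSum K h b := by
  rw [gapSum, sum_range_succ, hb, if_neg (not_isAdj_zero_right _), add_zero, gapSum]

lemma gapSum_insertAt {K e : ℕ} (h : ℕ → ℝ) (b : ℕ → ℤ) (x : ℤ) (he : e ≤ K) :
    gapSum (K + 1) h (insertAt b e x) = gapSum K (gapShift h e) b +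
      ((if IsAdj x (b e) then h e else 0) +
        ∑ r ∈ range K, if r + 1 = e ∧ IsAdj (b r) x then h r else 0) := by
  rw [gapSum, sum_range_succ_eq_skip _ he, insertAt_self, insertAt_succ le_rfl, add_left_comm,
    gapSum, ← sum_add_distrib]
  congr 1
  refine sum_congr rfl fun r _ => ?_
  rw [insertAt_skip]
  rcases lt_trichotomy (r + 1) e with hr | hr | hr
  · have h1 : r < e := by omega
    simp only [h1, hr, hr.ne, if_true, insertAt_of_lt hr, gapShift, false_and, if_false, add_zero]
  · have h1 : r < e := by omega
    subst hr
    simp [gapShift, insertAt_self]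
  · have h1 : ¬ r < e := by omega
    simp only [h1, hr.ne', if_false, insertAt_succ hr.le, gapShift, false_and, add_zero]

/-- The contribution of the pair formed by the last two inserted entries. -/
noncomputable def newPair (h : ℕ → ℝ) (m e' : ℕ) (ε' : Bool) (e : ℕ) (ε : Bool) : ℝ :=
  if (ε = ε' ∧ 1 ≤ m) ∧ (e = e' ∨ e = e' + 1) then h e' else 0

/-- The entry ±(m+2) can only be adjacent in value to ±(m+1) with the same sign, that is, to the
entry inserted just before; 1 ≤ m appears because entries ±1 are not counted. -/
lemma isAdj_newVal_iff {m : ℕ} {b : ℕ → ℤ} (hb : IsBounded m b) (e' : ℕ) (ε' ε : Bool) (i : ℕ) :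
    IsAdj (newVal (m + 1) ε) (insertAt b e' (newVal m ε') i) ↔ (ε = ε' ∧ 1 ≤ m) ∧ i = e' := by
  by_cases hi : i = e'
  · subst hi
    rw [insertAt_self]
    cases ε <;> cases ε' <;> simp [IsAdj, newVal] <;> omega
  · simp only [hi, and_false, iff_false]
    have : ∃ j, insertAt b e' (newVal m ε') i = b j := by
      rw [insertAt, if_neg hi]
      split_ifs
      exacts [⟨_, rfl⟩, ⟨_, rfl⟩]
    obtain ⟨j, hj⟩ := this
    have := hb.1 j
    rw [hj]
    simp only [IsAdj, newVal]
    split_ifs <;> omega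

lemma isAdj_comm {a b : ℤ} : IsAdj a b ↔ IsAdj b a := by
  unfold IsAdj; constructor <;> rintro ⟨h1, h2, h3⟩ <;> exact ⟨h1.symm, h3, h2⟩

lemma gapSum_insertAt_insertAt {K m : ℕ} (hK : m + 2 ≤ K) (h : ℕ → ℝ) {b : ℕ → ℤ}
    (hb : IsBounded m b) {e' e : ℕ} (he' : e' ≤ m) (he : e ≤ m + 1) (ε' ε : Bool) :
    gapSum K h (insertAt (insertAt b e' (newVal m ε')) e (newVal (m + 1) ε)) =
      gapSum K (gapShift h e) (insertAt b e' (newVal m ε')) + newPair h m e' ε' e ε := by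
  have hb1 := hb.insertAt he' ε'
  have hb2 := hb1.insertAt he ε
  rw [← gapSum_succ_of_eq_zero (hb2.2 (K + 1) (by omega)), gapSum_insertAt _ _ _ (by omega)]
  congr 1
  simp_rw [isAdj_comm (b := newVal (m + 1) ε), isAdj_newVal_iff hb, newPair]
  by_cases hε : ε = ε' ∧ 1 ≤ m
  · simp only [hε, true_and]
    have : ∀ r, (r + 1 = e ∧ r = e') ↔ (r = e' ∧ e = e' + 1) := fun r => by omega
    simp_rw [this, ite_and]
    have hk : e' < K := by omega
    rw [sum_ite_eq']
    by_cases h1 : e = e'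
    · subst h1; simp
    · simp [h1, hk]
  · simp [hε]

lemma newPair_mem {h : ℕ → ℝ} (h0 : ∀ r, 0 ≤ h r) (h1 : ∀ r, h r ≤ 1) (m e' : ℕ) (ε' : Bool)
    (e : ℕ) (ε : Bool) : 0 ≤ newPair h m e' ε' e ε ∧ newPair h m e' ε' e ε ≤ 1 := by
  unfold newPair
  split_ifs
  · exact ⟨h0 _, h1 _⟩
  · simp

lemma gapShift_mem {h : ℕ → ℝ} (h0 : ∀ r, 0 ≤ h r) (h1 : ∀ r, h r ≤ 1) (e r : ℕ) :
    0 ≤ gapShift h e r ∧ gapShift h e r ≤ 1 := by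
  unfold gapShift
  split_ifs
  · exact ⟨h0 _, h1 _⟩
  · simp
  · exact ⟨h0 _, h1 _⟩

/-- An insertion changes the weighted gap sum by a bounded amount. -/
lemma gapSum_gapShift_sub {K m : ℕ} (hK : m ≤ K) {h : ℕ → ℝ} (h0 : ∀ r, 0 ≤ h r)
    (h1 : ∀ r, h r ≤ 1) (hanti : ∀ r, r + 1 ≤ m → h (r + 1) ≤ h r) {b : ℕ → ℤ}
    (hb : IsBounded (m + 1) b) (e : ℕ) :
    -2 ≤ gapSum K (gapShift h e) b - gapSum K h b ∧
      gapSum K (gapShift h e) b - gapSum K h b ≤ 0 := by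
  have hγ : ∀ r, m ≤ r → ¬ IsAdj (b r) (b (r + 1)) := fun r hr => by
    rw [hb.2 (r + 1) (by omega)]; exact not_isAdj_zero_right _
  rw [gapSum, gapSum, ← sum_sub_distrib]
  constructor
  · have hpt : ∀ r ∈ range K, -(if r < m then h r - h (r + 1) else 0) - (if r + 1 = e then 1 else 0)
        ≤ (if IsAdj (b r) (b (r + 1)) then gapShift h e r else 0) -
          (if IsAdj (b r) (b (r + 1)) then h r else 0) := fun r _ => by
      by_cases hr : r < m
      · have h2 := hanti r hr
        have h3 := h1 r
        have h4 := h0 r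
        simp only [hr, if_true, gapShift]
        split_ifs <;> first | linarith | omega
      · simp only [hγ r (not_lt.mp hr), hr, if_false]
        split_ifs <;> simp
    refine le_trans ?_ (sum_le_sum hpt)
    rw [sum_sub_distrib, sum_neg_distrib]
    have hA : ∑ r ∈ range K, (if r < m then h r - h (r + 1) else 0) = h 0 - h m := by
      rw [← sum_filter, show (range K).filter (· < m) = range m by
        ext r; simp only [mem_filter, mem_range]; omega, sum_range_sub']
    have hB : ∑ r ∈ range K, (if r + 1 = e then (1 : ℝ) else 0) ≤ 1 := by
      rw [sum_ite, sum_const_zero, add_zero, sum_const, nsmul_eq_mul, mul_one]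
      exact_mod_cast card_le_one.mpr fun a ha b hb => by
        simp only [mem_filter] at ha hb; omega
    rw [hA]
    linarith [h1 0, h0 m]
  · refine sum_nonpos fun r _ => ?_
    by_cases hr : r < m
    · have h2 := hanti r hr
      have h4 := h0 r
      simp only [gapShift]
      split_ifs <;> linarith
    · simp [hγ r (not_lt.mp hr)]

/-- The averaged weight of the gap `r` after a random insertion at level `m`. -/
noncomputable def gapAvg (q z : ℝ) (m : ℕ) (h : ℕ → ℝ) (r : ℕ) : ℝ :=
  (insTotal q z m)⁻¹ * ∑ e ∈ range (m + 1), ∑ ε, insWt q z m e ε * gapShift h e r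

lemma average_mem (hq : 0 < q) (hz : 0 < z) (m : ℕ) {u : ℕ → Bool → ℝ}
    (hu : ∀ e ε, 0 ≤ u e ε ∧ u e ε ≤ 1) :
    0 ≤ (insTotal q z m)⁻¹ * ∑ e ∈ range (m + 1), ∑ ε, insWt q z m e ε * u e ε ∧
      (insTotal q z m)⁻¹ * ∑ e ∈ range (m + 1), ∑ ε, insWt q z m e ε * u e ε ≤ 1 := by
  have hT := insTotal_pos hq hz m
  constructor
  · exact mul_nonneg (inv_nonneg.mpr hT.le) (sum_nonneg fun e _ => sum_nonneg fun ε _ =>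
      mul_nonneg (insWt_pos hq hz _ _ _).le (hu e ε).1)
  · rw [inv_mul_le_one₀ hT]
    exact sum_le_sum fun e _ => sum_le_sum fun ε _ =>
      mul_le_of_le_one_right (insWt_pos hq hz _ _ _).le (hu e ε).2

/-- With k = m − e − 1 the increment is q^k (1 − q)(1 − z q^(2e+1)). As z is 1 or q, the last factor
is 1 minus a power of q, so it cannot have the sign opposite to 1 − q. -/
lemma sum_insWt_mono (hq : 0 < q) (hz : z = 1 ∨ z = q) {m e : ℕ} (he : e + 1 ≤ m) :
    ∑ ε, insWt q z m e ε ≤ ∑ ε, insWt q z m (e + 1) ε := by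
  simp only [Fintype.sum_bool, insWt, if_true, Bool.false_eq_true, if_false]
  obtain ⟨k, rfl⟩ : ∃ k, m = e + 1 + k := ⟨m - (e + 1), by omega⟩
  rw [show e + 1 + k - e = k + 1 by omega, show e + 1 + k - (e + 1) = k by omega,
    show e + 1 + k + e = k + (2 * e + 1) by omega,
    show e + 1 + k + (e + 1) = k + (2 * e + 1) + 1 by omega]
  have hk : 0 < q ^ k := by positivity
  have key : 0 ≤ (1 - q) * (1 - z * q ^ (2 * e + 1)) := by
    have : ∃ j : ℕ, z * q ^ (2 * e + 1) = q ^ j := by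
      rcases hz with rfl | rfl
      · exact ⟨_, one_mul _⟩
      · exact ⟨2 * e + 1 + 1, by ring⟩
    obtain ⟨j, hj⟩ := this
    rw [hj]
    rcases le_total q 1 with h | h
    · exact mul_nonneg (by linarith) (by linarith [pow_le_one₀ (n := j) hq.le h])
    · exact mul_nonneg_of_nonpos_of_nonpos (by linarith) (by linarith [one_le_pow₀ (n := j) h])
  have := mul_nonneg hk.le key
  have e1 : q ^ (k + 1) = q ^ k * q := pow_succ _ _
  have e2 : q ^ (k + (2 * e + 1)) = q ^ k * q ^ (2 * e + 1) := pow_add _ _ _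
  have e3 : q ^ (k + (2 * e + 1) + 1) = q ^ k * q ^ (2 * e + 1) * q := by rw [pow_succ, e2]
  rw [e1, e2, e3]
  nlinarith

/-- For insertion positions other than r + 1 and r + 2 the comparison is termwise. Position r + 1
destroys the gap r and position r + 2 destroys the gap r + 1; together these two terms compare
correctly because the later position has the larger weight. -/
lemma gapAvg_anti (hq : 0 < q) (hz : z = 1 ∨ z = q) {m : ℕ} {h : ℕ → ℝ} (h0 : ∀ r, 0 ≤ h r)
    (hanti : ∀ r, r + 1 ≤ m → h (r + 1) ≤ h r) (r : ℕ) (hr : r + 2 ≤ m) :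
    gapAvg q z (m + 1) h (r + 1) ≤ gapAvg q z (m + 1) h r := by
  have hz0 : 0 < z := by rcases hz with rfl | rfl <;> [exact one_pos; exact hq]
  have hT := insTotal_pos hq hz0 (m + 1)
  refine mul_le_mul_of_nonneg_left ?_ (inv_nonneg.mpr hT.le)
  simp_rw [← sum_mul]
  set c : ℕ → ℝ := fun e => ∑ ε, insWt q z (m + 1) e ε with hc
  have hc0 : ∀ e, 0 ≤ c e := fun e => sum_nonneg fun ε _ => (insWt_pos hq hz0 _ _ _).le
  have hA := hanti r (by omega)
  have hB := hanti (r + 1) (by omega)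
  have hcm : c (r + 1) ≤ c (r + 2) := sum_insWt_mono hq hz (by omega)
  -- compare the terms `e = r + 1` and `e = r + 2` together, the others one by one
  have hpt : ∀ e ∈ range (m + 1 + 1), c e * gapShift h e (r + 1) -
      (if e = r + 1 then c (r + 1) * h (r + 2) else 0) ≤ c e * gapShift h e r -
        (if e = r + 2 then c (r + 2) * h r else 0) := fun e _ => by
    by_cases h1 : e = r + 1
    · subst h1
      simp [gapShift]
    · by_cases h2 : e = r + 2
      · subst h2
        simp [gapShift]
      · simp only [h1, h2, if_false, sub_zero]
        refine mul_le_mul_of_nonneg_left ?_ (hc0 e)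
        unfold gapShift
        split_ifs <;> omega
  have := sum_le_sum hpt
  rw [sum_sub_distrib, sum_sub_distrib, sum_ite_eq', sum_ite_eq', if_pos (by simp; omega),
    if_pos (by simp; omega)] at this
  have h3 : c (r + 1) * h (r + 2) ≤ c (r + 2) * h r :=
    mul_le_mul hcm (hB.trans hA) (h0 _) (hc0 _)
  linarith

/-- Second moments under a finite measure split into the squared deviation of the mean and the
spread around any point. -/
lemma sum_mul_sq_sub_le {κ : Type*} (t : Finset κ) (c Φ : κ → ℝ) (hc : ∀ i ∈ t, 0 ≤ c i)
    (hC : 0 < ∑ i ∈ t, c i) (a β V : ℝ) (hV : ∀ i ∈ t, (Φ i - β) ^ 2 ≤ V) :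
    ∑ i ∈ t, c i * (Φ i - a) ^ 2 ≤
      (∑ i ∈ t, c i) * (((∑ i ∈ t, c i)⁻¹ * ∑ i ∈ t, c i * Φ i - a) ^ 2 + V) := by
  set C := ∑ i ∈ t, c i with hCdef
  set μ := C⁻¹ * ∑ i ∈ t, c i * Φ i with hμ
  have hμC : ∑ i ∈ t, c i * Φ i = C * μ := by rw [hμ, mul_inv_cancel_left₀ hC.ne']
  have hexp : ∀ a, ∑ i ∈ t, c i * (Φ i - a) ^ 2 =
      ∑ i ∈ t, c i * Φ i ^ 2 - 2 * a * (C * μ) + C * a ^ 2 := fun a => by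
    rw [← hμC, hCdef, mul_sum, sum_mul, ← sum_sub_distrib, ← sum_add_distrib]
    exact sum_congr rfl fun i _ => by ring
  have h1 : ∑ i ∈ t, c i * (Φ i - β) ^ 2 ≤ C * V := by
    rw [hCdef, sum_mul]
    exact sum_le_sum fun i hi => mul_le_mul_of_nonneg_left (hV i hi) (hc i hi)
  rw [hexp] at h1 ⊢
  nlinarith [mul_nonneg hC.le (sq_nonneg (μ - β))]

/-- The variance of the weighted gap sum, together with a bounded function of the last insertion,
grows at most linearly. -/
theorem exists_insSum_sq_gapSum_le (hq : 0 < q) (hz : z = 1 ∨ z = q) {K : ℕ} (m : ℕ)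
    (hK : m + 1 ≤ K) {h : ℕ → ℝ} {y : ℕ → Bool → ℝ} (h0 : ∀ r, 0 ≤ h r) (h1 : ∀ r, h r ≤ 1)
    (hanti : ∀ r, r + 2 ≤ m → h (r + 1) ≤ h r) (hy : ∀ e ε, 0 ≤ y e ε ∧ y e ε ≤ 1) :
    ∃ c, insSum q z m (fun b => ∑ e ∈ range (m + 1), ∑ ε, insWt q z m e ε *
      (gapSum K h (insertAt b e (newVal m ε)) + y e ε - c) ^ 2) ≤
        4 * (m + 1) * insSum q z m fun _ => insTotal q z m := by
  have hz0 : 0 < z := by rcases hz with rfl | rfl <;> [exact one_pos; exact hq]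
  induction m generalizing h y with
  | zero =>
    refine ⟨0, ?_⟩
    simp only [insSum]
    have hg : ∀ ε, gapSum K h (insertAt 0 0 (newVal 0 ε)) = 0 := fun ε =>
      sum_eq_zero fun r _ => by
        rw [insertAt_succ (Nat.zero_le _)]; exact if_neg (not_isAdj_zero_right _)
    have hle : insTotal q z 0 ≤ 4 * ((0 : ℕ) + 1) * insTotal q z 0 := by
      have := insTotal_pos hq hz0 0
      norm_num
      linarith
    refine le_trans (sum_le_sum fun e he => sum_le_sum fun ε _ => ?_) hle
    obtain rfl : e = 0 := by simpa using he
    rw [hg]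
    have h2 := hy 0 ε
    exact mul_le_of_le_one_right (insWt_pos hq hz0 _ _ _).le (by nlinarith)
  | succ m ih =>
    set C := insTotal q z (m + 1) with hC
    have hCpos : 0 < C := insTotal_pos hq hz0 (m + 1)
    have hanti' : ∀ r, r + 1 ≤ m → h (r + 1) ≤ h r := fun r hr => hanti r (by omega)
    -- Averaging over the last insertion turns the gap sum with weights `h` into one with weights
    -- `h'`, plus a function `y'` of the preceding insertion, plus the constant `yb`. The newly
    -- formed pair depends on the preceding insertion, which is why the induction carries a bounded
    -- function of the last insertion.
    set h' := gapAvg q z (m + 1) h with hh'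
    set y' : ℕ → Bool → ℝ := fun e' ε' => C⁻¹ * ∑ e ∈ range (m + 1 + 1), ∑ ε,
      insWt q z (m + 1) e ε * newPair h m e' ε' e ε with hy'
    set yb := C⁻¹ * ∑ e ∈ range (m + 1 + 1), ∑ ε, insWt q z (m + 1) e ε * y e ε with hyb
    have hmem' : ∀ r, 0 ≤ h' r ∧ h' r ≤ 1 := fun r =>
      average_mem hq hz0 (m + 1) fun e _ => gapShift_mem h0 h1 e r
    obtain ⟨c, hc⟩ := ih (by omega) (h := h') (y := y') (fun r => (hmem' r).1)
      (fun r => (hmem' r).2) (fun r hr => gapAvg_anti hq hz h0 hanti' r hr)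
      fun e' ε' => average_mem hq hz0 (m + 1) fun e ε => newPair_mem h0 h1 m e' ε' e ε
    refine ⟨c + yb, ?_⟩
    -- Given the earlier insertions, the statistic stays within 2 of `gapSum K h b'`: the shift lies
    -- in [−2, 0], the new pair and `y` in [0, 1]. The conditional variance is thus at most 4, and
    -- this is the growth per level.
    have hstep : ∀ b, IsBounded m b → ∀ e' ≤ m, ∀ ε',
        ∑ e ∈ range (m + 1 + 1), ∑ ε, insWt q z (m + 1) e ε *
          (gapSum K h (insertAt (insertAt b e' (newVal m ε')) e (newVal (m + 1) ε)) + y e ε -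
            (c + yb)) ^ 2 ≤
        C * ((gapSum K h' (insertAt b e' (newVal m ε')) + y' e' ε' - c) ^ 2 + 4) := by
      intro b hb e' he' ε'
      set b' := insertAt b e' (newVal m ε') with hb'
      have hb1 : IsBounded (m + 1) b' := hb.insertAt he' ε'
      have hCs : C = ∑ i ∈ range (m + 1 + 1) ×ˢ (univ : Finset Bool),
          insWt q z (m + 1) i.1 i.2 := by rw [sum_product]; rfl
      have hmean : C⁻¹ * ∑ i ∈ range (m + 1 + 1) ×ˢ (univ : Finset Bool),
          insWt q z (m + 1) i.1 i.2 *
            (gapSum K h (insertAt b' i.1 (newVal (m + 1) i.2)) + y i.1 i.2) =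
          gapSum K h' b' + y' e' ε' + yb := by
        have hgs : ∀ r, (if IsAdj (b' r) (b' (r + 1)) then (insTotal q z (m + 1))⁻¹ *
            ∑ e ∈ range (m + 1 + 1), ∑ ε, insWt q z (m + 1) e ε * gapShift h e r else 0) =
            C⁻¹ * ∑ e ∈ range (m + 1 + 1), ∑ ε, insWt q z (m + 1) e ε *
              (if IsAdj (b' r) (b' (r + 1)) then gapShift h e r else 0) := fun r => by
          split_ifs <;> simp [hC]
        have hG : gapSum K h' b' = C⁻¹ * ∑ e ∈ range (m + 1 + 1), ∑ ε,
            insWt q z (m + 1) e ε * gapSum K (gapShift h e) b' := by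
          simp only [hh', gapSum, gapAvg, hgs]
          rw [← mul_sum, sum_comm (s := range K)]
          congr 1
          refine sum_congr rfl fun e _ => ?_
          rw [sum_comm (s := range K)]
          exact sum_congr rfl fun ε _ => (mul_sum _ _ _).symm
        simp only [hG, hy', hyb]
        rw [sum_product, ← mul_add, ← mul_add, ← sum_add_distrib, ← sum_add_distrib]
        congr 1
        refine sum_congr rfl fun e he => ?_
        rw [← sum_add_distrib, ← sum_add_distrib]
        refine sum_congr rfl fun ε _ => ?_
        rw [gapSum_insertAt_insertAt (K := K) hK h hb he'
          (e := e) (by simpa [Nat.lt_succ_iff] using he) ε' ε]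
        ring
      have := sum_mul_sq_sub_le (range (m + 1 + 1) ×ˢ (univ : Finset Bool))
        (fun i => insWt q z (m + 1) i.1 i.2)
        (fun i => gapSum K h (insertAt b' i.1 (newVal (m + 1) i.2)) + y i.1 i.2)
        (fun i _ => (insWt_pos hq hz0 _ _ _).le) (hCs ▸ hCpos) (c + yb) (gapSum K h b') 4
        (fun i hi => by
          have hi1 : i.1 ≤ m + 1 := by
            have := (mem_product.mp hi).1
            simpa [Nat.lt_succ_iff] using this
          have h2 := gapSum_insertAt_insertAt (K := K) hK h hb he' hi1 ε' i.2
          have h3 := gapSum_gapShift_sub (K := K) (m := m) (by omega) h0 h1 hanti' hb1 i.1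
          have h4 := newPair_mem h0 h1 m e' ε' i.1 i.2
          have h5 := hy i.1 i.2
          rw [h2]
          rw [← hb']
          rw [← sq_abs]
          have : |gapSum K (gapShift h i.1) b' + newPair h m e' ε' i.1 i.2 + y i.1 i.2 -
              gapSum K h b'| ≤ 2 := by
            rw [abs_le]; constructor <;> linarith [h3.1, h3.2, h4.1, h4.2, h5.1, h5.2]
          nlinarith [abs_nonneg (gapSum K (gapShift h i.1) b' + newPair h m e' ε' i.1 i.2 +
            y i.1 i.2 - gapSum K h b')])
      rw [← hCs, hmean, sum_product] at this
      refine this.trans_eq ?_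
      ring
    calc insSum q z (m + 1) _ ≤ insSum q z m (fun b => C * (∑ e' ∈ range (m + 1), ∑ ε',
          insWt q z m e' ε' * (gapSum K h' (insertAt b e' (newVal m ε')) + y' e' ε' - c) ^ 2) +
          (4 * C) * insTotal q z m) := by
          refine insSum_mono hq hz0 m fun b hb => ?_
          rw [insTotal, mul_sum, mul_sum, ← sum_add_distrib]
          refine sum_le_sum fun e' he' => ?_
          rw [mul_sum, mul_sum, ← sum_add_distrib]
          refine sum_le_sum fun ε' _ => ?_
          refine (mul_le_mul_of_nonneg_left (hstep b hb e' (by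
            simpa [Nat.lt_succ_iff] using he') ε') (insWt_pos hq hz0 _ _ _).le).trans_eq ?_
          ring
      _ = C * insSum q z m (fun b => ∑ e' ∈ range (m + 1), ∑ ε', insWt q z m e' ε' *
          (gapSum K h' (insertAt b e' (newVal m ε')) + y' e' ε' - c) ^ 2) +
          (4 * C) * insSum q z m fun _ => insTotal q z m := by
          rw [insSum_add, insSum_mul_left, insSum_mul_left]
      _ ≤ C * (4 * (m + 1) * insSum q z m fun _ => insTotal q z m) +
          (4 * C) * insSum q z m fun _ => insTotal q z m :=
          add_le_add_left (mul_le_mul_of_nonneg_left hc hCpos.le) _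
      _ = 4 * ((m + 1 : ℕ) + 1) * insSum q z (m + 1) fun _ => C := by
          have : insSum q z (m + 1) (fun _ => C) = C * insSum q z m fun _ => insTotal q z m := by
            rw [← insSum_mul_left]
            simp only [insSum, insTotal, sum_mul, mul_comm C]
          rw [this]
          push_cast
          ring

end Insertion
-- Signed permutations as sequences of insertions.
section SignedSequences

open Finset

/-- `b` lists the values of a signed permutation of `{1, …, m}`. -/
structure IsSigned (m : ℕ) (b : ℕ → ℤ) : Prop where
  mem : ∀ i < m, 1 ≤ (b i).natAbs ∧ (b i).natAbs ≤ m
  inj : ∀ i < m, ∀ j < m, (b i).natAbs = (b j).natAbs → i = j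
  zero : ∀ i, m ≤ i → b i = 0

lemma IsSigned.isBounded {m : ℕ} {b : ℕ → ℤ} (hb : IsSigned m b) : IsBounded m b := by
  refine ⟨fun i => ?_, hb.zero⟩
  rcases lt_or_ge i m with h | h
  · exact (hb.mem i h).2
  · simp [hb.zero i h]

lemma natAbs_newVal (m : ℕ) (ε : Bool) : (newVal m ε).natAbs = m + 1 := by
  unfold newVal; split_ifs <;> omega

lemma eq_or_exists_skip (e i : ℕ) : i = e ∨ ∃ j, i = if j < e then j else j + 1 := by
  rcases lt_trichotomy i e with h | h | h
  · exact Or.inr ⟨i, by simp [h]⟩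
  · exact Or.inl h
  · exact Or.inr ⟨i - 1, by rw [if_neg (by omega)]; omega⟩

lemma IsSigned.insertAt {m : ℕ} {b : ℕ → ℤ} (hb : IsSigned m b) {e : ℕ} (he : e ≤ m) (ε : Bool) :
    IsSigned (m + 1) (insertAt b e (newVal m ε)) := by
  have hbd := hb.isBounded
  refine ⟨fun i hi => ?_, fun i hi j hj hij => ?_, (hbd.insertAt he ε).2⟩
  · rcases eq_or_exists_skip e i with rfl | ⟨k, rfl⟩
    · rw [insertAt_self, natAbs_newVal]; omega
    · rw [insertAt_skip]
      have := hb.mem k (by split_ifs at hi <;> omega)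
      omega
  · rcases eq_or_exists_skip e i with hie | ⟨k, rfl⟩ <;>
      rcases eq_or_exists_skip e j with hje | ⟨l, rfl⟩
    · rw [hie, hje]
    · rw [hie, insertAt_self, insertAt_skip, natAbs_newVal] at hij
      have := hbd.1 l
      omega
    · rw [hje, insertAt_self, insertAt_skip, natAbs_newVal] at hij
      have := hbd.1 k
      omega
    · rw [insertAt_skip, insertAt_skip] at hij
      rw [hb.inj k (by split_ifs at hi <;> omega) l (by split_ifs at hj <;> omega) hij]

open Classical in
/-- The lists of values of the signed permutations of `{1, …, m}`. -/
noncomputable def signedSeqs : ℕ → Finset (ℕ → ℤ)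
  | 0 => {0}
  | m + 1 => (signedSeqs m ×ˢ (range (m + 1) ×ˢ (univ : Finset Bool))).image
      fun p => insertAt p.1 p.2.1 (newVal m p.2.2)

lemma mem_signedSeqs {m : ℕ} {b : ℕ → ℤ} : b ∈ signedSeqs m ↔ IsSigned m b := by
  induction m generalizing b with
  | zero =>
    rw [signedSeqs, mem_singleton]
    constructor
    · rintro rfl
      exact ⟨by simp, by simp, by simp⟩
    · intro h
      exact funext fun i => h.zero i (Nat.zero_le _)
  | succ m ih =>
    simp only [signedSeqs, mem_image, mem_product, mem_univ, and_true, Prod.exists, mem_range]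
    constructor
    · rintro ⟨b', e, ε, ⟨hb', he⟩, rfl⟩
      exact (ih.mp hb').insertAt (by omega) ε
    · intro hb
      -- By counting, the absolute values exhaust 1, …, m + 1; the place of ±(m+1) is the last
      -- insertion to be undone.
      have himg : (range (m + 1)).image (fun i => (b i).natAbs) = Icc 1 (m + 1) := by
        refine eq_of_subset_of_card_le ?_ ?_
        · intro k hk
          obtain ⟨i, hi, rfl⟩ := mem_image.mp hk
          have := hb.mem i (mem_range.mp hi)
          simp only [mem_Icc]; omega
        · rw [card_image_of_injOn fun i hi j hj hij => hb.inj i (by simpa using hi) j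
            (by simpa using hj) hij]
          simp
      have hmem : m + 1 ∈ (range (m + 1)).image fun i => (b i).natAbs := by
        rw [himg]; simp
      obtain ⟨e, he, hbe⟩ := mem_image.mp hmem
      have he' := mem_range.mp he
      refine ⟨fun j => b (if j < e then j else j + 1), e, decide (0 < b e), ⟨ih.mpr ⟨?_, ?_, ?_⟩,
        he'⟩, ?_⟩
      · intro i hi
        have hlt : (if i < e then i else i + 1) < m + 1 := by split_ifs <;> omega
        have h1 := hb.mem _ hlt
        have h2 : (b (if i < e then i else i + 1)).natAbs ≠ m + 1 := fun h => by
          have := hb.inj _ hlt e he' (h.trans hbe.symm)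
          split_ifs at this <;> omega
        omega
      · intro i hi j hj hij
        have := hb.inj _ (by split_ifs <;> omega) _ (by split_ifs <;> omega) hij
        split_ifs at this <;> omega
      · intro i hi
        exact hb.zero _ (by split_ifs <;> omega)
      · funext i
        rcases eq_or_exists_skip e i with rfl | ⟨k, rfl⟩
        · rw [insertAt_self, newVal]
          by_cases h : 0 < b i
          · simp only [h, decide_true, if_true]; omega
          · simp only [h, decide_false, Bool.false_eq_true, if_false]; omega
        · rw [insertAt_skip]

lemma insertAt_newVal_inj {m : ℕ} {b b' : ℕ → ℤ} (hb' : IsSigned m b')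
    {e e' : ℕ} {ε ε' : Bool} (h : insertAt b e (newVal m ε) = insertAt b' e' (newVal m ε')) :
    b = b' ∧ e = e' ∧ ε = ε' := by
  have hval := congrFun h e
  rw [insertAt_self] at hval
  have hee : e = e' := by
    rcases eq_or_exists_skip e' e with he | ⟨k, hk⟩
    · exact he
    · rw [hk, insertAt_skip] at hval
      have h1 := natAbs_newVal m ε
      have h2 := hb'.isBounded.1 k
      rw [hval] at h1
      omega
  subst hee
  rw [insertAt_self] at hval
  refine ⟨funext fun i => ?_, rfl, ?_⟩
  · have := congrFun h (if i < e then i else i + 1)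
    rwa [insertAt_skip, insertAt_skip] at this
  · unfold newVal at hval
    revert hval
    cases ε <;> cases ε' <;> simp <;> omega

lemma sum_signedSeqs_succ (m : ℕ) (F : (ℕ → ℤ) → ℝ) :
    ∑ b ∈ signedSeqs (m + 1), F b = ∑ b ∈ signedSeqs m, ∑ e ∈ range (m + 1), ∑ ε,
      F (insertAt b e (newVal m ε)) := by
  classical
  rw [signedSeqs, sum_image, sum_product]
  · simp_rw [sum_product]
  · rintro ⟨b, e, ε⟩ _ ⟨b', e', ε'⟩ hb' h
    simp only [coe_product, Set.mem_prod, mem_coe] at hb'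
    obtain ⟨rfl, rfl, rfl⟩ := insertAt_newVal_inj (mem_signedSeqs.mp hb'.1) h
    rfl

/-- The number of positive roots `e_j - e_i`, `e_j + e_i` made negative, for values `a`, `b` at
the places `i < j`. -/
def pairInv (a b : ℤ) : ℕ := (if b < a then 1 else 0) + if b < -a then 1 else 0

/-- The number of inversions of the type `D` of a sequence. -/
def invCount (m : ℕ) (b : ℕ → ℤ) : ℕ :=
  ∑ i ∈ range m, ∑ j ∈ range m, if i < j then pairInv (b i) (b j) else 0

/-- The number of negative entries of a sequence. -/
def negEntries (m : ℕ) (b : ℕ → ℤ) : ℕ := ∑ i ∈ range m, if b i < 0 then 1 else 0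

/-- The weight of a signed permutation. -/
noncomputable def seqWt (q z : ℝ) (m : ℕ) (b : ℕ → ℤ) : ℝ := q ^ invCount m b * z ^ negEntries m b

lemma negEntries_insertAt {m : ℕ} (b : ℕ → ℤ) {e : ℕ} (he : e ≤ m) (ε : Bool) :
    negEntries (m + 1) (insertAt b e (newVal m ε)) = negEntries m b + if ε then 0 else 1 := by
  rw [negEntries, sum_range_succ_eq_skip _ he, add_comm]
  simp only [insertAt_skip, insertAt_self, negEntries]
  congr 1
  unfold newVal
  cases ε <;> simp <;> omega

/-- The new entry has the largest absolute value. With each later entry it forms exactly one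
inversion, whatever its sign; with each earlier entry it forms none if positive and two if negative.
-/
lemma invCount_insertAt {m : ℕ} {b : ℕ → ℤ} (hb : IsBounded m b) {e : ℕ} (he : e ≤ m) (ε : Bool) :
    invCount (m + 1) (insertAt b e (newVal m ε)) =
      invCount m b + (m - e) + if ε then 0 else 2 * e := by
  set x := newVal m ε with hx
  have hxa : x.natAbs = m + 1 := natAbs_newVal m ε
  have hleft : ∀ j, pairInv x (b j) = 1 := fun j => by
    have := hb.1 j
    unfold pairInv
    split_ifs <;> omega
  have hright : ∀ i, pairInv (b i) x = if ε then 0 else 2 := fun i => by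
    have := hb.1 i
    rw [hx]
    unfold pairInv newVal
    split_ifs <;> omega
  rw [invCount, sum_range_succ_eq_skip _ he, sum_range_succ_eq_skip _ he]
  simp_rw [sum_range_succ_eq_skip _ he, insertAt_skip, insertAt_self, hleft, hright]
  rw [sum_add_distrib]
  have h1 : ∀ i j : ℕ, ((if i < e then i else i + 1) < if j < e then j else j + 1) ↔ i < j :=
    fun i j => by split_ifs <;> omega
  have h2 : ∀ j : ℕ, (e < if j < e then j else j + 1) ↔ e ≤ j := fun j => by split_ifs <;> omega
  have h3 : ∀ j : ℕ, ((if j < e then j else j + 1) < e) ↔ j < e := fun j => by split_ifs <;> omega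
  simp_rw [h1, h2, h3, lt_irrefl, if_false]
  rw [← sum_filter, ← sum_filter, sum_const, sum_const]
  have c1 : ((range m).filter (e ≤ ·)).card = m - e := by
    rw [show (range m).filter (e ≤ ·) = Ico e m by ext; simp [and_comm], Nat.card_Ico]
  have c2 : ((range m).filter (· < e)).card = e := by
    rw [show (range m).filter (· < e) = range e by ext; simp; omega, card_range]
  rw [c1, c2, invCount]
  cases ε <;> simp <;> ring

lemma seqWt_insertAt (q z : ℝ) {m : ℕ} {b : ℕ → ℤ} (hb : IsBounded m b) {e : ℕ} (he : e ≤ m)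
    (ε : Bool) :
    seqWt q z (m + 1) (insertAt b e (newVal m ε)) = seqWt q z m b * insWt q z m e ε := by
  rw [seqWt, negEntries_insertAt b he, invCount_insertAt hb he, seqWt, insWt]
  cases ε
  · simp only [Bool.false_eq_true, if_false]
    rw [show invCount m b + (m - e) + 2 * e = invCount m b + (m + e) by omega]
    ring
  · simp only [if_true, add_zero, pow_add]
    ring

/-- The factor contributed by an insertion depends only on its level, position and sign, so under
these weights the insertions are independent. -/
lemma sum_signedSeqs_eq_insSum (q z : ℝ) (m : ℕ) (F : (ℕ → ℤ) → ℝ) :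
    ∑ b ∈ signedSeqs m, seqWt q z m b * F b = insSum q z m F := by
  induction m generalizing F with
  | zero => simp [signedSeqs, insSum, seqWt, invCount, negEntries]
  | succ m ih =>
    rw [sum_signedSeqs_succ, insSum, ← ih]
    refine sum_congr rfl fun b hb => ?_
    rw [mul_sum]
    refine sum_congr rfl fun e he => ?_
    rw [mul_sum]
    refine sum_congr rfl fun ε _ => ?_
    rw [seqWt_insertAt q z (mem_signedSeqs.mp hb).isBounded
      (by simpa [Nat.lt_succ_iff] using he), mul_assoc]

end SignedSequences

/-! ### One-line notation and the inversion statistic. -/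

section OneLine

variable {n : ℕ}

/-- The `k`-th positive element of `[±n]`, counted from `0`. -/
def PM.pos (k : Fin n) : PM n := PM.ofNat (k + 1) (by omega) (by omega)

lemma PM.coe_pos (k : Fin n) : ((PM.pos k : PM n) : ℤ) = k + 1 := by
  simp [PM.pos]

lemma PM.exists_pos (c : PM n) : ∃ k : Fin n, c = PM.pos k ∨ c = -PM.pos k := by
  have h0 := PM.coe_ne_zero c
  have hc := c.2
  simp only [Finset.mem_erase, Finset.mem_Icc] at hc
  refine ⟨⟨(c : ℤ).natAbs - 1, by omega⟩, ?_⟩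
  rw [Subtype.ext_iff, Subtype.ext_iff, PM.coe_neg, PM.coe_pos]
  simp only
  omega

lemma PM.natAbs_le (c : PM n) : (c : ℤ).natAbs ≤ n := by
  have hc := c.2
  simp only [Finset.mem_erase, Finset.mem_Icc] at hc
  omega

lemma PM.sum_eq {M : Type*} [AddCommMonoid M] (f : PM n → M) :
    ∑ c, f c = ∑ k : Fin n, (f (PM.pos k) + f (-PM.pos k)) := by
  have hbij : Function.Bijective fun p : Fin n × Bool =>
      if p.2 then PM.pos p.1 else -PM.pos p.1 := by
    constructor
    · rintro ⟨k, ε⟩ ⟨l, ε'⟩ h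
      have h1 : (if ε then ((k : ℕ) : ℤ) + 1 else -(((k : ℕ) : ℤ) + 1)) =
          if ε' then ((l : ℕ) : ℤ) + 1 else -(((l : ℕ) : ℤ) + 1) := by
        have := congrArg (fun c : PM n => (c : ℤ)) h
        revert this
        cases ε <;> cases ε' <;> simp [PM.coe_pos]
      have h2 : (k : ℕ) = l ∧ ε = ε' := by
        revert h1
        cases ε <;> cases ε' <;> simp <;> omega
      exact Prod.ext (Fin.ext h2.1) h2.2
    · intro c
      obtain ⟨k, rfl | rfl⟩ := PM.exists_pos c
      · exact ⟨(k, true), by simp⟩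
      · exact ⟨(k, false), by simp⟩
  rw [← hbij.sum_comp, Fintype.sum_prod_type]
  simp

/-- The sequence of the values `w(1), …, w(n)`, continued by `0`. -/
def oneLine (w : Equiv.Perm (PM n)) (r : ℕ) : ℤ := if h : r < n then (w (PM.pos ⟨r, h⟩) : ℤ) else 0

lemma oneLine_coe (w : Equiv.Perm (PM n)) (k : Fin n) : oneLine w k = w (PM.pos k) := by
  simp [oneLine]

lemma eq_of_oneLine_eq {v w : Equiv.Perm (PM n)} (hv : v ∈ B n) (hw : w ∈ B n)
    (h : ∀ k < n, oneLine v k = oneLine w k) : v = w := by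
  have hk : ∀ k : Fin n, v (PM.pos k) = w (PM.pos k) := fun k => by
    have := h k k.2
    rw [oneLine_coe, oneLine_coe] at this
    exact Subtype.ext this
  refine Equiv.ext fun c => ?_
  obtain ⟨k, rfl | rfl⟩ := PM.exists_pos c
  · exact hk k
  · rw [hv, hw, hk]

lemma isSigned_oneLine {w : Equiv.Perm (PM n)} (hw : w ∈ B n) : IsSigned n (oneLine w) := by
  refine ⟨fun i hi => ?_, fun i hi j hj hij => ?_, fun i hi => by simp [oneLine, hi.not_gt]⟩
  · rw [oneLine, dif_pos hi]
    exact ⟨Int.natAbs_pos.mpr (PM.coe_ne_zero _), PM.natAbs_le _⟩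
  · rw [oneLine, oneLine, dif_pos hi, dif_pos hj, Int.natAbs_eq_natAbs_iff] at hij
    have : PM.pos ⟨i, hi⟩ = PM.pos ⟨j, hj⟩ ∨ PM.pos ⟨i, hi⟩ = -PM.pos ⟨j, hj⟩ := by
      rcases hij with h | h
      · exact Or.inl (w.injective (Subtype.ext h))
      · right
        refine w.injective (Subtype.ext ?_)
        rw [hw, PM.coe_neg, h]
    rw [Subtype.ext_iff, Subtype.ext_iff, PM.coe_neg, PM.coe_pos, PM.coe_pos] at this
    simp only at this
    omega

lemma exists_oneLine_eq {b : ℕ → ℤ} (hb : IsSigned n b) :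
    ∃ w ∈ B n, oneLine w = b := by
  have hmem : ∀ c : PM n, 1 ≤ (b ((c : ℤ).natAbs - 1)).natAbs ∧
      (b ((c : ℤ).natAbs - 1)).natAbs ≤ n := fun c => by
    have h0 := PM.coe_ne_zero c
    have h1 := PM.natAbs_le c
    exact hb.mem _ (by omega)
  let f : PM n → PM n := fun c => ⟨if 0 < (c : ℤ) then b ((c : ℤ).natAbs - 1) else
    -b ((c : ℤ).natAbs - 1), by
      have := hmem c
      simp only [Finset.mem_erase, Finset.mem_Icc]
      split_ifs <;> omega⟩
  have hf : ∀ c, (f c : ℤ) = if 0 < (c : ℤ) then b ((c : ℤ).natAbs - 1) else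
    -b ((c : ℤ).natAbs - 1) := fun _ => rfl
  have hinj : Function.Injective f := fun c d hcd => by
    have h := congrArg (fun c : PM n => (c : ℤ)) hcd
    simp only [hf] at h
    have hc0 := PM.coe_ne_zero c
    have hd0 := PM.coe_ne_zero d
    have hc1 := PM.natAbs_le c
    have hd1 := PM.natAbs_le d
    have hc := hmem c
    have hidx := hb.inj ((c : ℤ).natAbs - 1) (by omega) ((d : ℤ).natAbs - 1) (by omega)
      (by split_ifs at h <;> omega)
    rw [← hidx] at h
    apply Subtype.ext
    split_ifs at h <;> omega
  refine ⟨Equiv.ofBijective f (Finite.injective_iff_bijective.mp hinj), fun c => ?_, ?_⟩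
  · apply Subtype.ext
    have hc0 := PM.coe_ne_zero c
    simp only [Equiv.ofBijective_apply, hf, PM.coe_neg, Int.natAbs_neg]
    split_ifs <;> omega
  · funext r
    unfold oneLine
    split_ifs with h
    · rw [Equiv.ofBijective_apply, hf, PM.coe_pos, if_pos (by positivity)]
      congr 1
    · exact (hb.zero r (not_lt.mp h)).symm

lemma sum_B_oneLine [Fintype (B n)] (F : (ℕ → ℤ) → ℝ) :
    ∑ w : B n, F (oneLine (w : Equiv.Perm (PM n))) = ∑ b ∈ signedSeqs n, F b := by
  refine Finset.sum_nbij (fun w => oneLine (w : Equiv.Perm (PM n)))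
    (fun w _ => mem_signedSeqs.mpr (isSigned_oneLine w.2)) ?_ ?_ fun _ _ => rfl
  · intro v _ w _ h
    exact Subtype.ext (eq_of_oneLine_eq v.2 w.2 fun k _ => congrFun h k)
  · intro b hb
    obtain ⟨w, hw, rfl⟩ := exists_oneLine_eq (mem_signedSeqs.mp hb)
    exact ⟨⟨w, hw⟩, by simp, rfl⟩

lemma sum_sum_eq_of_add_swap {ι : Type*} [Fintype ι] {f g : ι → ι → ℕ}
    (h : ∀ i j, f i j + f j i = g i j + g j i) : ∑ i, ∑ j, f i j = ∑ i, ∑ j, g i j := by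
  have h2 : ∑ i, ∑ j, (f i j + f j i) = ∑ i, ∑ j, (g i j + g j i) :=
    Finset.sum_congr rfl fun i _ => Finset.sum_congr rfl fun j _ => h i j
  simp only [Finset.sum_add_distrib] at h2
  rw [Finset.sum_comm (f := fun i j => f j i), Finset.sum_comm (f := fun i j => g j i)] at h2
  omega

/-- The inversion statistic in terms of the one-line notation. The proposition `c` tells whether
the roots `2 e_i` are present. -/
lemma invStat_eq {w : Equiv.Perm (PM n)} (hw : w ∈ B n) (c : Prop) [Decidable c] :
    invStat (fun a b => a = -b → c) w =
      2 * (invCount n (oneLine w) + if c then negEntries n (oneLine w) else 0) := by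
  classical
  have hN : (if c then negEntries n (oneLine w) else 0) = ∑ i : Fin n, ∑ j : Fin n,
      if i = j then (if c ∧ oneLine w i < 0 then 1 else 0) else 0 := by
    simp only [Finset.sum_ite_eq, Finset.mem_univ, if_true]
    rw [negEntries, ← Fin.sum_univ_eq_sum_range fun i => if oneLine w i < 0 then 1 else 0]
    split_ifs with h <;> simp [h]
  have hI : invCount n (oneLine w) = ∑ i : Fin n, ∑ j : Fin n,
      if (i : ℕ) < j then pairInv (oneLine w i) (oneLine w j) else 0 := by
    rw [invCount, ← Fin.sum_univ_eq_sum_range fun i => ∑ j ∈ Finset.range n,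
      if i < j then pairInv (oneLine w i) (oneLine w j) else 0]
    refine Finset.sum_congr rfl fun i _ => ?_
    rw [← Fin.sum_univ_eq_sum_range fun j =>
      if (i : ℕ) < j then pairInv (oneLine w i) (oneLine w j) else 0]
  have hS : invStat (fun a b => a = -b → c) w = ∑ a, ∑ b,
      if ((a : PM n) = -b → c) ∧ a < b ∧ w b < w a then pairWt (a, b) else 0 := by
    rw [invStat, inversions, Finset.sum_filter, Fintype.sum_prod_type]
    exact Finset.sum_congr rfl fun a _ => Finset.sum_congr rfl fun b _ => by congr
  have hterm : ∀ i j : Fin n,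
      (if (PM.pos i = -PM.pos j → c) ∧ PM.pos i < PM.pos j ∧ w (PM.pos j) < w (PM.pos i)
        then pairWt (PM.pos i, PM.pos j) else 0) +
      (if (PM.pos i = - -PM.pos j → c) ∧ PM.pos i < -PM.pos j ∧ w (-PM.pos j) < w (PM.pos i)
        then pairWt (PM.pos i, -PM.pos j) else 0) +
      ((if (-PM.pos i = -PM.pos j → c) ∧ -PM.pos i < PM.pos j ∧ w (PM.pos j) < w (-PM.pos i)
        then pairWt (-PM.pos i, PM.pos j) else 0) +
      (if (-PM.pos i = - -PM.pos j → c) ∧ -PM.pos i < -PM.pos j ∧ w (-PM.pos j) < w (-PM.pos i)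
        then pairWt (-PM.pos i, -PM.pos j) else 0)) =
      (if (i : ℕ) < j ∧ (w (PM.pos j) : ℤ) < w (PM.pos i) then 1 else 0) +
      ((if i = j then (if c ∧ (w (PM.pos i) : ℤ) < 0 then 2 else 0)
        else if (w (PM.pos j) : ℤ) < -w (PM.pos i) then 1 else 0) +
      if (j : ℕ) < i ∧ (w (PM.pos i) : ℤ) < w (PM.pos j) then 1 else 0) := by
    intro i j
    simp only [pairWt, hw _, Subtype.ext_iff, ← Subtype.coe_lt_coe, PM.coe_neg, PM.coe_pos]
    have e1 : ¬ ((i : ℤ) + 1 = -((j : ℤ) + 1)) := by omega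
    have e2 : ¬ ((i : ℤ) + 1 < -((j : ℤ) + 1)) := by omega
    have e3 : ¬ (-((i : ℤ) + 1) = - -((j : ℤ) + 1)) := by omega
    have e4 : -((i : ℤ) + 1) < (j : ℤ) + 1 := by omega
    have e5 : (i : ℤ) + 1 < (j : ℤ) + 1 ↔ (i : ℕ) < j := by omega
    have e6 : -((i : ℤ) + 1) < -((j : ℤ) + 1) ↔ (j : ℕ) < i := by omega
    have e7 : -((i : ℤ) + 1) = -((j : ℤ) + 1) ↔ i = j := by rw [Fin.ext_iff]; omega
    have e8 : -(w (PM.pos j) : ℤ) < -w (PM.pos i) ↔ (w (PM.pos i) : ℤ) < w (PM.pos j) := by omega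
    simp only [e1, e2, e3, e4, e5, e6, e7, e8, false_imp_iff, true_and, false_and, and_false,
      if_false, add_zero]
    congr 1
    congr 1
    by_cases h : i = j
    · subst h
      have : (w (PM.pos i) : ℤ) < -w (PM.pos i) ↔ (w (PM.pos i) : ℤ) < 0 := by omega
      simp [this]
    · simp [h]
  rw [hS, hN, hI, PM.sum_eq, ← Finset.sum_add_distrib]
  simp_rw [PM.sum_eq, ← Finset.sum_add_distrib, Finset.mul_sum]
  -- The two representatives (a, b) and (−b, −a) of a root sit at transposed places (i, j) and (j,
  -- i), so the double sums agree only after symmetrization.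
  refine sum_sum_eq_of_add_swap fun i j => ?_
  have hu := PM.coe_ne_zero (w (PM.pos i))
  have hv := PM.coe_ne_zero (w (PM.pos j))
  have hne : ((w (PM.pos i) : PM n) : ℤ).natAbs = ((w (PM.pos j) : PM n) : ℤ).natAbs → i = j :=
    fun h => Fin.ext ((isSigned_oneLine hw).inj i i.2 j j.2 (by rwa [oneLine_coe, oneLine_coe]))
  simp only [hterm, oneLine_coe, pairInv]
  rcases lt_trichotomy i j with h | h | h
  · have hn := mt hne h.ne
    simp only [Fin.lt_def.mp h, (Fin.lt_def.mp h).not_gt, h.ne, h.ne', if_true, if_false, true_and,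
      false_and]
    split_ifs <;> omega
  · subst h
    simp only [lt_irrefl, if_true, if_false, false_and, ← two_mul]
    by_cases hc : c
    · simp only [hc, true_and]
      split_ifs <;> omega
    · simp [hc]
  · have hn := mt hne h.ne'
    simp only [Fin.lt_def.mp h, (Fin.lt_def.mp h).not_gt, h.ne, h.ne', if_true, if_false, true_and,
      false_and]
    split_ifs <;> omega

end OneLine
-- The root systems of types B and D.
section ConcreteRootSystems

variable {n : ℕ}

/-- The lower entry of the `i`-th simple root: `i`, or `-1` for `i = 0`. -/
def lowRoot (i : Fin n) : PM n :=
  if h : 1 ≤ i.1 then PM.ofNat i.1 h i.2.le else -PM.ofNat 1 le_rfl (by have := i.2; omega)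

/-- The upper entry of the `i`-th simple root: `i + 1`, or `c` for `i = 0`. -/
def highRoot (c : PM n) (i : Fin n) : PM n :=
  if 1 ≤ i.1 then PM.ofNat (i.1 + 1) (by omega) i.2 else c

lemma coe_lowRoot (i : Fin n) : (lowRoot i : ℤ) = if 1 ≤ i.1 then (i : ℤ) else -1 := by
  unfold lowRoot; split_ifs <;> simp

lemma coe_highRoot (c : PM n) (i : Fin n) :
    (highRoot c i : ℤ) = if 1 ≤ i.1 then (i : ℤ) + 1 else c := by
  unfold highRoot; split_ifs <;> simp

lemma apply_lowRoot (w : Equiv.Perm (PM n)) {i : Fin n} (hi : 1 ≤ i.1) :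
    (w (lowRoot i) : ℤ) = oneLine w (i - 1) := by
  rw [oneLine, dif_pos (by omega)]
  congr 2
  exact Subtype.ext (by rw [coe_lowRoot, PM.coe_pos, if_pos hi]; simp only; omega)

lemma apply_highRoot (w : Equiv.Perm (PM n)) (c : PM n) {i : Fin n} (hi : 1 ≤ i.1) :
    (w (highRoot c i) : ℤ) = oneLine w i := by
  rw [oneLine, dif_pos i.2]
  congr 2
  exact Subtype.ext (by rw [coe_highRoot, PM.coe_pos, if_pos hi])

lemma oneLine_one (k : ℕ) (hk : k < n) : oneLine (1 : Equiv.Perm (PM n)) k = k + 1 := by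
  rw [oneLine, dif_pos hk, Equiv.Perm.one_apply, PM.coe_pos]

/-- An increasing tail of values which starts high enough is the identity. -/
lemma eq_of_increasing {b : ℕ → ℤ} (hb : IsSigned n b) {k : ℕ} (hk : (k : ℤ) + 1 ≤ b k)
    (hinc : ∀ i, k < i → i < n → b (i - 1) < b i) (i : ℕ) (hki : k ≤ i) (hi : i < n) :
    b i = i + 1 := by
  -- Strict increase carries the lower bound up from `k`; likewise the bound `b (n - 1)` ≤ n is
  -- carried down from the top, and the two meet.
  have hlow : ∀ j, k + j < n → ((k + j : ℕ) : ℤ) + 1 ≤ b (k + j) := by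
    intro j
    induction j with
    | zero => intro _; simpa using hk
    | succ j ih =>
      intro hj
      have h1 := ih (by omega)
      have h2 := hinc (k + (j + 1)) (by omega) hj
      rw [show k + (j + 1) - 1 = k + j by omega] at h2
      push_cast at h1 ⊢
      omega
  have hup : ∀ j, k + j < n → b (n - 1 - j) ≤ ((n - 1 - j : ℕ) : ℤ) + 1 := by
    intro j
    induction j with
    | zero =>
      intro _
      have := (hb.mem (n - 1) (by omega)).2
      simp only [Nat.sub_zero]
      omega
    | succ j ih =>
      intro hj
      have h1 := ih (by omega)
      have h2 := hinc (n - 1 - j) (by omega) (by omega)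
      rw [show n - 1 - j - 1 = n - 1 - (j + 1) by omega] at h2
      omega
  have h1 := hlow (i - k) (by omega)
  have h2 := hup (n - 1 - i) (by omega)
  rw [show k + (i - k) = i by omega] at h1
  rw [show n - 1 - (n - 1 - i) = i by omega] at h2
  omega

lemma negCount_eq (w : Equiv.Perm (PM n)) : negCount w = negEntries n (oneLine w) := by
  rw [negCount, Finset.card_filter, PM.sum_eq, negEntries,
    ← Fin.sum_univ_eq_sum_range fun i => if oneLine w i < 0 then 1 else 0]
  refine Finset.sum_congr rfl fun i _ => ?_
  have h1 : (0 : ℤ) < (i : ℤ) + 1 := by positivity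
  have h2 : ¬ ((0 : ℤ) < -((i : ℤ) + 1)) := by omega
  simp only [PM.coe_neg, PM.coe_pos, h1, h2, true_and, false_and, if_false, add_zero, oneLine_coe]

lemma refl_lowRoot_highRoot_inj (c : PM n) (hc : (c : ℤ) = 1 ∨ (c : ℤ) = 2) {i j : Fin n}
    (h : refl (lowRoot i) (highRoot c i) = refl (lowRoot j) (highRoot c j)) : i = j := by
  have h1 : ∀ a : PM n, ((refl (lowRoot i) (highRoot c i) a : PM n) : ℤ) =
      ((refl (lowRoot j) (highRoot c j) a : PM n) : ℤ) := fun a => by rw [h]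
  have h2 := h1 (lowRoot i)
  simp only [coe_refl_apply, coe_lowRoot, coe_highRoot] at h2
  apply Fin.ext
  by_cases h1i : 1 ≤ i.1 <;> by_cases h1j : 1 ≤ j.1 <;> try omega
  all_goals
    simp only [h1i, h1j, if_true, if_false] at h2
    rcases hc with hc | hc <;> (try simp only [hc] at h2) <;>
      split_ifs at h2 <;> first | omega | contradiction

lemma refl_lowRoot_highRoot_flip (c : PM n) {p : Prop} (hc : (c : ℤ) = 1 ∨ (c : ℤ) = 2 ∧ ¬ p)
    (i : Fin n) (a b : PM n) (hR : a = -b → p) (hab : a < b)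
    (h : refl (lowRoot i) (highRoot c i) b < refl (lowRoot i) (highRoot c i) a) :
    (a = lowRoot i ∧ b = highRoot c i) ∨ (a = -highRoot c i ∧ b = -lowRoot i) := by
  have ha := PM.coe_ne_zero a
  have hb := PM.coe_ne_zero b
  have hRp : (a : ℤ) = -(b : ℤ) → p := fun h => hR (Subtype.ext (by rw [h, PM.coe_neg]))
  rw [← Subtype.coe_lt_coe] at hab h
  simp only [Subtype.ext_iff, PM.coe_neg]
  simp only [coe_refl_apply, coe_lowRoot, coe_highRoot] at h ⊢
  by_cases hi : 1 ≤ i.1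
  · simp only [hi, if_true] at h ⊢
    clear hc hR hRp
    split_ifs at h <;> omega
  · simp only [hi, if_false] at h ⊢
    rcases hc with hc | ⟨hc, hp⟩
    · rw [hc] at h ⊢
      split_ifs at h <;> omega
    · have hne : (a : ℤ) ≠ -(b : ℤ) := fun h => hp (hRp h)
      rw [hc] at h ⊢
      split_ifs at h <;> omega

lemma adjSwap_eq_refl (i : ℕ) (h1 : 1 ≤ i) (h2 : i < n) :
    adjSwap i h1 h2 = refl (PM.ofNat i h1 h2.le) (PM.ofNat (i + 1) (by omega) h2) := by
  rw [refl, if_neg, adjSwap]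
  rw [Subtype.ext_iff, PM.coe_neg, PM.coe_ofNat, PM.coe_ofNat]
  omega

lemma isRootSystem_B (hn : 1 ≤ n) :
    IsRootSystem (B n) (fun a b => a = -b → True) (genB n) lowRoot
      (highRoot (PM.ofNat 1 le_rfl hn)) where
  le := le_rfl
  map _ _ _ _ _ _ := trivial
  symm _ _ _ _ := trivial
  neg _ _ _ _ := trivial
  root _ _ := trivial
  lt i := by
    rw [← Subtype.coe_lt_coe, coe_lowRoot, coe_highRoot]
    split_ifs <;> simp
  gen i := by
    unfold genB lowRoot highRoot
    split_ifs with h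
    · exact adjSwap_eq_refl _ _ _
    · rw [refl, if_pos rfl]
  inj i j h := by
    refine refl_lowRoot_highRoot_inj (PM.ofNat 1 le_rfl hn) (Or.inl rfl) ?_
    have hg : ∀ i : Fin n, (genB n i : Equiv.Perm (PM n)) =
        refl (lowRoot i) (highRoot (PM.ofNat 1 le_rfl hn) i) := fun i => by
      unfold genB lowRoot highRoot
      split_ifs with h
      · exact adjSwap_eq_refl _ _ _
      · rw [refl, if_pos rfl]
    rw [← hg, ← hg, h]
  flip i a b hR hab h := refl_lowRoot_highRoot_flip _ (Or.inl rfl) i a b hR hab h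
  ident w hw h := by
    have hb := isSigned_oneLine hw
    refine eq_of_oneLine_eq hw (B n).one_mem fun k hk => ?_
    rw [oneLine_one k hk]
    refine eq_of_increasing hb (k := 0) ?_ (fun i hi hin => ?_) k (Nat.zero_le k) hk
    · have h0 := h ⟨0, hn⟩
      have h1 : lowRoot (⟨0, hn⟩ : Fin n) = -PM.pos ⟨0, hn⟩ :=
        Subtype.ext (by rw [coe_lowRoot, PM.coe_neg, PM.coe_pos]; simp)
      have h2 : highRoot (PM.ofNat 1 le_rfl hn) (⟨0, hn⟩ : Fin n) = PM.pos ⟨0, hn⟩ :=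
        Subtype.ext (by rw [coe_highRoot, PM.coe_pos]; simp)
      rw [h1, h2, hw, ← Subtype.coe_lt_coe, PM.coe_neg, ← oneLine_coe] at h0
      simp only at h0
      push_cast
      omega
    · have h0 := h ⟨i, hin⟩
      rwa [← Subtype.coe_lt_coe, apply_lowRoot _ (by exact hi), apply_highRoot _ _ (by exact hi)]
        at h0

lemma isRootSystem_D (hn : 2 ≤ n) :
    IsRootSystem (D n) (fun a b => a = -b → False) (genD n) lowRoot
      (highRoot (PM.ofNat 2 one_le_two hn)) where
  le _ hw := hw.1
  map w hw a b hR h := hR (by rw [← hw.1, w.injective.eq_iff] at h; exact h)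
  symm a b hR h := hR (by rw [h, PM.neg_neg])
  neg a b hR h := hR (PM.neg_inj.mp h)
  root i := by
    rw [Subtype.ext_iff, PM.coe_neg, coe_lowRoot, coe_highRoot]
    split_ifs <;> simp; omega
  lt i := by
    rw [← Subtype.coe_lt_coe, coe_lowRoot, coe_highRoot]
    split_ifs <;> simp
  gen i := by
    unfold genD lowRoot highRoot
    split_ifs with h
    · exact adjSwap_eq_refl _ _ _
    · rw [refl, if_neg]
      · rfl
      rw [Subtype.ext_iff, PM.coe_neg, PM.coe_neg, PM.coe_ofNat, PM.coe_ofNat]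
      simp
  inj i j h := by
    refine refl_lowRoot_highRoot_inj (PM.ofNat 2 one_le_two hn) (Or.inr rfl) ?_
    have hg : ∀ i : Fin n, (genD n i : Equiv.Perm (PM n)) =
        refl (lowRoot i) (highRoot (PM.ofNat 2 one_le_two hn) i) := fun i => by
      unfold genD lowRoot highRoot
      split_ifs with h
      · exact adjSwap_eq_refl _ _ _
      · rw [refl, if_neg]
        · rfl
        rw [Subtype.ext_iff, PM.coe_neg, PM.coe_neg, PM.coe_ofNat, PM.coe_ofNat]
        simp
    rw [← hg, ← hg, h]
  flip i a b hR hab h := refl_lowRoot_highRoot_flip _ (Or.inr ⟨rfl, not_false⟩) i a b hR hab h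
  ident w hw h := by
    have hb := isSigned_oneLine hw.1
    have h0 := h ⟨0, by omega⟩
    have e1 : lowRoot (⟨0, by omega⟩ : Fin n) = -PM.pos ⟨0, by omega⟩ :=
      Subtype.ext (by rw [coe_lowRoot, PM.coe_neg, PM.coe_pos]; simp)
    have e2 : highRoot (PM.ofNat 2 one_le_two hn) (⟨0, by omega⟩ : Fin n) = PM.pos ⟨1, by omega⟩ :=
      Subtype.ext (by rw [coe_highRoot, PM.coe_pos]; simp)
    rw [e1, e2, hw.1, ← Subtype.coe_lt_coe, PM.coe_neg, ← oneLine_coe, ← oneLine_coe] at h0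
    simp only at h0
    have hinc : ∀ i, 0 < i → i < n → oneLine w (i - 1) < oneLine w i := fun i hi hin => by
      have h1 := h ⟨i, hin⟩
      rwa [← Subtype.coe_lt_coe, apply_lowRoot _ (by exact hi), apply_highRoot _ _ (by exact hi)]
        at h1
    have h1 := hinc 1 one_pos hn
    have hm0 := hb.mem 0 (by omega)
    simp only [Nat.sub_self] at h1
    -- From −w(1) < w(2) and w(1) < w(2) follows w(2) > |w(1)| ≥ 1, so w fixes 2, …, n. Then w(1) =
    -- ±1, and parity excludes −1.
    have htail := eq_of_increasing hb (k := 1) (by push_cast; omega) fun i hi hin =>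
      hinc i (by omega) hin
    have h2 := htail 1 le_rfl (by omega)
    push_cast at h2
    have hpos : 0 < oneLine w 0 := by
      by_contra hcon
      have heven := hw.2
      rw [negCount_eq, negEntries, Finset.sum_eq_single 0, if_pos (by omega)] at heven
      · exact absurd heven (by decide)
      · intro i hi hi0
        rw [if_neg]
        have := htail i (by omega) (by simpa using hi)
        omega
      · intro hcon'
        exact absurd (Finset.mem_range.mpr (by omega)) hcon'
    refine eq_of_oneLine_eq hw.1 (B n).one_mem fun k hk => ?_
    rw [oneLine_one k hk]
    rcases Nat.eq_zero_or_pos k with rfl | hk0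
    · push_cast; omega
    · exact htail k hk0 hk

end ConcreteRootSystems
-- Reversal of patterns, and sums with finite-range correlations.
section LocalPatterns

variable {W ι : Type*} [Group W] [Fintype W] {s : ι → W} {q : ℝ}

/-- A pattern which always has an ascent at `i` is `q` times less likely in reverse. -/
lemma malE_pattern (hs : IsLengthSystem s) (i : ι) {p p' : W → Prop}
    [DecidablePred p] [DecidablePred p']
    (hp : ∀ g, p' (g * s i) ↔ p g) (hasc : ∀ g, p g → ¬ IsDescent s g i) {F : W → ℝ}
    (hF : ∀ g, F (g * s i) = F g) :
    malE s q (fun g => if p' g then F g else 0) = q * malE s q fun g => if p g then F g else 0 := by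
  unfold malE
  rw [← Equiv.sum_comp (Equiv.mulRight (s i)), Finset.mul_sum]
  refine Finset.sum_congr rfl fun g _ => ?_
  simp only [Equiv.coe_mulRight, hp, hF]
  by_cases h : p g
  · simp only [h, if_true, mal_mul_gen hs (hasc g h)]; ring
  · simp [h]

/-- The second moment of a sum of bounded variables with correlations of range `2`. -/
lemma malE_sq_sum_le (hq : 0 < q) (T : Finset ℕ) (U : ℕ → W → ℝ)
    (hU : ∀ k g, |U k g| ≤ 1)
    (h0 : ∀ k ∈ T, ∀ j ∈ T, k + 3 ≤ j ∨ j + 3 ≤ k → malE s q (fun g => U k g * U j g) = 0) :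
    malE s q (fun g => (∑ k ∈ T, U k g) ^ 2) ≤ 5 * T.card := by
  have h1 : (fun g => (∑ k ∈ T, U k g) ^ 2) = fun g => ∑ k ∈ T, ∑ j ∈ T, U k g * U j g := by
    ext g; rw [sq, Finset.sum_mul_sum]
  have h2 : malE s q (fun g => (∑ k ∈ T, U k g) ^ 2) =
      ∑ k ∈ T, ∑ j ∈ T, malE s q fun g => U k g * U j g := by
    rw [h1, malE_sum]
    exact Finset.sum_congr rfl fun k _ => malE_sum _ _
  have h3 : ∀ k ∈ T, ∑ j ∈ T, malE s q (fun g => U k g * U j g) ≤ 5 := by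
    intro k hk
    have h4 : ∀ j ∈ T, malE s q (fun g => U k g * U j g) ≤
        if j ∈ Finset.Icc (k - 2) (k + 2) then 1 else 0 := by
      intro j hj
      split_ifs with hjk
      · refine (malE_mono hq (G := fun _ => (1 : ℝ)) fun g => ?_).trans_eq (malE_const s hq 1)
        refine (le_abs_self _).trans ?_
        rw [abs_mul]
        exact mul_le_one₀ (hU k g) (abs_nonneg _) (hU j g)
      · rw [Finset.mem_Icc] at hjk
        exact (h0 k hk j hj (by omega)).le
    refine (Finset.sum_le_sum h4).trans ?_
    rw [Finset.sum_boole]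
    have h5 : (T.filter fun j => j ∈ Finset.Icc (k - 2) (k + 2)).card ≤ 5 := by
      refine (Finset.card_le_card fun j hj => (Finset.mem_filter.mp hj).2).trans ?_
      rw [Nat.card_Icc]
      omega
    exact_mod_cast h5
  rw [h2]
  refine (Finset.sum_le_sum h3).trans_eq ?_
  rw [Finset.sum_const, nsmul_eq_mul, mul_comm]

end LocalPatterns

/-! ### The jumps of the descent statistics across an edge. -/

section Jumps

variable {n : ℕ} {G : Subgroup (Equiv.Perm (PM n))} {R : PM n → PM n → Prop} {s : Fin n → G}
  {c : PM n}

lemma IsRootSystem.oneLine_mul_gen (h : IsRootSystem G R s lowRoot (highRoot c)) (w : G) {r : ℕ}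
    (hr : r + 1 < n) (k : ℕ) : oneLine ((w * s ⟨r + 1, hr⟩ : G) : Equiv.Perm (PM n)) k =
      if k = r then oneLine (w : Equiv.Perm (PM n)) (r + 1) else
        if k = r + 1 then oneLine (w : Equiv.Perm (PM n)) r else
          oneLine (w : Equiv.Perm (PM n)) k := by
  have key : ∀ (k l : ℕ) (hk : k < n) (hl : l < n),
      (l : ℤ) + 1 = refl (lowRoot ⟨r + 1, hr⟩) (highRoot c ⟨r + 1, hr⟩) (PM.pos ⟨k, hk⟩) →
      oneLine ((w * s ⟨r + 1, hr⟩ : G) : Equiv.Perm (PM n)) k =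
        oneLine (w : Equiv.Perm (PM n)) l := by
    intro k l hk hl hkl
    rw [oneLine, oneLine, dif_pos hk, dif_pos hl, h.mul_gen_apply]
    congr 2
    exact Subtype.ext (by rw [← hkl, PM.coe_pos])
  split_ifs with h1 h2
  · refine key k _ (by omega) hr ?_
    rw [coe_refl_apply, coe_lowRoot, coe_highRoot, PM.coe_pos]
    simp only [Nat.le_add_left, if_true]
    push_cast
    split_ifs <;> omega
  · refine key k _ (by omega) (by omega) ?_
    rw [coe_refl_apply, coe_lowRoot, coe_highRoot, PM.coe_pos]
    simp only [Nat.le_add_left, if_true]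
    push_cast
    split_ifs <;> omega
  · by_cases hk : k < n
    · refine key k _ hk hk ?_
      rw [coe_refl_apply, coe_lowRoot, coe_highRoot, PM.coe_pos]
      simp only [Nat.le_add_left, if_true]
      push_cast
      split_ifs <;> omega
    · rw [oneLine, oneLine, dif_neg hk, dif_neg hk]

lemma IsRootSystem.isDescent_succ_iff (h : IsRootSystem G R s lowRoot (highRoot c)) (w : G) {r : ℕ}
    (hr : r + 1 < n) : IsDescent s w ⟨r + 1, hr⟩ ↔
      oneLine (w : Equiv.Perm (PM n)) (r + 1) < oneLine (w : Equiv.Perm (PM n)) r := by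
  rw [h.isDescent_iff, ← Subtype.coe_lt_coe, apply_lowRoot _ (Nat.le_add_left 1 r),
    apply_highRoot _ _ (Nat.le_add_left 1 r)]
  rfl

/-- Generators that are far apart do not interfere with each other's descents. -/
lemma IsRootSystem.isDescent_mul_gen_of_far (h : IsRootSystem G R s lowRoot (highRoot c))
    (hc : (c : ℤ) = 1 ∨ (c : ℤ) = 2) (w : G) {i k : Fin n}
    (h2 : i.1 + 2 ≤ k ∨ k.1 + 2 ≤ i) (h3 : 3 ≤ i.1 ∨ i.1 + 3 ≤ k) :
    IsDescent s (w * s i) k ↔ IsDescent s w k := by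
  have e1 : refl (lowRoot i) (highRoot c i) (lowRoot k) = lowRoot k := by
    apply Subtype.ext
    simp only [coe_refl_apply, coe_lowRoot, coe_highRoot]
    rcases hc with hc | hc <;> simp only [hc] <;> split_ifs <;> first | omega | contradiction
  have e2 : refl (lowRoot i) (highRoot c i) (highRoot c k) = highRoot c k := by
    apply Subtype.ext
    simp only [coe_refl_apply, coe_lowRoot, coe_highRoot]
    rcases hc with hc | hc <;> simp only [hc] <;> split_ifs <;> omega
  rw [h.isDescent_iff, h.isDescent_iff, h.mul_gen_apply, h.mul_gen_apply, e1, e2]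

open Classical in
/-- The number of generators that are conjugate to `s i` by `w`. -/
noncomputable def conjCount {W ι : Type*} [Group W] [Fintype ι] (s : ι → W) (w : W) (i : ι) : ℝ :=
  ∑ j, if s j * w = w * s i then 1 else 0

open Classical in
/-- The change of the one-sided descent statistic across the edge `{w, w * s i}`. -/
noncomputable def localJump {W ι : Type*} [Group W] [Fintype ι] (s : ι → W) (w : W) (i : ι) : ℝ :=
  descentSign s w i * ∑ k, ((if IsDescent s w k then 1 else 0) -
    if IsDescent s (w * s i) k then 1 else 0)

/-- Across an ascending edge the left descents gain precisely the generators conjugate to s_i by w.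
Passing from w to w s_i does not change `conjCount`, so the descending case reduces to the ascending
one. -/
lemma desJump_eq {W ι : Type*} [Group W] [Fintype ι] {s : ι → W} (hs : IsLengthSystem s)
    (w : W) (i : ι) : desJump s w i = localJump s w i + conjCount s w i := by
  classical
  have key : ∀ w, ¬ IsDescent s w i → ((des s (w * s i)⁻¹ : ℝ) - des s w⁻¹) = conjCount s w i := by
    intro w hw
    rw [des_eq_sum, des_eq_sum, ← Finset.sum_sub_distrib, conjCount]
    refine Finset.sum_congr rfl fun j _ => ?_
    rw [isDescent_inv_mul_gen hs hw]
    ring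
  have hsum : ∑ k, ((if IsDescent s w k then (1 : ℝ) else 0) -
      if IsDescent s (w * s i) k then 1 else 0) = des s w - des s (w * s i) := by
    rw [Finset.sum_sub_distrib, des_eq_sum, des_eq_sum]
  rw [desJump, localJump, hsum, twoSidedDes, twoSidedDes, descentSign]
  push_cast
  split_ifs with h
  · have h1 := key (w * s i) (by rw [isDescent_mul_gen hs]; exact not_not.mpr h)
    have h2 : conjCount s (w * s i) i = conjCount s w i := by
      unfold conjCount
      refine Finset.sum_congr rfl fun j _ => ?_
      rw [← mul_assoc, mul_left_inj]
    rw [mul_gen_mul_gen hs, h2] at h1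
    linarith
  · have h1 := key w h
    linarith

lemma conjCount_nonneg {W ι : Type*} [Group W] [Fintype ι] (s : ι → W) (w : W) (i : ι) :
    0 ≤ conjCount s w i := Finset.sum_nonneg fun _ _ => by split_ifs <;> norm_num

lemma sum_ite_le_one {ι : Type*} (t : Finset ι) (p : ι → Prop) [DecidablePred p]
    (hp : ∀ i j, p i → p j → i = j) : ∑ i ∈ t, (if p i then 1 else 0 : ℝ) ≤ 1 := by
  rw [Finset.sum_boole]
  exact_mod_cast Finset.card_le_one.mpr fun i hi j hj =>
    hp i j (Finset.mem_filter.mp hi).2 (Finset.mem_filter.mp hj).2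

lemma conjCount_le_one {W ι : Type*} [Group W] [Fintype ι] {s : ι → W} (hs : IsLengthSystem s)
    (w : W) (i : ι) : conjCount s w i ≤ 1 := by
  classical
  exact sum_ite_le_one _ _ fun j k hj hk => hs.inj (mul_right_cancel (hj.trans hk.symm))

lemma abs_descentSign {W ι : Type*} [Group W] (s : ι → W) (w : W) (i : ι) :
    |descentSign s w i| = 1 := by
  unfold descentSign; split_ifs <;> simp

/-- Only descents at distance at most 2 from i can change. This crude bound serves the few
generators near the ends. -/
lemma IsRootSystem.abs_localJump_le (h : IsRootSystem G R s lowRoot (highRoot c))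
    (hc : (c : ℤ) = 1 ∨ (c : ℤ) = 2) (w : G) (i : Fin n) : |localJump s w i| ≤ 5 := by
  classical
  rw [localJump, abs_mul, abs_descentSign, one_mul]
  refine (Finset.abs_sum_le_sum_abs _ _).trans (le_trans (b := ∑ k : Fin n,
    if k.1 ∈ Finset.Icc (i.1 - 2) (i.1 + 2) then (1 : ℝ) else 0) ?_ ?_)
  · refine Finset.sum_le_sum fun k _ => ?_
    by_cases hk : k.1 ∈ Finset.Icc (i.1 - 2) (i.1 + 2)
    · rw [if_pos hk]
      split_ifs <;> simp
    · rw [Finset.mem_Icc] at hk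
      rw [h.isDescent_mul_gen_of_far hc w (by omega) (by omega), sub_self, abs_zero]
      split_ifs <;> simp
  · rw [Fin.sum_univ_eq_sum_range
      fun k => if k ∈ Finset.Icc (i.1 - 2) (i.1 + 2) then (1 : ℝ) else 0, Finset.sum_boole]
    have h5 : ((Finset.range n).filter fun j => j ∈ Finset.Icc (i.1 - 2) (i.1 + 2)).card ≤ 5 := by
      refine (Finset.card_le_card fun j hj => (Finset.mem_filter.mp hj).2).trans ?_
      rw [Nat.card_Icc]
      omega
    exact_mod_cast h5

/-- `1` if `b r` lies between `b (r + 1)` and `b (r + 2)`. -/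
noncomputable def medFirst (b : ℕ → ℤ) (r : ℕ) : ℝ :=
  if b (r + 1) < b r ∧ b r < b (r + 2) ∨ b (r + 2) < b r ∧ b r < b (r + 1) then 1 else 0

/-- `1` if `b (r + 2)` lies between `b r` and `b (r + 1)`. -/
noncomputable def medLast (b : ℕ → ℤ) (r : ℕ) : ℝ :=
  if b r < b (r + 2) ∧ b (r + 2) < b (r + 1) ∨ b (r + 1) < b (r + 2) ∧ b (r + 2) < b r then 1 else 0

lemma IsSigned.ne {m : ℕ} {b : ℕ → ℤ} (hb : IsSigned m b) {i j : ℕ} (hi : i < m) (hj : j < m)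
    (hij : i ≠ j) : b i ≠ b j := fun he => hij (hb.inj i hi j hj (by rw [he]))

/-- Only the descents at i − 1, i and i + 1 can change. The one at i always does; a neighbouring one
changes exactly when the outer entry lies between the two exchanged entries, and then with the
opposite sign. Taking i ≥ 3 avoids s_0, which in type D moves the places 1 and 2. -/
lemma IsRootSystem.localJump_eq (h : IsRootSystem G R s lowRoot (highRoot c))
    (hc : (c : ℤ) = 1 ∨ (c : ℤ) = 2) (w : G) {t : ℕ} (ht : t + 4 < n) :
    localJump s w ⟨t + 3, by omega⟩ = 1 - medFirst (oneLine (w : Equiv.Perm (PM n))) (t + 1) -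
      medLast (oneLine (w : Equiv.Perm (PM n))) (t + 2) := by
  classical
  set i : Fin n := ⟨t + 3, by omega⟩ with hi
  have h0 : ∀ k ∈ Finset.univ, k ∉ ({⟨t + 2, by omega⟩, i, ⟨t + 4, ht⟩} : Finset (Fin n)) →
      (if IsDescent s w k then (1 : ℝ) else 0) - (if IsDescent s (w * s i) k then 1 else 0) = 0 := by
    intro k _ hk
    simp only [Finset.mem_insert, Finset.mem_singleton, not_or, Fin.ext_iff, hi] at hk
    rw [h.isDescent_mul_gen_of_far hc w (by simp only [hi]; omega) (by simp only [hi]; omega),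
      sub_self]
  have hb := isSigned_oneLine (h.le w.2)
  have n12 := hb.ne (i := t + 1) (j := t + 2) (by omega) (by omega) (by omega)
  have n13 := hb.ne (i := t + 1) (j := t + 3) (by omega) (by omega) (by omega)
  have n23 := hb.ne (i := t + 2) (j := t + 3) (by omega) (by omega) (by omega)
  have n24 := hb.ne (i := t + 2) (j := t + 4) (by omega) (by omega) (by omega)
  have n34 := hb.ne (i := t + 3) (j := t + 4) (by omega) (by omega) (by omega)
  rw [localJump, ← Finset.sum_subset (Finset.subset_univ _) h0, Finset.sum_insert,
    Finset.sum_insert, Finset.sum_singleton, descentSign]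
  · rw [hi]
    simp only [h.isDescent_succ_iff, h.oneLine_mul_gen]
    simp only [medFirst, medLast, show t + 1 + 1 = t + 2 by omega, show t + 1 + 2 = t + 3 by omega,
      show t + 2 + 2 = t + 4 by omega, show t + 1 ≠ t + 2 by omega,
      show t + 1 ≠ t + 3 by omega, show t + 3 ≠ t + 2 by omega, show t + 4 ≠ t + 2 by omega,
      show t + 4 ≠ t + 3 by omega, if_true, if_false]
    generalize oneLine (w : Equiv.Perm (PM n)) (t + 1) = b1 at *
    generalize oneLine (w : Equiv.Perm (PM n)) (t + 2) = b2 at *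
    generalize oneLine (w : Equiv.Perm (PM n)) (t + 3) = b3 at *
    generalize oneLine (w : Equiv.Perm (PM n)) (t + 4) = b4 at *
    clear h0 hb
    split_ifs <;> first | omega | norm_num
  · simp [hi]
  · simp [hi]

end Jumps
-- Means and correlations of the median patterns.
section PatternMeans

variable {n : ℕ} {G : Subgroup (Equiv.Perm (PM n))} [Fintype G] {R : PM n → PM n → Prop}
  {s : Fin n → G} {c : PM n} {q : ℝ}

/-- The probability of a given entry of a uniformly placed triple to be the median. -/
noncomputable def medProb (q : ℝ) : ℝ := q / (1 + q + q ^ 2)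

lemma medProb_nonneg (hq : 0 < q) : 0 ≤ medProb q := by unfold medProb; positivity

/-- Equality occurs at q = 1. This bound, uniform in q, leaves a mean jump of at least 1 − 2/3 at
each interior generator. -/
lemma medProb_le (hq : 0 < q) : medProb q ≤ 1 / 3 := by
  rw [medProb, div_le_div_iff₀ (by positivity) (by norm_num)]
  nlinarith [sq_nonneg (q - 1)]

/-- The means of the median patterns, given the complementary entries. -/
lemma IsRootSystem.malE_med_mul (h : IsRootSystem G R s lowRoot (highRoot c)) (hq : 0 < q) {r : ℕ}
    (hr : r + 2 < n) {F : G → ℝ} (h1 : ∀ w, F (w * s ⟨r + 1, by omega⟩) = F w)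
    (h2 : ∀ w, F (w * s ⟨r + 2, hr⟩) = F w) :
    malE s q (fun w => medFirst (oneLine (w : Equiv.Perm (PM n))) r * F w) =
      medProb q * malE s q F ∧
    malE s q (fun w => medLast (oneLine (w : Equiv.Perm (PM n))) r * F w) =
      medProb q * malE s q F := by
  classical
  have hs := h.isLengthSystem
  let b : G → ℕ → ℤ := fun w => oneLine (w : Equiv.Perm (PM n))
  let x : G → ℤ := fun w => b w r
  let y : G → ℤ := fun w => b w (r + 1)
  let z : G → ℤ := fun w => b w (r + 2)
  have h1r : r + 1 < n := by omega
  have x1 : ∀ w, x (w * s ⟨r + 1, h1r⟩) = y w := fun w => by simp [x, y, b, h.oneLine_mul_gen]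
  have y1 : ∀ w, y (w * s ⟨r + 1, h1r⟩) = x w := fun w => by simp [x, y, b, h.oneLine_mul_gen]
  have z1 : ∀ w, z (w * s ⟨r + 1, h1r⟩) = z w := fun w => by simp [z, b, h.oneLine_mul_gen]
  have x2 : ∀ w, x (w * s ⟨r + 2, hr⟩) = x w := fun w => by
    simp only [x, b, h.oneLine_mul_gen w hr]
    rw [if_neg (by omega), if_neg (by omega)]
  have y2 : ∀ w, y (w * s ⟨r + 2, hr⟩) = z w := fun w => by
    simp only [y, z, b, h.oneLine_mul_gen w hr, if_true]
  have z2 : ∀ w, z (w * s ⟨r + 2, hr⟩) = y w := fun w => by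
    simp only [y, z, b, h.oneLine_mul_gen w hr]
    rw [if_neg (by omega), if_pos trivial]
  have d1 : ∀ w, x w < y w → ¬ IsDescent s w ⟨r + 1, h1r⟩ := fun w hw => by
    rw [h.isDescent_succ_iff]; exact hw.not_gt
  have d2 : ∀ w, y w < z w → ¬ IsDescent s w ⟨r + 2, hr⟩ := fun w hw => by
    rw [h.isDescent_succ_iff w (r := r + 1) hr]; exact hw.not_gt
  -- Relative to the increasing pattern, the six orderings have weights 1, q, q, q², q², q³, with
  -- sum (1 + q)(1 + q + q²). A given outer entry is the median in two of them, of weights q and q².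
  have e213 := malE_pattern (q := q) hs ⟨r + 1, h1r⟩ (p := fun w => x w < y w ∧ y w < z w)
    (p' := fun w => y w < x w ∧ x w < z w) (fun w => by simp only [x1, y1, z1])
    (fun w hw => d1 w hw.1) h1
  have e132 := malE_pattern (q := q) hs ⟨r + 2, hr⟩ (p := fun w => x w < y w ∧ y w < z w)
    (p' := fun w => x w < z w ∧ z w < y w) (fun w => by simp only [x2, y2, z2])
    (fun w hw => d2 w hw.2) h2
  have e312 := malE_pattern (q := q) hs ⟨r + 1, h1r⟩ (p := fun w => x w < z w ∧ z w < y w)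
    (p' := fun w => y w < z w ∧ z w < x w) (fun w => by simp only [x1, y1, z1])
    (fun w hw => d1 w (hw.1.trans hw.2)) h1
  have e231 := malE_pattern (q := q) hs ⟨r + 2, hr⟩ (p := fun w => y w < x w ∧ x w < z w)
    (p' := fun w => z w < x w ∧ x w < y w) (fun w => by simp only [x2, y2, z2])
    (fun w hw => d2 w (hw.1.trans hw.2)) h2
  have e321 := malE_pattern (q := q) hs ⟨r + 2, hr⟩ (p := fun w => y w < z w ∧ z w < x w)
    (p' := fun w => z w < y w ∧ y w < x w) (fun w => by simp only [x2, y2, z2])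
    (fun w hw => d2 w hw.1) h2
  have hne : ∀ w, x w ≠ y w ∧ x w ≠ z w ∧ y w ≠ z w := fun w => by
    have hb := isSigned_oneLine (h.le w.2)
    exact ⟨hb.ne (by omega) (by omega) (by omega), hb.ne (by omega) (by omega) (by omega),
      hb.ne (by omega) (by omega) (by omega)⟩
  have htot : malE s q F = malE s q (fun w => if x w < y w ∧ y w < z w then F w else 0) +
      malE s q (fun w => if y w < x w ∧ x w < z w then F w else 0) +
      malE s q (fun w => if x w < z w ∧ z w < y w then F w else 0) +
      malE s q (fun w => if y w < z w ∧ z w < x w then F w else 0) +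
      malE s q (fun w => if z w < x w ∧ x w < y w then F w else 0) +
      malE s q (fun w => if z w < y w ∧ y w < x w then F w else 0) := by
    rw [← malE_add, ← malE_add, ← malE_add, ← malE_add, ← malE_add]
    congr 1; ext w
    obtain ⟨n1, n2, n3⟩ := hne w
    split_ifs <;> first | omega | simp
  have hF : malE s q (fun w => medFirst (b w) r * F w) =
      malE s q (fun w => if y w < x w ∧ x w < z w then F w else 0) +
      malE s q (fun w => if z w < x w ∧ x w < y w then F w else 0) := by
    rw [← malE_add]
    congr 1; ext w
    obtain ⟨n1, n2, n3⟩ := hne w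
    simp only [medFirst]
    change (if y w < x w ∧ x w < z w ∨ z w < x w ∧ x w < y w then (1 : ℝ) else 0) * F w = _
    split_ifs <;> first | omega | simp
  have hL : malE s q (fun w => medLast (b w) r * F w) =
      malE s q (fun w => if x w < z w ∧ z w < y w then F w else 0) +
      malE s q (fun w => if y w < z w ∧ z w < x w then F w else 0) := by
    rw [← malE_add]
    congr 1; ext w
    obtain ⟨n1, n2, n3⟩ := hne w
    simp only [medLast]
    change (if x w < z w ∧ z w < y w ∨ y w < z w ∧ z w < x w then (1 : ℝ) else 0) * F w = _
    split_ifs <;> first | omega | simp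
  rw [e231, e213] at hF
  rw [e312, e132] at hL
  rw [e321, e312, e231, e213, e132] at htot
  have : 1 + q + q ^ 2 ≠ 0 := by positivity
  refine ⟨hF.trans ?_, hL.trans ?_⟩ <;>
  · rw [htot, medProb]
    field_simp
    ring

lemma medFirst_mem (b : ℕ → ℤ) (r : ℕ) : 0 ≤ medFirst b r ∧ medFirst b r ≤ 1 := by
  unfold medFirst; split_ifs <;> simp

lemma medLast_mem (b : ℕ → ℤ) (r : ℕ) : 0 ≤ medLast b r ∧ medLast b r ≤ 1 := by
  unfold medLast; split_ifs <;> simp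

lemma malE_sq_sum_sub_le (s : Fin n → G) (hq : 0 < q) (T : Finset ℕ) (M : ℕ → G → ℝ)
    (hM : ∀ k g, 0 ≤ M k g ∧ M k g ≤ 1)
    (h : ∀ k ∈ T, ∀ j ∈ T, k + 3 ≤ j ∨ j + 3 ≤ k →
      malE s q (fun g => M k g * (M j g - medProb q)) =
        medProb q * malE s q fun g => M j g - medProb q) :
    malE s q (fun g => (∑ k ∈ T, (M k g - medProb q)) ^ 2) ≤ 5 * T.card := by
  have hp0 := medProb_nonneg hq
  have hp1 := medProb_le hq
  refine malE_sq_sum_le hq T (fun k g => M k g - medProb q) (fun k g => ?_) fun k hk j hj hkj => ?_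
  · have := hM k g
    rw [abs_le]; constructor <;> linarith
  · simp only [sub_mul]
    rw [malE_sub, malE_mul_left, h k hk j hj hkj, sub_self]

lemma IsRootSystem.malE_sq_sum_medFirst_le (h : IsRootSystem G R s lowRoot (highRoot c))
    (hq : 0 < q) (T : Finset ℕ) (hT : ∀ k ∈ T, k + 2 < n) :
    malE s q (fun w => (∑ k ∈ T, (medFirst (oneLine (w : Equiv.Perm (PM n))) k - medProb q)) ^ 2) ≤
      5 * T.card := by
  refine malE_sq_sum_sub_le s hq T (fun k w => medFirst (oneLine (w : Equiv.Perm (PM n))) k)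
    (fun k w => medFirst_mem _ k) fun k hk j hj hkj =>
      (h.malE_med_mul hq (hT k hk) (fun w => ?_) fun w => ?_).1
  -- Windows starting at distance at least 3 are disjoint, so the exchanges within the window at `k`
  -- leave the pattern at `j` unchanged.
  all_goals
    simp only [medFirst, h.oneLine_mul_gen]
    simp only [show j ≠ k by omega, show j ≠ k + 1 by omega, show j + 1 ≠ k by omega,
      show j + 1 ≠ k + 1 by omega, show j + 2 ≠ k by omega, show j + 2 ≠ k + 1 by omega,
      show j ≠ k + 2 by omega, show j + 1 ≠ k + 2 by omega, show j + 2 ≠ k + 2 by omega, if_false]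

lemma IsRootSystem.malE_sq_sum_medLast_le (h : IsRootSystem G R s lowRoot (highRoot c))
    (hq : 0 < q) (T : Finset ℕ) (hT : ∀ k ∈ T, k + 2 < n) :
    malE s q (fun w => (∑ k ∈ T, (medLast (oneLine (w : Equiv.Perm (PM n))) k - medProb q)) ^ 2) ≤
      5 * T.card := by
  refine malE_sq_sum_sub_le s hq T (fun k w => medLast (oneLine (w : Equiv.Perm (PM n))) k)
    (fun k w => medLast_mem _ k) fun k hk j hj hkj =>
      (h.malE_med_mul hq (hT k hk) (fun w => ?_) fun w => ?_).2
  all_goals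
    simp only [medLast, h.oneLine_mul_gen]
    simp only [show j ≠ k by omega, show j ≠ k + 1 by omega, show j + 1 ≠ k by omega,
      show j + 1 ≠ k + 1 by omega, show j + 2 ≠ k by omega, show j + 2 ≠ k + 1 by omega,
      show j ≠ k + 2 by omega, show j + 1 ≠ k + 2 by omega, show j + 2 ≠ k + 2 by omega, if_false]

end PatternMeans

/-! ### Conjugate generators and consecutive adjacent values. -/

section ConjugateGenerators

variable {n : ℕ} {G : Subgroup (Equiv.Perm (PM n))} {R : PM n → PM n → Prop} {s : Fin n → G}
  {c : PM n}

lemma IsRootSystem.isAdj_of_gen_mul (h : IsRootSystem G R s lowRoot (highRoot c)) (w : G)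
    {r : ℕ} (hr : r + 1 < n) {j : Fin n} (hj : 2 ≤ j.1) (he : s j * w = w * s ⟨r + 1, hr⟩) :
    IsAdj (oneLine (w : Equiv.Perm (PM n)) r) (oneLine (w : Equiv.Perm (PM n)) (r + 1)) := by
  rw [h.gen_mul_eq_iff] at he
  have h1 := congrArg (fun v : Equiv.Perm (PM n) => ((v (lowRoot j) : PM n) : ℤ)) he
  simp only [refl_left] at h1
  have hj1 : 1 ≤ j.1 := by omega
  rw [coe_refl_apply, apply_lowRoot _ (Nat.le_add_left 1 r), apply_highRoot _ _ (Nat.le_add_left 1 r),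
    coe_lowRoot, coe_highRoot] at h1
  simp only [hj1, if_true, Nat.add_sub_cancel] at h1
  unfold IsAdj
  split_ifs at h1 <;> omega

lemma IsRootSystem.exists_gen_mul (h : IsRootSystem G R s lowRoot (highRoot c)) (w : G)
    {r : ℕ} (hr : r + 1 < n)
    (ha : IsAdj (oneLine (w : Equiv.Perm (PM n)) r) (oneLine (w : Equiv.Perm (PM n)) (r + 1))) :
    ∃ j, s j * w = w * s ⟨r + 1, hr⟩ := by
  have hb := isSigned_oneLine (h.le w.2)
  have h1 := (hb.mem r (by omega)).2
  have h2 := (hb.mem (r + 1) hr).2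
  unfold IsAdj at ha
  set x := oneLine (w : Equiv.Perm (PM n)) r with hx
  set y := oneLine (w : Equiv.Perm (PM n)) (r + 1) with hy
  obtain ⟨j, hj⟩ : ∃ j : Fin n, j.1 = min x.natAbs y.natAbs := ⟨⟨_, by omega⟩, rfl⟩
  have hj1 : 1 ≤ j.1 := by omega
  refine ⟨j, (h.gen_mul_eq_iff _ _ _).mpr (Equiv.ext fun a =>
    Subtype.ext ?_)⟩
  rw [coe_refl_apply, coe_refl_apply, apply_lowRoot _ (Nat.le_add_left 1 r),
    apply_highRoot _ _ (Nat.le_add_left 1 r), coe_lowRoot, coe_highRoot]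
  simp only [Nat.add_sub_cancel, hj1, if_true]
  rw [← hx, ← hy]
  have h0 := PM.coe_ne_zero a
  split_ifs <;> omega

/-- For j ≥ 2, s_j w = w s_i forces the two entries exchanged by s_i to be j and j + 1, or −j and −j
− 1, in some order. The error 3 consists of 1 for i = 0 and 1 for each of j = 0 and j = 1. -/
lemma IsRootSystem.sum_conjCount (h : IsRootSystem G R s lowRoot (highRoot c)) (w : G) :
    gapSum n (fun _ => 1) (oneLine (w : Equiv.Perm (PM n))) ≤ ∑ i, conjCount s w i ∧
    ∑ i, conjCount s w i ≤ gapSum n (fun _ => 1) (oneLine (w : Equiv.Perm (PM n))) + 3 := by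
  classical
  have hs := h.isLengthSystem
  obtain _ | m := n
  · simp [gapSum]
  set b := oneLine (w : Equiv.Perm (PM (m + 1))) with hb
  have hgap : gapSum (m + 1) (fun _ => 1) b =
      ∑ i : Fin m, if IsAdj (b i) (b (i + 1)) then (1 : ℝ) else 0 := by
    have h0 : b (m + 1) = 0 := (isSigned_oneLine (h.le w.2)).zero _ le_rfl
    rw [gapSum_succ_of_eq_zero h0, gapSum,
      ← Fin.sum_univ_eq_sum_range fun r => if IsAdj (b r) (b (r + 1)) then (1 : ℝ) else 0]
  rw [hgap, Fin.sum_univ_succ]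
  have hc0 := conjCount_nonneg s w 0
  have hc1 := conjCount_le_one hs w 0
  constructor
  · refine le_add_of_nonneg_of_le hc0 (Finset.sum_le_sum fun i _ => ?_)
    split_ifs with hi
    · obtain ⟨j, hj⟩ := h.exists_gen_mul w (r := i) (Nat.succ_lt_succ i.2) hi
      have h1 := Finset.single_le_sum
        (f := fun j => if s j * w = w * s i.succ then (1 : ℝ) else 0)
        (fun j _ => by split_ifs <;> norm_num) (Finset.mem_univ j)
      rw [if_pos (show s j * w = w * s i.succ from hj)] at h1
      unfold conjCount
      convert h1
    · exact conjCount_nonneg _ _ _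
  · have hsplit : ∀ i : Fin m, conjCount s w i.succ ≤ (if IsAdj (b i) (b (i + 1)) then 1 else 0) +
        ∑ j : Fin (m + 1), if j.1 < 2 then (if s j * w = w * s i.succ then (1 : ℝ) else 0) else 0 := by
      intro i
      have h2 : conjCount s w i.succ =
          (∑ j : Fin (m + 1), if 2 ≤ j.1 ∧ s j * w = w * s i.succ then (1 : ℝ) else 0) +
          ∑ j : Fin (m + 1), if j.1 < 2 then (if s j * w = w * s i.succ then (1 : ℝ) else 0) else 0 := by
        rw [conjCount, ← Finset.sum_add_distrib]
        refine Finset.sum_congr rfl fun j _ => ?_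
        by_cases h3 : 2 ≤ j.1
        · simp [h3, not_lt.mpr h3]
        · simp [h3, not_le.mp h3]
      rw [h2]
      gcongr
      split_ifs with hi
      · exact sum_ite_le_one _ _ fun j k hj hk => hs.inj (mul_right_cancel (hj.2.trans hk.2.symm))
      · refine (Finset.sum_eq_zero fun j _ => if_neg fun hj => hi ?_).le
        exact h.isAdj_of_gen_mul w (r := i) (Nat.succ_lt_succ i.2) hj.1 hj.2
    have hsmall : ∑ i : Fin m, ∑ j : Fin (m + 1),
        (if j.1 < 2 then (if s j * w = w * s i.succ then (1 : ℝ) else 0) else 0) ≤ 2 := by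
      rw [Finset.sum_comm]
      refine (Finset.sum_le_sum (g := fun j : Fin (m + 1) => if j.1 < 2 then (1 : ℝ) else 0)
        fun j _ => ?_).trans ?_
      · split_ifs
        · exact sum_ite_le_one _ _ fun i k hi hk =>
            Fin.succ_injective _ (hs.inj (mul_left_cancel (hi.symm.trans hk)))
        · simp
      · rw [Fin.sum_univ_eq_sum_range fun j => if j < 2 then (1 : ℝ) else 0, Finset.sum_boole]
        have : ((Finset.range (m + 1)).filter fun j => j < 2).card ≤ 2 := by
          refine (Finset.card_le_card fun j hj => Finset.mem_range.mpr
            (Finset.mem_filter.mp hj).2).trans_eq (Finset.card_range 2)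
        exact_mod_cast this
    have hsum := Finset.sum_le_sum fun i (_ : i ∈ Finset.univ) => hsplit i
    rw [Finset.sum_add_distrib] at hsum
    linarith

end ConjugateGenerators
-- The adjacency variance under the Mallows laws of types B and D.
section AdjacencyVariance

variable {n : ℕ} {q : ℝ}

lemma exists_sum_seqWt_sq_gapSum_le (hq : 0 < q) {z : ℝ} (hz : z = 1 ∨ z = q) (hn : 1 ≤ n) :
    ∃ c, ∑ b ∈ signedSeqs n, seqWt q z n b * (gapSum n (fun _ => 1) b - c) ^ 2 ≤
      4 * n * ∑ b ∈ signedSeqs n, seqWt q z n b := by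
  obtain ⟨m, rfl⟩ : ∃ m, n = m + 1 := ⟨n - 1, by omega⟩
  obtain ⟨c, hc⟩ := exists_insSum_sq_gapSum_le (K := m + 1) (h := fun _ => 1) (y := fun _ _ => 0)
    hq hz m le_rfl (fun _ => zero_le_one) (fun _ => le_rfl) (fun _ _ => le_rfl)
    (fun _ _ => ⟨le_rfl, zero_le_one⟩)
  refine ⟨c, ?_⟩
  have h1 : ∑ b ∈ signedSeqs (m + 1), seqWt q z (m + 1) b =
      ∑ b ∈ signedSeqs (m + 1), seqWt q z (m + 1) b * 1 := by simp
  rw [h1, sum_signedSeqs_eq_insSum, sum_signedSeqs_eq_insSum, insSum, insSum]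
  simp only [add_zero] at hc
  refine hc.trans_eq ?_
  simp only [insTotal, mul_one]
  push_cast
  ring

lemma malE_le_of_sum_le {W ι : Type*} [Group W] [Fintype W] {s : ι → W} (hq : 0 < q) {F : W → ℝ}
    {V : ℝ} (h : ∑ g, q ^ length s g * F g ≤ V * ∑ g, q ^ length s g) : malE s q F ≤ V := by
  have h1 : malE s q F = (∑ g, q ^ length s g * F g) / ∑ g, q ^ length s g := by
    rw [malE, Finset.sum_div]
    exact Finset.sum_congr rfl fun g _ => by rw [mal]; ring
  rw [h1, div_le_iff₀ (sum_pow_length_pos s hq)]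
  exact h

/-- In type B each negative entry adds one to the length, hence z = q. -/
lemma exists_malE_sq_gapSum_le_B [Fintype (B n)] (hq : 0 < q) (hn : 1 ≤ n) :
    ∃ c, malE (genB n) q (fun w => (gapSum n (fun _ => 1)
      (oneLine (w : Equiv.Perm (PM n))) - c) ^ 2) ≤ 4 * n := by
  obtain ⟨c, hc⟩ := exists_sum_seqWt_sq_gapSum_le hq (Or.inr rfl) hn
  refine ⟨c, malE_le_of_sum_le hq ?_⟩
  have hl : ∀ w : B n, q ^ length (genB n) w = seqWt q q n (oneLine (w : Equiv.Perm (PM n))) := by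
    intro w
    have h1 := (isRootSystem_B hn).two_mul_length w
    rw [invStat_eq w.2, if_pos trivial] at h1
    rw [seqWt, ← pow_add]
    congr 1
    omega
  simp only [hl]
  rw [← sum_B_oneLine, ← sum_B_oneLine] at hc
  exact hc

/-- Exchanging the values `1` and `-1`. -/
def flipOne (a : ℤ) : ℤ := if a.natAbs = 1 then -a else a

/-- Entries ±1 never count as adjacent. This is one purpose of the lower bound 2 in `IsAdj`: it lets
the gap sum descend from B_n to D_n. -/
lemma isAdj_flipOne (a b : ℤ) : IsAdj (flipOne a) (flipOne b) ↔ IsAdj a b := by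
  unfold IsAdj flipOne
  split_ifs <;> omega

lemma pairInv_flipOne {a b : ℤ} (ha : a ≠ 0) (hb : b ≠ 0) (hab : a.natAbs ≠ b.natAbs) :
    pairInv (flipOne a) (flipOne b) = pairInv a b := by
  unfold pairInv flipOne
  split_ifs <;> omega

lemma invCount_flipOne {b : ℕ → ℤ} (hb : IsSigned n b) :
    invCount n (fun i => flipOne (b i)) = invCount n b := by
  unfold invCount
  refine Finset.sum_congr rfl fun i hi => Finset.sum_congr rfl fun j hj => ?_
  rw [Finset.mem_range] at hi hj
  split_ifs with hij
  · have h1 := (hb.mem i hi).1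
    have h2 := (hb.mem j hj).1
    exact pairInv_flipOne (by omega) (by omega) fun he => hij.ne (hb.inj i hi j hj he)
  · rfl

lemma gapSum_flipOne (K : ℕ) (h : ℕ → ℝ) (b : ℕ → ℤ) :
    gapSum K h (fun i => flipOne (b i)) = gapSum K h b := by
  classical
  unfold gapSum
  refine Finset.sum_congr rfl fun i _ => ?_
  by_cases hi : IsAdj (b i) (b (i + 1))
  · rw [if_pos hi, if_pos ((isAdj_flipOne _ _).mpr hi)]
  · rw [if_neg hi, if_neg (mt (isAdj_flipOne _ _).mp hi)]

/-- The sign change `(-1 1)`. -/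
noncomputable def signChange (hn : 1 ≤ n) : Equiv.Perm (PM n) :=
  refl (-PM.ofNat 1 le_rfl hn) (PM.ofNat 1 le_rfl hn)

lemma oneLine_signChange_mul (hn : 1 ≤ n) (w : Equiv.Perm (PM n)) :
    oneLine (signChange hn * w) = fun i => flipOne (oneLine w i) := by
  funext i
  unfold oneLine
  split_ifs with hi
  · rw [signChange, Equiv.Perm.mul_apply, coe_refl_apply]
    simp only [PM.coe_neg, PM.coe_ofNat]
    unfold flipOne
    push_cast
    split_ifs <;> omega
  · rfl

lemma negCount_signChange (hn : 1 ≤ n) : negCount (signChange hn) = 1 := by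
  rw [negCount, Finset.card_eq_one]
  refine ⟨PM.ofNat 1 le_rfl hn, ?_⟩
  ext x
  have hx := PM.coe_ne_zero x
  simp only [Finset.mem_filter, Finset.mem_univ, true_and, Finset.mem_singleton, signChange,
    coe_refl_apply, Subtype.ext_iff, PM.coe_neg, PM.coe_ofNat]
  push_cast
  split_ifs <;> omega

/-- Left multiplication by (−1 1) changes the parity of the number of negative entries, so it
exchanges D_n with its complement in B_n. -/
lemma sum_B_eq_two_mul_sum_D [Fintype (B n)] [Fintype (D n)] (hn : 1 ≤ n)
    (F : Equiv.Perm (PM n) → ℝ) (hF : ∀ w ∈ B n, F (signChange hn * w) = F w) :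
    ∑ w : B n, F w = 2 * ∑ w : D n, F w := by
  classical
  have hB : ∑ w : B n, F w = ∑ w ∈ Finset.univ.filter (· ∈ B n), F w :=
    (Finset.sum_subtype _ (fun w => by simp) F).symm
  have hD : ∑ w : D n, F w = ∑ w ∈ Finset.univ.filter (· ∈ D n), F w :=
    (Finset.sum_subtype _ (fun w => by simp) F).symm
  have ht : signChange hn ∈ B n := refl_mem_B _ _
  have hpar : ∀ w ∈ B n, (Even (negCount (signChange hn * w)) ↔ ¬ Even (negCount w)) := by
    intro w hw
    rw [even_negCount_mul ht hw, negCount_signChange, add_comm, Nat.even_add_one]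
  have htt : ∀ w, signChange hn * (signChange hn * w) = w := fun w => by
    rw [← mul_assoc, signChange, refl_mul_self, one_mul]
  rw [hB, hD, ← Finset.sum_filter_add_sum_filter_not _ fun w => Even (negCount w), two_mul,
    Finset.filter_filter, Finset.filter_filter]
  congr 1
  refine Finset.sum_nbij' (fun w => signChange hn * w) (fun w => signChange hn * w) ?_ ?_ ?_ ?_ ?_
  · intro w hw
    simp only [Finset.mem_filter, Finset.mem_univ, true_and, mem_D] at hw ⊢
    exact ⟨(B n).mul_mem ht hw.1, (hpar w hw.1).mpr hw.2⟩
  · intro w hw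
    simp only [Finset.mem_filter, Finset.mem_univ, true_and, mem_D] at hw ⊢
    exact ⟨(B n).mul_mem ht hw.1, fun he => (hpar w hw.1).mp he hw.2⟩
  · exact fun w _ => htt w
  · exact fun w _ => htt w
  · intro w hw
    simp only [Finset.mem_filter, Finset.mem_univ, true_and] at hw
    exact (hF w hw.1).symm

/-- With z = 1 the weight q^`invCount` makes sense on all of B_n and restricts to the Mallows weight
of D_n. Both it and the gap sum are invariant under the sign change of ±1, so the second moment on
B_n equals the one on D_n. -/
lemma exists_malE_sq_gapSum_le_D [Fintype (D n)] (hq : 0 < q) (hn : 2 ≤ n) :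
    ∃ c, malE (genD n) q (fun w => (gapSum n (fun _ => 1)
      (oneLine (w : Equiv.Perm (PM n))) - c) ^ 2) ≤ 4 * n := by
  classical
  have hn1 : 1 ≤ n := by omega
  obtain ⟨c, hc⟩ := exists_sum_seqWt_sq_gapSum_le hq (Or.inl rfl) hn1
  refine ⟨c, malE_le_of_sum_le hq ?_⟩
  have hl : ∀ w : D n, q ^ length (genD n) w = seqWt q 1 n (oneLine (w : Equiv.Perm (PM n))) := by
    intro w
    have h1 := (isRootSystem_D hn).two_mul_length w
    rw [invStat_eq w.2.1, if_neg not_false] at h1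
    rw [seqWt, one_pow, mul_one]
    congr 1
    omega
  simp only [hl]
  have hwt : ∀ w ∈ B n, seqWt q 1 n (oneLine (signChange hn1 * w)) = seqWt q 1 n (oneLine w) :=
    fun w hw => by
      rw [oneLine_signChange_mul, seqWt, seqWt, invCount_flipOne (isSigned_oneLine hw), one_pow,
        one_pow]
  rw [← sum_B_oneLine, ← sum_B_oneLine,
    sum_B_eq_two_mul_sum_D hn1 (fun w => seqWt q 1 n (oneLine w)) hwt,
    sum_B_eq_two_mul_sum_D hn1 (fun w => seqWt q 1 n (oneLine w) *
      (gapSum n (fun _ => 1) (oneLine w) - c) ^ 2) fun w hw => by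
        rw [hwt w hw, oneLine_signChange_mul, gapSum_flipOne]] at hc
  linarith

end AdjacencyVariance
-- Mean, variance and squared jumps of the total jump.
section NormalApproximation

variable {m : ℕ} {G : Subgroup (Equiv.Perm (PM (m + 4)))} {R : PM (m + 4) → PM (m + 4) → Prop}
  {s : Fin (m + 4) → G} {c : PM (m + 4)} {q : ℝ}

lemma sum_fin_add_four (f : Fin (m + 4) → ℝ) : ∑ i, f i =
    ∑ t : Fin m, f ⟨t + 3, by omega⟩ + (f 0 + f 1 + f 2 + f (Fin.last (m + 3))) := by
  rw [Fin.sum_univ_castSucc, Fin.sum_univ_succ, Fin.sum_univ_succ, Fin.sum_univ_succ]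
  have h : ∀ t : Fin m, f (Fin.castSucc t.succ.succ.succ) = f ⟨t + 3, by omega⟩ := fun _ => rfl
  simp only [h]
  have h0 : f (Fin.castSucc 0) = f 0 := rfl
  have h1 : f (Fin.castSucc (Fin.succ 0)) = f 1 := rfl
  have h2 : f (Fin.castSucc (Fin.succ (Fin.succ 0))) = f 2 := rfl
  rw [h0, h1, h2]
  ring

/-- The error is 23 = 4 · 5 + 3: four generators near the ends with local jump at most 5 in absolute
value, and 3 from `sum_conjCount`. -/
lemma IsRootSystem.abs_totalJump_sub_le (h : IsRootSystem G R s lowRoot (highRoot c))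
    (hc : (c : ℤ) = 1 ∨ (c : ℤ) = 2) (w : G) :
    |totalJump s w - (m - ∑ t ∈ Finset.range m, medFirst (oneLine (w : Equiv.Perm (PM (m + 4)))) (t + 1) -
      ∑ t ∈ Finset.range m, medLast (oneLine (w : Equiv.Perm (PM (m + 4)))) (t + 2) +
      gapSum (m + 4) (fun _ => 1) (oneLine (w : Equiv.Perm (PM (m + 4)))))| ≤ 23 := by
  have h1 : totalJump s w = ∑ i, localJump s w i + ∑ i, conjCount s w i := by
    rw [totalJump, ← Finset.sum_add_distrib]
    exact Finset.sum_congr rfl fun i _ => desJump_eq h.isLengthSystem w i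
  have h2 : ∑ t : Fin m, localJump s w ⟨t + 3, by omega⟩ =
      m - ∑ t ∈ Finset.range m, medFirst (oneLine (w : Equiv.Perm (PM (m + 4)))) (t + 1) -
      ∑ t ∈ Finset.range m, medLast (oneLine (w : Equiv.Perm (PM (m + 4)))) (t + 2) := by
    rw [← Fin.sum_univ_eq_sum_range fun t => medFirst (oneLine (w : Equiv.Perm (PM (m + 4)))) (t + 1),
      ← Fin.sum_univ_eq_sum_range fun t => medLast (oneLine (w : Equiv.Perm (PM (m + 4)))) (t + 2)]
    have h3 : ∀ t : Fin m, localJump s w ⟨t + 3, by omega⟩ =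
        1 - medFirst (oneLine (w : Equiv.Perm (PM (m + 4)))) (t + 1) -
        medLast (oneLine (w : Equiv.Perm (PM (m + 4)))) (t + 2) := fun t => h.localJump_eq hc w (by omega)
    simp only [h3, Finset.sum_sub_distrib]
    simp
  rw [h1, sum_fin_add_four, h2]
  have h4 := h.sum_conjCount w
  have a0 := abs_le.mp (h.abs_localJump_le hc w 0)
  have a1 := abs_le.mp (h.abs_localJump_le hc w 1)
  have a2 := abs_le.mp (h.abs_localJump_le hc w 2)
  have a3 := abs_le.mp (h.abs_localJump_le hc w (Fin.last (m + 3)))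
  rw [abs_le]
  constructor <;> linarith [h4.1, h4.2]

/-- The m interior jumps lie in [−1, 2], the four others in [−5, 6]. -/
lemma IsRootSystem.sum_sq_desJump_le (h : IsRootSystem G R s lowRoot (highRoot c))
    (hc : (c : ℤ) = 1 ∨ (c : ℤ) = 2) (w : G) : ∑ i, desJump s w i ^ 2 ≤ 4 * m + 144 := by
  have hs := h.isLengthSystem
  have h1 : ∀ i, desJump s w i ^ 2 ≤ 36 := fun i => by
    have a := abs_le.mp (h.abs_localJump_le hc w i)
    have b := conjCount_nonneg s w i
    have b' := conjCount_le_one hs w i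
    rw [desJump_eq hs]
    nlinarith
  have h2 : ∀ t : Fin m, desJump s w ⟨t + 3, by omega⟩ ^ 2 ≤ 4 := fun t => by
    have a := medFirst_mem (oneLine (w : Equiv.Perm (PM (m + 4)))) (t + 1)
    have a' := medLast_mem (oneLine (w : Equiv.Perm (PM (m + 4)))) (t + 2)
    have b := conjCount_nonneg s w ⟨t + 3, by omega⟩
    have b' := conjCount_le_one hs w ⟨t + 3, by omega⟩
    rw [desJump_eq hs, h.localJump_eq hc w (by omega)]
    nlinarith
  have h3 := Finset.sum_le_sum fun t (_ : t ∈ Finset.univ) => h2 t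
  rw [Finset.sum_const, Finset.card_univ, Fintype.card_fin, nsmul_eq_mul] at h3
  rw [sum_fin_add_four]
  linarith [h1 0, h1 1, h1 2, h1 (Fin.last (m + 3))]

variable [Fintype G]

lemma IsRootSystem.malE_med (h : IsRootSystem G R s lowRoot (highRoot c)) (hq : 0 < q) {r : ℕ}
    (hr : r + 2 < m + 4) :
    malE s q (fun w => medFirst (oneLine (w : Equiv.Perm (PM (m + 4)))) r) = medProb q ∧
    malE s q (fun w => medLast (oneLine (w : Equiv.Perm (PM (m + 4)))) r) = medProb q := by
  have := h.malE_med_mul hq hr (F := fun _ => 1) (fun _ => rfl) fun _ => rfl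
  simpa only [mul_one, malE_const s hq] using this

lemma IsRootSystem.le_malE_totalJump (h : IsRootSystem G R s lowRoot (highRoot c))
    (hc : (c : ℤ) = 1 ∨ (c : ℤ) = 2) (hq : 0 < q) : m / 3 - 23 ≤ malE s q (totalJump s) := by
  have hgap : ∀ w : G, 0 ≤ gapSum (m + 4) (fun _ => 1) (oneLine (w : Equiv.Perm (PM (m + 4)))) := fun w =>
    Finset.sum_nonneg fun _ _ => by split_ifs <;> norm_num
  refine le_trans ?_ (malE_mono hq (F := fun w : G => ((m - 23 : ℝ) -
    ∑ t ∈ Finset.range m, medFirst (oneLine (w : Equiv.Perm (PM (m + 4)))) (t + 1)) -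
    ∑ t ∈ Finset.range m, medLast (oneLine (w : Equiv.Perm (PM (m + 4)))) (t + 2)) fun w => ?_)
  · rw [malE_sub, malE_sub, malE_const s hq, malE_sum, malE_sum]
    have h1 : ∀ t ∈ Finset.range m,
        malE s q (fun w => medFirst (oneLine (w : Equiv.Perm (PM (m + 4)))) (t + 1)) = medProb q := fun t ht =>
      (h.malE_med hq (by have := Finset.mem_range.mp ht; omega)).1
    have h2 : ∀ t ∈ Finset.range m,
        malE s q (fun w => medLast (oneLine (w : Equiv.Perm (PM (m + 4)))) (t + 2)) = medProb q := fun t ht =>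
      (h.malE_med hq (by have := Finset.mem_range.mp ht; omega)).2
    rw [Finset.sum_congr rfl h1, Finset.sum_congr rfl h2, Finset.sum_const, Finset.card_range,
      nsmul_eq_mul]
    have h3 := medProb_le hq
    have h4 : (0 : ℝ) ≤ m := Nat.cast_nonneg m
    nlinarith
  · have h1 := abs_le.mp (h.abs_totalJump_sub_le hc w)
    have h2 := hgap w
    linarith [h1.1]

lemma IsRootSystem.malE_sq_totalJump_sub_le (h : IsRootSystem G R s lowRoot (highRoot c))
    (hc : (c : ℤ) = 1 ∨ (c : ℤ) = 2) (hq : 0 < q) {a : ℝ}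
    (ha : malE s q (fun w => (gapSum (m + 4) (fun _ => 1) (oneLine (w : Equiv.Perm (PM (m + 4)))) - a) ^ 2) ≤
      4 * (m + 4 : ℕ)) :
    malE s q (fun w => (totalJump s w - (m - 2 * (m * medProb q) + a)) ^ 2) ≤ 56 * m + 2180 := by
  set X : G → ℝ := fun w => ∑ k ∈ Finset.Ico 1 (m + 1),
    (medFirst (oneLine (w : Equiv.Perm (PM (m + 4)))) k - medProb q) with hX
  set Y : G → ℝ := fun w => ∑ k ∈ Finset.Ico 2 (m + 2),
    (medLast (oneLine (w : Equiv.Perm (PM (m + 4)))) k - medProb q) with hY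
  set A : G → ℝ := fun w => gapSum (m + 4) (fun _ => 1) (oneLine (w : Equiv.Perm (PM (m + 4)))) - a with hA
  have hXe : ∀ w, X w = ∑ t ∈ Finset.range m, medFirst (oneLine (w : Equiv.Perm (PM (m + 4)))) (t + 1) -
      m * medProb q := fun w => by
    simp only [hX]
    rw [Finset.sum_sub_distrib, Finset.sum_Ico_eq_sum_range]
    simp [add_comm]
  have hYe : ∀ w, Y w = ∑ t ∈ Finset.range m, medLast (oneLine (w : Equiv.Perm (PM (m + 4)))) (t + 2) -
      m * medProb q := fun w => by
    simp only [hY]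
    rw [Finset.sum_sub_distrib, Finset.sum_Ico_eq_sum_range]
    simp [add_comm]
  have hX2 : malE s q (fun w => X w ^ 2) ≤ 5 * m := by
    have := h.malE_sq_sum_medFirst_le hq (Finset.Ico 1 (m + 1)) fun k hk => by
      rw [Finset.mem_Ico] at hk; omega
    rw [Nat.card_Ico, Nat.add_sub_cancel] at this
    exact this
  have hY2 : malE s q (fun w => Y w ^ 2) ≤ 5 * m := by
    have := h.malE_sq_sum_medLast_le hq (Finset.Ico 2 (m + 2)) fun k hk => by
      rw [Finset.mem_Ico] at hk; omega
    rw [Nat.card_Ico, Nat.add_sub_cancel] at this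
    exact this
  -- The square of a sum of four terms is at most four times the sum of the squares; 529 = 23²
  -- bounds the square of the error term.
  refine (malE_mono hq (G := fun w => 4 * (((X w ^ 2 + Y w ^ 2) + A w ^ 2) + 529))
    fun w => ?_).trans ?_
  · have h1 := h.abs_totalJump_sub_le hc w
    set T := totalJump s w - (m - ∑ t ∈ Finset.range m, medFirst (oneLine (w : Equiv.Perm (PM (m + 4)))) (t + 1) -
      ∑ t ∈ Finset.range m, medLast (oneLine (w : Equiv.Perm (PM (m + 4)))) (t + 2) +
      gapSum (m + 4) (fun _ => 1) (oneLine (w : Equiv.Perm (PM (m + 4))))) with hT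
    have h2 : totalJump s w - (m - 2 * (m * medProb q) + a) = T + A w - X w - Y w := by
      rw [hXe, hYe, hT]; simp only [hA]; ring
    have h3 : T ^ 2 ≤ 529 := by
      rw [← sq_abs]; nlinarith [abs_nonneg T]
    rw [h2]
    nlinarith [sq_nonneg (T - A w), sq_nonneg (T + X w), sq_nonneg (T + Y w), sq_nonneg (A w + X w),
      sq_nonneg (A w + Y w), sq_nonneg (X w - Y w)]
  · rw [malE_mul_left, malE_add, malE_add, malE_add, malE_const s hq]
    push_cast at ha
    linarith

end NormalApproximation

/-! ### Numerical constants. -/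

section Constants

variable {q : ℝ}

lemma one_le_max_rpow (hq : 0 < q) : 1 ≤ max (q ^ (-1 / 2 : ℝ)) (q ^ (1 / 2 : ℝ)) := by
  rcases le_total 1 q with h | h
  · exact le_max_of_le_right (Real.one_le_rpow h (by norm_num))
  · exact le_max_of_le_left (Real.one_le_rpow_of_pos_of_le_one_of_nonpos hq h (by norm_num))

/-- Indeed √(q/(1+q)²) = 1 / (q^(−1/2) + q^(1/2)). -/
lemma inv_le_sqrt_mul (hq : 0 < q) :
    1 / (2 * max (q ^ (-1 / 2 : ℝ)) (q ^ (1 / 2 : ℝ))) ≤ √(q / (1 + q) ^ 2) := by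
  set M := max (q ^ (-1 / 2 : ℝ)) (q ^ (1 / 2 : ℝ))
  have h1 : q ^ (1 / 2 : ℝ) = √q := (Real.sqrt_eq_rpow q).symm
  have h2 : q ^ (-1 / 2 : ℝ) = (√q)⁻¹ := by
    rw [show (-1 / 2 : ℝ) = -(1 / 2) by norm_num, Real.rpow_neg hq.le, h1]
  have h3 : 0 < √q := Real.sqrt_pos.mpr hq
  have h4 : √q ≤ M := h1 ▸ le_max_right _ _
  have h5 : (√q)⁻¹ ≤ M := h2 ▸ le_max_left _ _
  have h6 : √(q / (1 + q) ^ 2) = √q / (1 + q) := by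
    rw [Real.sqrt_div hq.le, Real.sqrt_sq (by positivity)]
  have h7 : √q * √q = q := Real.mul_self_sqrt hq.le
  have h8 : √q * (√q)⁻¹ = 1 := mul_inv_cancel₀ h3.ne'
  rw [h6, div_le_div_iff₀ (by linarith) (by positivity)]
  nlinarith

lemma stein_constant_le (hq : 0 < q) {n : ℕ} (hn : 1000 ≤ n) :
    2 * √(64 * n) / (3 / 10 * n) +
      2 * (5 * n) / (3 / 10 * n * √(2 * (q / (1 + q) ^ 2) * (3 / 10 * n))) ≤
    (180 + 236 * max (q ^ (-1 / 2 : ℝ)) (q ^ (1 / 2 : ℝ))) * (n : ℝ) ^ (-1 / 2 : ℝ) := by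
  have hM := one_le_max_rpow hq
  have hv := inv_le_sqrt_mul hq
  set M := max (q ^ (-1 / 2 : ℝ)) (q ^ (1 / 2 : ℝ))
  have hn0 : (0 : ℝ) < n := by exact_mod_cast (by omega : 0 < n)
  have hr : (0 : ℝ) < √n := Real.sqrt_pos.mpr hn0
  have hrr : √(n : ℝ) * √n = n := Real.mul_self_sqrt hn0.le
  have e1 : (n : ℝ) ^ (-1 / 2 : ℝ) = 1 / √n := by
    rw [show (-1 / 2 : ℝ) = -(1 / 2) by norm_num, Real.rpow_neg hn0.le, ← Real.sqrt_eq_rpow,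
      one_div]
  have e2 : √(64 * n) = 8 * √n := by
    rw [Real.sqrt_mul (by norm_num), show (64 : ℝ) = 8 ^ 2 by norm_num, Real.sqrt_sq (by norm_num)]
  have e3 : √(2 * (q / (1 + q) ^ 2) * (3 / 10 * n)) = √(3 / 5) * √(q / (1 + q) ^ 2) * √n := by
    rw [show 2 * (q / (1 + q) ^ 2) * (3 / 10 * n) = 3 / 5 * (q / (1 + q) ^ 2) * n by ring,
      Real.sqrt_mul (by positivity), Real.sqrt_mul (by positivity)]
  have e4 : 3 / 4 ≤ √(3 / 5 : ℝ) := Real.le_sqrt_of_sq_le (by norm_num)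
  have h1 : 2 * √(64 * n) / (3 / 10 * n) ≤ 180 * (1 / √n) := by
    rw [e2, mul_one_div, div_le_div_iff₀ (by positivity) hr]
    nlinarith
  have h2 : 2 * (5 * n) / (3 / 10 * n * √(2 * (q / (1 + q) ^ 2) * (3 / 10 * n))) ≤
      236 * M * (1 / √n) := by
    rw [e3]
    have h3 : 3 / 4 * (1 / (2 * M)) * √n ≤ √(3 / 5) * √(q / (1 + q) ^ 2) * √n := by gcongr
    have h4 : 0 < 3 / 4 * (1 / (2 * M)) * √n := by positivity
    calc 2 * (5 * n) / (3 / 10 * n * (√(3 / 5) * √(q / (1 + q) ^ 2) * √n))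
        ≤ 2 * (5 * n) / (3 / 10 * n * (3 / 4 * (1 / (2 * M)) * √n)) := by gcongr
      _ = 800 / 9 * M * (1 / √n) := by
        have : M ≠ 0 := by linarith
        field_simp
        norm_num
      _ ≤ 236 * M * (1 / √n) := by gcongr; norm_num
  rw [e1, add_mul]
  exact add_le_add h1 h2

lemma three_le_constant (hq : 0 < q) {n : ℕ} (hn1 : 1 ≤ n) (hn : n ≤ 1000) :
    3 ≤ (180 + 236 * max (q ^ (-1 / 2 : ℝ)) (q ^ (1 / 2 : ℝ))) * (n : ℝ) ^ (-1 / 2 : ℝ) := by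
  have hM := one_le_max_rpow hq
  have hn0 : (0 : ℝ) < n := by exact_mod_cast hn1
  have e1 : (n : ℝ) ^ (-1 / 2 : ℝ) = 1 / √n := by
    rw [show (-1 / 2 : ℝ) = -(1 / 2) by norm_num, Real.rpow_neg hn0.le, ← Real.sqrt_eq_rpow,
      one_div]
  have hr : √(n : ℝ) ≤ 100 := Real.sqrt_le_iff.mpr ⟨by norm_num, by
    have : (n : ℝ) ≤ 1000 := by exact_mod_cast hn
    linarith⟩
  rw [e1, mul_one_div, le_div_iff₀ (Real.sqrt_pos.mpr hn0)]
  linarith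

end Constants

/-! ### The normal approximation for both types. -/

section MainBound

variable {Ω Ω' : Type*} [MeasurableSpace Ω] [MeasurableSpace Ω'] {P : Measure Ω}
  [IsProbabilityMeasure P] {n : ℕ} {G : Subgroup (Equiv.Perm (PM n))} [Fintype G]
  {R : PM n → PM n → Prop} {s : Fin n → G} {c : PM n} {q : ℝ}

/-- Normal approximation of the two-sided descent statistic. -/
theorem IsRootSystem.wassersteinOne_le (h : IsRootSystem G R s lowRoot (highRoot c))
    (hc : (c : ℤ) = 1 ∨ (c : ℤ) = 2) (hq : 0 < q) (hn1 : 1 ≤ n) {a : ℝ}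
    (ha : malE s q (fun w => (gapSum n (fun _ => 1) (oneLine (w : Equiv.Perm (PM n))) - a) ^ 2) ≤ 4 * n)
    {w : Ω → G} (hw : IsMallows s q P w) (Q : Measure Ω') [IsProbabilityMeasure Q] {Z : Ω' → ℝ}
    (hZ : HasLaw Z (gaussianReal 0 1) Q) :
    wassersteinOne P (normalized P fun ω => (twoSidedDes s (w ω) : ℝ)) Q Z ≤ ENNReal.ofReal
      ((180 + 236 * max (q ^ (-1 / 2 : ℝ)) (q ^ (1 / 2 : ℝ))) * (n : ℝ) ^ (-1 / 2 : ℝ)) := by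
  refine hw.wassersteinOne_le h.isLengthSystem hq Q hZ fun f f' hf hf1 hf2 hlip σ hσ => ?_
  -- Up to 1000 the claimed bound exceeds the trivial bound 3. From 1000 on, the additive constants
  -- 23, 2180 and 144 are absorbed into linear bounds with coefficients 3/10, 64 and 5.
  rcases le_total n 1000 with hn | hn
  · exact (stein_bound_trivial hq hσ hf1 hf2).trans (three_le_constant hq hn1 hn)
  · obtain ⟨m, rfl⟩ : ∃ m, n = m + 4 := ⟨n - 4, by omega⟩
    have hm : (996 : ℝ) ≤ m := by exact_mod_cast (by omega : 996 ≤ m)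
    refine (stein_bound h.isLengthSystem hq (L := 3 / 10 * (m + 4 : ℕ)) (V := 64 * (m + 4 : ℕ))
      (S := 5 * (m + 4 : ℕ)) (by positivity) ((?_ : _ ≤ (m : ℝ) / 3 - 23).trans
      (h.le_malE_totalJump hc hq)) ((h.malE_sq_totalJump_sub_le hc hq ha).trans ?_)
      ((malE_mono hq fun w => h.sum_sq_desJump_le hc w).trans ?_) hσ hf hf2 hlip).trans
      (stein_constant_le hq hn)
    · push_cast; linarith
    · push_cast; linarith
    · rw [malE_const s hq]; push_cast; linarith

end MainBound
end Mallows

theorem mainTheorem4 {Ω Ω' : Type*} [MeasurableSpace Ω] [MeasurableSpace Ω']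
    (P : Measure Ω) [IsProbabilityMeasure P] (Q : Measure Ω') [IsProbabilityMeasure Q]
    (Z : Ω' → ℝ) (hZ : HasLaw Z (gaussianReal 0 1) Q) (q : ℝ) (hq : 0 < q) :
    (∀ (n : ℕ) (w : Ω → Mallows.B n), 4 ≤ n → Mallows.IsMallows (Mallows.genB n) q P w →
      Mallows.wassersteinOne P
          (Mallows.normalized P fun ω => (Mallows.twoSidedDes (Mallows.genB n) (w ω) : ℝ)) Q Z ≤
        ENNReal.ofReal
          ((180 + 236 * max (q ^ (-1 / 2 : ℝ)) (q ^ (1 / 2 : ℝ))) * (n : ℝ) ^ (-1 / 2 : ℝ))) ∧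
    (∀ (n : ℕ) (w : Ω → Mallows.D n), 30 ≤ n → Mallows.IsMallows (Mallows.genD n) q P w →
      Mallows.wassersteinOne P
          (Mallows.normalized P fun ω => (Mallows.twoSidedDes (Mallows.genD n) (w ω) : ℝ)) Q Z ≤
        ENNReal.ofReal
          ((384 + 666 * max (q ^ (-1 / 2 : ℝ)) (q ^ (1 / 2 : ℝ))) * (n : ℝ) ^ (-1 / 2 : ℝ))) := by
  constructor
  · intro n w hn hw
    obtain ⟨a, ha⟩ := Mallows.exists_malE_sq_gapSum_le_B (n := n) hq (by omega)
    exact (Mallows.isRootSystem_B (n := n) (by omega)).wassersteinOne_le (Or.inl rfl) hq (by omega) ha hw Q hZ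
  · intro n w hn hw
    obtain ⟨a, ha⟩ := Mallows.exists_malE_sq_gapSum_le_D (n := n) hq (by omega)
    -- The common argument gives type D the constants of type B, which are smaller than those
    -- claimed.
    refine ((Mallows.isRootSystem_D (n := n) (by omega)).wassersteinOne_le (Or.inr rfl) hq (by omega) ha hw
      Q hZ).trans (ENNReal.ofReal_le_ofReal ?_)
    have hM := Mallows.one_le_max_rpow hq
    gcongr <;> norm_num
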